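/- **Setting.** Let $k$ be an algebraically closed field of characteristic $p>0$, let $K_0=\operatorname{Frac}(W(k))$, and let $K_n=K_0(\zeta_{p^n})$, where $\zeta_{p^n}$ is a primitive $p^n$-th root of unity in a fixed algebraic closure of $K_0$. For a finite extension $L/K_0$ let $v_L$ be its valuation, normalized so that uniformizers have valuation $1$ and $v_L(0)=\infty$; write $v_\ell=v_{K_\ell}$. For a finite Galois extension $L/K_0$ with group $G$, the lower ramification groups are $G_i=\{g\in G: v_L(g\pi_L-\pi_L)\ge i+1\}$ for real $i\ge 0$ ($\pi_L$ a uniformizer of $L$), the upper ones are $G^i=G_{\psi(i)}$, where $\psi$ is the inverse of the function $\varphi(u)=\int_0^u \frac{dt}{[G_0:G_t]}$ on $[0,\infty)$, and the conductor is $h_{L/K_0}=\sup\{i\ge 0: G^i\ne\{\mathrm{id}\}\}$ (with $h_{L/K_0}=0$ if $L=K_0$). A nonzero element $a=1+t\in K_\ell$ is called *$p$-primitive for $K_\ell$* if either $p\nmid v_\ell(a)$, or $0<v_\ell(t)<\frac{p}{p-1}v_\ell(p)$ and $p\nmid v_\ell(t)$. **Statement.** Let $\ell\ge 1$ and $c\ge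 1$ be integers and let $\alpha\in K_\ell$ with $v_\ell(\alpha)\ge 0$ (not necessarily $p$-primitive). Then $\alpha$ can be written as $\alpha=\alpha'\beta^p$ with $\alpha',\beta\in K_\ell$, $v_\ell(\beta)\ge 0$, and $\alpha'$ either equal to $1$ or $p$-primitive for $K_\ell$. For every such decomposition, write $\alpha'=1+t_{\alpha'}$ and $\beta=1+t_\beta$, and let $L$ be the Galois closure of $K_{\max(\ell,c)}(\sqrt[p^c]{\alpha})$ over $K_0$ (for any choice of the root). Then $$h_{L/K_0}\le \max\left(\max(\ell,c)-1,\;\; c+\ell-1-\frac{v_\ell(t_{\alpha'})-1}{p^{\ell-1}(p-1)},\;\; c+\ell-2-\frac{v_\ell(t_\beta)-1}{p^{\ell-1}(p-1)}\right),$$ where a term containing $v_\ell(0)=\infty$ is read as $-\infty$. -/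

import Mathlib

namespace WittKummer

/-! ### The base field `K₀ = Frac W(k)` and normalized valuations -/

/-- The field `K₀ = Frac(W(k))`. -/
abbrev K₀ (p : ℕ) [Fact p.Prime] (k : Type*) [Field k] [CharP k p] : Type _ :=
  FractionRing (WittVector p k)

theorem charZero_K₀ (p : ℕ) [Fact p.Prime] (k : Type*) [Field k] [CharP k p] :
    CharZero (K₀ p k) := by
  have h0 : (p : WittVector p k) ≠ 0 := WittVector.p_nonzero p k
  have : CharZero (WittVector p k) := by
    refine charZero_of_inj_zero fun n hn => ?_
    induction n using Nat.strong_induction_on with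
    | _ n ih =>
      by_contra hn0
      have hc : ((n : ℕ) : k) = 0 := by
        have := congrArg (WittVector.constantCoeff (p := p) (R := k)) hn
        simpa using this
      obtain ⟨m, rfl⟩ := (CharP.cast_eq_zero_iff k p n).1 hc
      have hm : (m : WittVector p k) = 0 := by
        have : (p : WittVector p k) * (m : WittVector p k) = 0 := by exact_mod_cast hn
        exact (mul_eq_zero.1 this).resolve_left h0
      have hm0 : m ≠ 0 := by rintro rfl; simp at hn0
      exact hm0 (ih m (by
        have := (Fact.out : p.Prime).two_le
        nlinarith [Nat.pos_of_ne_zero hm0]) hm)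
  exact charZero_of_injective_algebraMap (IsFractionRing.injective (WittVector p k) (K₀ p k))

/-- `v : L → ℤ ∪ {∞}` is a normalized discrete valuation on the extension `L` of `K₀`:
it is surjective (uniformizers have valuation `1`) and nonnegative on the image of `W(k)`.
For `L / K₀` finite there is exactly one such `v`. -/
def IsNormalizedVal (p : ℕ) [Fact p.Prime] (k : Type*) [Field k] [CharP k p]
    {L : Type*} [Field L] [Algebra (K₀ p k) L] (v : AddValuation L (WithTop ℤ)) : Prop :=
  Function.Surjective v ∧
    ∀ a : WittVector p k,
      0 ≤ v (algebraMap (K₀ p k) L (algebraMap (WittVector p k) (K₀ p k) a))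

/-- Rewriting a multiplicative `ℤᵐ⁰`-valued valuation additively. -/
theorem exists_addValuation {L : Type*} [Field L]
    (w : Valuation L (WithZero (Multiplicative ℤ))) :
    ∃ v : AddValuation L (WithTop ℤ), ∀ x, v x = if w x = 0 then ⊤ else
      ((-WithZero.log (w x) : ℤ) : WithTop ℤ) := by
  refine ⟨AddValuation.of (fun x => if w x = 0 then ⊤ else
      ((-WithZero.log (w x) : ℤ) : WithTop ℤ)) (by simp) (by simp) ?_ ?_, fun x => rfl⟩
  · intro x y
    by_cases hxy : w (x + y) = 0
    · simp [hxy]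
    by_cases hx : w x = 0
    · have hx' : x = 0 := by simpa using hx
      rw [hx', map_zero, zero_add]; simp
    by_cases hy : w y = 0
    · have hy' : y = 0 := by simpa using hy
      rw [hy', map_zero, add_zero]; simp
    simp only [hx, hy, hxy, if_false]
    rw [min_le_iff]
    rcases le_max_iff.1 (w.map_add x y) with h | h
    · left
      exact_mod_cast neg_le_neg ((WithZero.log_le_log hxy hx).2 h)
    · right
      exact_mod_cast neg_le_neg ((WithZero.log_le_log hxy hy).2 h)
  · intro x y
    by_cases hx : w x = 0
    · simp [hx]
    by_cases hy : w y = 0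
    · simp [hy]
    simp only [map_mul, hx, hy, mul_eq_zero, or_self, if_false]
    rw [WithZero.log_mul hx hy]
    rw [← WithTop.coe_add, neg_add]

theorem exists_isNormalizedVal (p : ℕ) [Fact p.Prime] (k : Type*) [Field k] [CharP k p]
    [IsAlgClosed k] (L : Type*) [Field L] [Algebra (K₀ p k) L] [FiniteDimensional (K₀ p k) L] :
    ∃ v : AddValuation L (WithTop ℤ), IsNormalizedVal p k v := by
  have := charZero_K₀ p k
  let A := WittVector p k
  let _ : Algebra A L := ((algebraMap (K₀ p k) L).comp (algebraMap A (K₀ p k))).toAlgebra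
  have : IsScalarTower A (K₀ p k) L := IsScalarTower.of_algebraMap_eq fun _ => rfl
  let B := integralClosure A L
  have : IsFractionRing B L := integralClosure.isFractionRing_of_finite_extension (K₀ p k) L
  have : IsDedekindDomain B := integralClosure.isDedekindDomain A (K₀ p k) L
  have hB : ¬ IsField B := by
    intro h
    have hinj : Function.Injective (algebraMap A B) := by
      have : Function.Injective (algebraMap A L) :=
        (algebraMap (K₀ p k) L).injective.comp (IsFractionRing.injective A (K₀ p k))
      rw [IsScalarTower.algebraMap_eq A B L] at this
      exact Function.Injective.of_comp (f := algebraMap B L) (by simpa using this)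
    exact IsDiscreteValuationRing.not_isField A (isField_of_isIntegral_of_isField hinj h)
  obtain ⟨M, hM⟩ := Ideal.exists_maximal B
  let P : IsDedekindDomain.HeightOneSpectrum B :=
    ⟨M, hM.isPrime, Ring.ne_bot_of_isMaximal_of_not_isField hM hB⟩
  obtain ⟨v, hv⟩ := exists_addValuation (P.valuation L)
  refine ⟨v, ?_, ?_⟩
  · intro y
    induction y using WithTop.recTopCoe with
    | top => exact ⟨0, by simp⟩
    | coe n =>
      obtain ⟨x, hx⟩ := P.valuation_surjective L (WithZero.exp (-n))
      refine ⟨x, ?_⟩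
      rw [hv, hx]
      simp
  · intro a
    have h1 : P.valuation L (algebraMap (K₀ p k) L (algebraMap A (K₀ p k) a)) ≤ 1 := by
      exact P.valuation_le_one (K := L) (algebraMap A B a)
    rw [hv]
    split_ifs with h
    · exact le_top
    · have h2 := (WithZero.log_le_log h one_ne_zero).2 h1
      rw [WithZero.log_one] at h2
      exact_mod_cast neg_nonneg.2 h2

/-- The normalized valuation `v_L` of a finite extension `L` of `K₀` (unique, since `W(k)` is a
complete discrete valuation ring). -/
noncomputable def normVal (p : ℕ) [Fact p.Prime] (k : Type*) [Field k] [CharP k p]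
    [IsAlgClosed k] (L : Type*) [Field L] [Algebra (K₀ p k) L] [FiniteDimensional (K₀ p k) L] :
    AddValuation L (WithTop ℤ) :=
  (exists_isNormalizedVal p k L).choose

/-! ### Higher ramification filtration and conductor

`L / K` is a finite Galois extension of complete discrete valuation fields, with algebraically
closed residue field, and `v` is the normalized valuation of `L`. -/

section Ramification

variable (K : Type*) {L : Type*} [Field K] [Field L] [Algebra K L]
  (v : AddValuation L (WithTop ℤ))

/-- The `i`-th ramification group for the lower numbering (as a subset of the Galois group):
`g ∈ G_i ↔ v_L (g π - π) ≥ i + 1`, for uniformizers `π` of `L`. -/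
def lowerRam (i : ℝ) : Set (L ≃ₐ[K] L) :=
  {g | ∀ π : L, v π = 1 →
    ((i + 1 : ℝ) : WithTop ℝ) ≤ WithTop.map (fun n : ℤ => (n : ℝ)) (v (g π - π))}

/-- The Herbrand function `φ_{L/K} (u) = ∫₀ᵘ dt / [G₀ : G_t]`. -/
noncomputable def herbrandPhi (u : ℝ) : ℝ :=
  ∫ t in (0 : ℝ)..u, (Nat.card (lowerRam K v t) : ℝ) / (Nat.card (lowerRam K v 0) : ℝ)

/-- `ψ_{L/K}`, the inverse of the bijection `φ_{L/K} : [0, ∞) → [0, ∞)`. -/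
noncomputable def herbrandPsi (u : ℝ) : ℝ :=
  Function.invFunOn (herbrandPhi K v) (Set.Ici 0) u

/-- The `i`-th ramification group for the upper numbering: `G^i = G_{ψ(i)}`. -/
noncomputable def upperRam (i : ℝ) : Set (L ≃ₐ[K] L) :=
  lowerRam K v (herbrandPsi K v i)

/-- The conductor `h_{L/K} = sup {i ∈ [0, ∞) | G^i ≠ {id}}`
(equal to `0` when there is no such `i`, i.e. for the trivial extension). -/
noncomputable def conductor : ℝ :=
  sSup {i : ℝ | 0 ≤ i ∧ upperRam K v i ≠ {1}}

end Ramification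

/-- `a = 1 + t` is `p`-primitive for the field with normalized valuation `v`: either
`p ∤ v(a)` (with `a ≠ 0`), or `0 < v(t) < p/(p-1) * e` and `p ∤ v(t)`, where `e = v(p)`. -/
def IsPPrimitive (p : ℕ) {K : Type*} [Field K] (v : AddValuation K (WithTop ℤ)) (a : K) : Prop :=
  (∃ n : ℤ, v a = n ∧ ¬ (p : ℤ) ∣ n) ∨
  (∃ n e : ℤ, v (a - 1) = n ∧ v (p : K) = e ∧ 0 < n ∧
    (n : ℝ) < (p : ℝ) / ((p : ℝ) - 1) * (e : ℝ) ∧ ¬ (p : ℤ) ∣ n)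

/-! ### The fields `K_n`, `K_m(a^(1/p^c))` inside an algebraic closure `Ω` of `K₀` -/

section Fields

variable (p : ℕ) [Fact p.Prime] (k : Type*) [Field k] [CharP k p]
  (Ω : Type*) [Field Ω] [Algebra (K₀ p k) Ω]

/-- `K_n = K₀(ζ_{p^n})`, generated by the `p^n`-th roots of unity. -/
noncomputable def Kn (n : ℕ) : IntermediateField (K₀ p k) Ω :=
  IntermediateField.adjoin (K₀ p k) {ζ : Ω | ζ ^ p ^ n = 1}

theorem isIntegral_of_pow_eq_one {n : ℕ} {ζ : Ω} (hζ : ζ ^ p ^ n = 1) :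
    IsIntegral (K₀ p k) ζ := by
  refine IsIntegral.of_pow (pow_pos (Fact.out : p.Prime).pos n) ?_
  rw [hζ]
  exact isIntegral_one

instance finiteDimensional_Kn (n : ℕ) : FiniteDimensional (K₀ p k) (Kn p k Ω n) := by
  classical
  have hpos : 0 < p ^ n := pow_pos (Fact.out : p.Prime).pos n
  have : Finite {ζ : Ω | ζ ^ p ^ n = 1} := by
    refine Set.Finite.subset (Polynomial.nthRoots (p ^ n) (1 : Ω)).toFinset.finite_toSet ?_
    intro ζ hζ
    simpa [Polynomial.mem_nthRoots hpos] using hζ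
  exact IntermediateField.finiteDimensional_adjoin fun x hx =>
    isIntegral_of_pow_eq_one p k Ω hx

/-- The normalized valuation `v_n` of `K_n`. -/
noncomputable def vn [IsAlgClosed k] (n : ℕ) : AddValuation (Kn p k Ω n) (WithTop ℤ) :=
  normVal p k (Kn p k Ω n)

/-- `K_m(x)` for `x ∈ Ω`. -/
noncomputable def KnAdjoin (m : ℕ) (x : Ω) : IntermediateField (K₀ p k) Ω :=
  Kn p k Ω m ⊔ IntermediateField.adjoin (K₀ p k) {x}

instance finiteDimensional_KnAdjoin [Algebra.IsAlgebraic (K₀ p k) Ω] (m : ℕ) (x : Ω) :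
    FiniteDimensional (K₀ p k) (KnAdjoin p k Ω m x) := by
  have : FiniteDimensional (K₀ p k) (IntermediateField.adjoin (K₀ p k) {x}) :=
    IntermediateField.adjoin.finiteDimensional (Algebra.IsIntegral.isIntegral x)
  unfold KnAdjoin
  infer_instance

/-- The Galois closure of `K_m(x)` over `K₀` (inside the algebraic closure `Ω`). -/
noncomputable def galoisClosure (m : ℕ) (x : Ω) : IntermediateField (K₀ p k) Ω :=
  IntermediateField.normalClosure (K₀ p k) (KnAdjoin p k Ω m x) Ω

instance finiteDimensional_galoisClosure [Algebra.IsAlgebraic (K₀ p k) Ω] (m : ℕ) (x : Ω) :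
    FiniteDimensional (K₀ p k) (galoisClosure p k Ω m x) := by
  unfold galoisClosure
  infer_instance

end Fields

/-- The quantity `b - (v - 1) / (p^(ℓ-1) (p-1))` for `v ∈ ℤ ∪ {∞}`; it is `-∞` when `v = ∞`. -/
noncomputable def boundTerm (p ℓ : ℕ) (b : ℝ) : WithTop ℤ → WithBot ℝ
  | ⊤ => ⊥
  | (n : ℤ) => ((b - ((n : ℝ) - 1) / ((p : ℝ) ^ (ℓ - 1) * ((p : ℝ) - 1)) : ℝ) : WithBot ℝ)

end WittKummer

namespace WittKummer

open Polynomial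

/-!
If the conductor of `L` exceeded the bound, a nontrivial normal subgroup `H` of `Gal(L/K₀)` would
move a uniformizer `π` of `L` only very slightly. Then `H` cannot separate the points of a small
disc around `π`: the Gauss valuation `w` of that disc on `L[X]` is almost invariant under the action
of `H` on coefficients, while a polynomial over `W(k)` vanishing at `π` is small for `w`. Hence
`X` serves as an approximation of `π` defined over `K₀`. Writing elements of `L` as polynomials over
`W(k)` in `π` and replacing `π` by `X`, one approximates the roots of unity and the `p ^ c`-th roots
of `α' * β ^ p` by elements fixed by `H`; the closer `α'` and `β` are to `1`, the less is needed
for these approximations to be good. By the argument of Krasner's lemma `H` fixes all these roots.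
They generate `L`, so `H` is trivial.

The decomposition `α = α' * β ^ p` is found by successive approximation: the residue field is
perfect, so as long as `p` divides the valuation of `α`, respectively of `α - 1`, division by a
`p`-th power brings `α` closer to `1`, and elements close enough to `1` are `p`-th powers.
-/

/-! ### Valuations with values in `ℤ ∪ {∞}` -/

section WithTopInt

variable {a b : ℤ} {x y : WithTop ℤ}

theorem coe_lt_iff_add_one_le : (a : WithTop ℤ) < x ↔ ((a + 1 : ℤ) : WithTop ℤ) ≤ x := by
  induction x using WithTop.recTopCoe with
  | top => simp
  | coe n => norm_cast

theorem coe_le_of_coe_le (hb : (b : WithTop ℤ) ≤ x) (hab : a ≤ b) : (a : WithTop ℤ) ≤ x :=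
  (WithTop.coe_le_coe.2 hab).trans hb

theorem coe_add_le_add (hx : (a : WithTop ℤ) ≤ x) (hy : (b : WithTop ℤ) ≤ y) :
    ((a + b : ℤ) : WithTop ℤ) ≤ x + y := by
  rw [WithTop.coe_add]
  exact add_le_add hx hy

theorem coe_le_add_coe_iff :
    (a : WithTop ℤ) ≤ x + (b : WithTop ℤ) ↔ ((a - b : ℤ) : WithTop ℤ) ≤ x := by
  induction x using WithTop.recTopCoe with
  | top => simp
  | coe n => norm_cast; omega

end WithTopInt

section AddValuationRing

variable {R : Type*} [CommRing R] (v : AddValuation R (WithTop ℤ))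

theorem coe_add_le_map_mul {a b : ℤ} {x y : R} (hx : (a : WithTop ℤ) ≤ v x)
    (hy : (b : WithTop ℤ) ≤ v y) : ((a + b : ℤ) : WithTop ℤ) ≤ v (x * y) := by
  rw [v.map_mul]
  exact coe_add_le_add hx hy

theorem coe_nsmul (n : ℕ) (a : ℤ) : n • (a : WithTop ℤ) = ((n * a : ℤ) : WithTop ℤ) := by
  rw [← nsmul_eq_mul, WithTop.coe_nsmul]

theorem coe_mul_le_map_pow {a : ℤ} {x : R} (hx : (a : WithTop ℤ) ≤ v x) (n : ℕ) :
    ((n * a : ℤ) : WithTop ℤ) ≤ v (x ^ n) := by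
  rw [v.map_pow, ← coe_nsmul]
  exact nsmul_le_nsmul_right hx n

theorem map_mul_eq_coe {a b : ℤ} {x y : R} (hx : v x = a) (hy : v y = b) :
    v (x * y) = ((a + b : ℤ) : WithTop ℤ) := by
  rw [v.map_mul, hx, hy, WithTop.coe_add]

theorem map_pow_eq_coe {a : ℤ} {x : R} (hx : v x = a) (n : ℕ) :
    v (x ^ n) = ((n * a : ℤ) : WithTop ℤ) := by
  rw [v.map_pow, hx, coe_nsmul]

theorem map_uniformizer_pow {x : R} (hx : v x = 1) (n : ℕ) : v (x ^ n) = ((n : ℤ) : WithTop ℤ) := by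
  simpa using map_pow_eq_coe v (a := 1) hx n

theorem ne_zero_of_map_eq_coe {a : ℤ} {x : R} (hx : v x = a) : x ≠ 0 := by
  rintro rfl
  simp at hx

theorem map_nonneg_of_isIntegralElem {A : Type*} [CommRing A] {f : A →+* R} (hf : ∀ a, 0 ≤ v (f a))
    {x : R} (hx : f.IsIntegralElem x) : 0 ≤ v x := by
  obtain ⟨P, hP, hPx⟩ := hx
  let O := (AddValuation.toValuation v).integer
  exact (Valuation.integer.integers (AddValuation.toValuation v)).mem_of_integral
    ⟨P.map (f.codRestrict O hf), hP.map _, by rw [eval₂_map]; exact hPx⟩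

end AddValuationRing

section AddValuationGeneral

variable {R Γ : Type*} [CommRing R] [LinearOrderedAddCommMonoidWithTop Γ] (v : AddValuation R Γ)

theorem map_prod_eq_sum {ι : Type*} (s : Finset ι) (f : ι → R) :
    v (∏ i ∈ s, f i) = ∑ i ∈ s, v (f i) := by
  classical
  induction s using Finset.induction_on with
  | empty => simp
  | insert i s hi ih => rw [Finset.prod_insert hi, Finset.sum_insert hi, v.map_mul, ih]

theorem map_natCast_nonneg (n : ℕ) : 0 ≤ v (n : R) := by
  induction n with
  | zero => simp
  | succ n ih =>
    rw [Nat.cast_succ]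
    exact v.map_le_add ih v.map_one.ge

theorem map_pow_nonneg {x : R} (hx : 0 ≤ v x) (n : ℕ) : 0 ≤ v (x ^ n) := by
  rw [v.map_pow]
  exact nsmul_nonneg hx n

theorem map_eq_zero_of_mul_eq_one {x y : R} (hxy : x * y = 1) (hx : 0 ≤ v x) (hy : 0 ≤ v y) :
    v x = 0 := by
  have hsum : v x + v y = 0 := by rw [← v.map_mul, hxy, v.map_one]
  exact le_antisymm (hsum ▸ le_add_of_nonneg_right hy) hx

theorem nsmul_add_le_map_pow_sub_pow {x y : R} {a c : Γ} (hx : a ≤ v x) (hy : a ≤ v y)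
    (hxy : a + c ≤ v (x - y)) (n : ℕ) : n • a + c ≤ v (x ^ n - y ^ n) := by
  induction n with
  | zero => simp
  | succ n ih =>
    have hsplit : x ^ (n + 1) - y ^ (n + 1) = x * (x ^ n - y ^ n) + (x - y) * y ^ n := by ring
    rw [hsplit]
    refine v.map_le_add ?_ ?_
    · rw [v.map_mul, succ_nsmul', add_assoc]
      exact add_le_add hx ih
    · rw [v.map_mul, v.map_pow, succ_nsmul, add_assoc, add_comm]
      exact add_le_add hxy (nsmul_le_nsmul_right hy n)

theorem le_map_pow_sub_pow {x y : R} (hx : 0 ≤ v x) (hy : 0 ≤ v y) {c : Γ}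
    (hxy : c ≤ v (x - y)) (n : ℕ) : c ≤ v (x ^ n - y ^ n) := by
  simpa using nsmul_add_le_map_pow_sub_pow v hx hy (by rwa [zero_add]) n

variable {A : Type*} [CommRing A] {f : A →+* R}

theorem map_eval₂_nonneg (hf : ∀ a, 0 ≤ v (f a)) {x : R} (hx : 0 ≤ v x) (P : A[X]) :
    0 ≤ v (P.eval₂ f x) := by
  rw [eval₂_eq_sum, sum_def]
  refine v.map_le_sum fun i _ => ?_
  rw [v.map_mul]
  exact add_nonneg (hf _) (map_pow_nonneg v hx i)

theorem le_map_eval₂_sub (hf : ∀ a, 0 ≤ v (f a)) {x y : R} (hx : 0 ≤ v x) (hy : 0 ≤ v y)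
    {c : Γ} (hxy : c ≤ v (x - y)) (P : A[X]) : c ≤ v (P.eval₂ f x - P.eval₂ f y) := by
  rw [eval₂_eq_sum, eval₂_eq_sum, sum_def, sum_def, ← Finset.sum_sub_distrib]
  refine v.map_le_sum fun i _ => ?_
  rw [← mul_sub, v.map_mul]
  exact le_add_of_nonneg_of_le (hf _) (le_map_pow_sub_pow v hx hy hxy i)

end AddValuationGeneral

section AddValuationField

variable {L : Type*} [Field L] (v : AddValuation L (WithTop ℤ))

theorem exists_map_eq_coe {x : L} (hx : x ≠ 0) : ∃ n : ℤ, v x = n := by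
  obtain ⟨n, hn⟩ := WithTop.ne_top_iff_exists.1 (v.ne_top_iff.2 hx)
  exact ⟨n, hn.symm⟩

theorem map_div_eq_coe {a b : ℤ} {x y : L} (hx : v x = a) (hy : v y = b) :
    v (x / y) = ((a - b : ℤ) : WithTop ℤ) := by
  rw [v.map_div, hx, hy]
  rfl

theorem map_zpow_eq_coe {a : ℤ} {x : L} (hx : v x = a) (n : ℤ) :
    v (x ^ n) = ((n * a : ℤ) : WithTop ℤ) := by
  obtain ⟨m, rfl | rfl⟩ := n.eq_nat_or_neg
  · rw [zpow_natCast, map_pow_eq_coe v hx]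
  · rw [zpow_neg, zpow_natCast, v.map_inv, map_pow_eq_coe v hx, neg_mul]
    rfl

theorem coe_le_map_div {x y : L} {a b : ℤ} (hx : ((a + b : ℤ) : WithTop ℤ) ≤ v x)
    (hy : v y = b) : (a : WithTop ℤ) ≤ v (x / y) := by
  rw [← div_mul_cancel₀ x (ne_zero_of_map_eq_coe v hy), v.map_mul, hy, coe_le_add_coe_iff,
    add_sub_cancel_right] at hx
  exact hx

theorem eq_zero_of_forall_mul_le_map {x : L} {e : ℤ} (he : 1 ≤ e)
    (h : ∀ n : ℕ, ((n * e : ℤ) : WithTop ℤ) ≤ v x) : x = 0 := by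
  by_contra hx
  obtain ⟨m, hm⟩ := exists_map_eq_coe v hx
  have hle := h (m.toNat + 1)
  rw [hm, WithTop.coe_le_coe] at hle
  push_cast at hle
  nlinarith [Int.self_le_toNat m]

end AddValuationField

/-! ### Gauss valuations on polynomials -/

section Gauss

theorem exists_coe_le_of_coe_le_add {a : ℤ} {x y : WithTop ℤ} (h : (a : WithTop ℤ) ≤ x + y) :
    ∃ b c : ℤ, b + c = a ∧ (b : WithTop ℤ) ≤ x ∧ (c : WithTop ℤ) ≤ y := by
  induction x using WithTop.recTopCoe with
  | top =>
    induction y using WithTop.recTopCoe with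
    | top => exact ⟨a, 0, add_zero a, le_top, le_top⟩
    | coe n => exact ⟨a - n, n, sub_add_cancel a n, le_top, le_rfl⟩
  | coe m =>
    refine ⟨m, a - m, add_sub_cancel m a, le_rfl, ?_⟩
    rwa [add_comm, coe_le_add_coe_iff] at h

variable {R : Type*} [CommRing R] (v : AddValuation R (WithTop ℤ)) (ρ : ℤ)

/-- The Gauss valuation `min_i (v(a_i) + i ρ)` of `∑ a_i X^i`, as a plain function. -/
noncomputable def gaussFun (f : R[X]) : WithTop ℤ :=
  f.support.inf fun i => v (f.coeff i) + ((i * ρ : ℤ) : WithTop ℤ)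

theorem gaussFun_le_coeff (f : R[X]) (i : ℕ) :
    gaussFun v ρ f ≤ v (f.coeff i) + ((i * ρ : ℤ) : WithTop ℤ) := by
  by_cases hi : i ∈ f.support
  · exact Finset.inf_le hi
  · simp [notMem_support_iff.1 hi]

theorem coe_le_gaussFun {a : ℤ} {f : R[X]} :
    (a : WithTop ℤ) ≤ gaussFun v ρ f ↔ ∀ i : ℕ, ((a - i * ρ : ℤ) : WithTop ℤ) ≤ v (f.coeff i) :=
  ⟨fun h i => coe_le_add_coe_iff.1 (h.trans (gaussFun_le_coeff v ρ f i)),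
    fun h => Finset.le_inf fun i _ => coe_le_add_coe_iff.2 (h i)⟩

theorem gaussFun_C (a : R) : gaussFun v ρ (C a) = v a := by
  refine WithTop.eq_of_forall_coe_le_iff fun n => ?_
  rw [coe_le_gaussFun]
  refine ⟨fun h => by simpa using h 0, fun h i => ?_⟩
  rw [coeff_C]
  split_ifs with hi
  · simpa [hi] using h
  · simp

theorem min_gaussFun_le_gaussFun_add (f g : R[X]) :
    min (gaussFun v ρ f) (gaussFun v ρ g) ≤ gaussFun v ρ (f + g) := by
  refine WithTop.forall_coe_le_iff_le.1 fun a ha => ?_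
  rw [le_min_iff, coe_le_gaussFun, coe_le_gaussFun] at ha
  rw [coe_le_gaussFun]
  intro i
  rw [coeff_add]
  exact v.map_le_add (ha.1 i) (ha.2 i)

theorem gaussFun_add_le_gaussFun_mul (f g : R[X]) :
    gaussFun v ρ f + gaussFun v ρ g ≤ gaussFun v ρ (f * g) := by
  refine WithTop.forall_coe_le_iff_le.1 fun a ha => ?_
  obtain ⟨b, c, rfl, hb, hc⟩ := exists_coe_le_of_coe_le_add ha
  rw [coe_le_gaussFun] at hb hc ⊢
  intro i
  rw [coeff_mul]
  refine v.map_le_sum fun x hx => ?_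
  refine coe_le_of_coe_le (coe_add_le_map_mul v (hb x.1) (hc x.2)) (le_of_eq ?_)
  rw [← Finset.HasAntidiagonal.mem_antidiagonal.1 hx]
  push_cast
  ring

theorem exists_least_gaussFun_coeff {f : R[X]} {a : ℤ} (hf : gaussFun v ρ f = a) :
    ∃ i : ℕ, v (f.coeff i) = ((a - i * ρ : ℤ) : WithTop ℤ) ∧
      ∀ j < i, ((a - j * ρ : ℤ) : WithTop ℤ) < v (f.coeff j) := by
  classical
  have hle := (coe_le_gaussFun v ρ).1 hf.ge
  have hex : ∃ i : ℕ, ¬ ((a - i * ρ : ℤ) : WithTop ℤ) < v (f.coeff i) := by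
    by_contra! h
    have hsucc : ((a + 1 : ℤ) : WithTop ℤ) ≤ gaussFun v ρ f := by
      rw [coe_le_gaussFun]
      intro i
      rw [add_sub_right_comm, ← coe_lt_iff_add_one_le]
      exact h i
    exact (coe_lt_iff_add_one_le.2 hsucc).ne' hf
  exact ⟨Nat.find hex, (not_lt.1 (Nat.find_spec hex)).antisymm (hle _),
    fun j hj => not_not.1 (Nat.find_min hex hj)⟩

theorem gaussFun_mul (f g : R[X]) : gaussFun v ρ (f * g) = gaussFun v ρ f + gaussFun v ρ g := by
  refine le_antisymm ?_ (gaussFun_add_le_gaussFun_mul v ρ f g)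
  rcases eq_or_ne (gaussFun v ρ f) ⊤ with hf | hf
  · simp [hf]
  rcases eq_or_ne (gaussFun v ρ g) ⊤ with hg | hg
  · simp [hg]
  obtain ⟨a, ha⟩ := WithTop.ne_top_iff_exists.1 hf
  obtain ⟨b, hb⟩ := WithTop.ne_top_iff_exists.1 hg
  obtain ⟨i, hi, hi_lt⟩ := exists_least_gaussFun_coeff v ρ ha.symm
  obtain ⟨j, hj, hj_lt⟩ := exists_least_gaussFun_coeff v ρ hb.symm
  have hij : v (f.coeff i * g.coeff j) = ((a - i * ρ + (b - j * ρ) : ℤ) : WithTop ℤ) :=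
    map_mul_eq_coe v hi hj
  have hmem : (i, j) ∈ Finset.HasAntidiagonal.antidiagonal (i + j) := by simp
  -- in the coefficient of `X ^ (i + j)` the term indexed by `(i, j)` strictly dominates
  have hcoeff : v ((f * g).coeff (i + j)) = v (f.coeff i * g.coeff j) := by
    rw [coeff_mul, ← Finset.add_sum_erase _ _ hmem]
    refine v.map_add_eq_of_lt_left (v.map_lt_sum (hij ▸ WithTop.coe_ne_top) fun x hx => ?_)
    obtain ⟨hne, hx⟩ := Finset.mem_erase.1 hx
    have hsum : (x.1 + x.2 : ℤ) = i + j := mod_cast Finset.HasAntidiagonal.mem_antidiagonal.1 hx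
    rw [hij, coe_lt_iff_add_one_le]
    rcases lt_or_ge x.1 i with hlt | hge
    · exact coe_le_of_coe_le (coe_add_le_map_mul v (coe_lt_iff_add_one_le.1 (hi_lt _ hlt))
        ((coe_le_gaussFun v ρ).1 hb.le x.2)) (by linear_combination ρ * hsum)
    · have hlt : x.2 < j := by
        by_contra hge'
        exact hne (Prod.ext (by lia) (by lia))
      exact coe_le_of_coe_le (coe_add_le_map_mul v ((coe_le_gaussFun v ρ).1 ha.le x.1)
        (coe_lt_iff_add_one_le.1 (hj_lt _ hlt))) (by linear_combination ρ * hsum)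
  refine (gaussFun_le_coeff v ρ (f * g) (i + j)).trans (le_of_eq ?_)
  rw [hcoeff, hij, ← ha, ← hb, ← WithTop.coe_add, ← WithTop.coe_add]
  congr 1
  push_cast
  ring

/-- The Gauss valuation on `R[X]` of the disc of radius `ρ` (measured additively) around `0`. -/
noncomputable def gaussVal : AddValuation R[X] (WithTop ℤ) :=
  AddValuation.of (gaussFun v ρ) (by simp [gaussFun]) (by rw [← C_1, gaussFun_C, v.map_one])
    (min_gaussFun_le_gaussFun_add v ρ) (gaussFun_mul v ρ)

theorem coe_le_gaussVal {a : ℤ} {f : R[X]} :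
    (a : WithTop ℤ) ≤ gaussVal v ρ f ↔ ∀ i : ℕ, ((a - i * ρ : ℤ) : WithTop ℤ) ≤ v (f.coeff i) :=
  coe_le_gaussFun v ρ

theorem gaussVal_C (a : R) : gaussVal v ρ (C a) = v a :=
  gaussFun_C v ρ a

theorem gaussVal_X_add_C (a : R) : gaussVal v ρ (X + C a) = min (ρ : WithTop ℤ) (v a) := by
  refine WithTop.eq_of_forall_coe_le_iff fun n => ?_
  rw [coe_le_gaussVal, le_min_iff]
  refine ⟨fun h => ⟨?_, by simpa using h 0⟩, fun ⟨hρ, ha⟩ i => ?_⟩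
  · have h1 := h 1
    rw [coeff_add, coeff_X_one, coeff_C_of_ne_zero one_ne_zero, add_zero, v.map_one] at h1
    norm_cast at h1 ⊢
    lia
  · rcases i with _ | _ | i
    · simpa using ha
    · rw [coeff_add, zero_add, coeff_X_one, coeff_C_of_ne_zero one_ne_zero, add_zero, v.map_one]
      norm_cast at hρ ⊢
      lia
    · rw [coeff_add, coeff_C_of_ne_zero (by lia), coeff_X_of_ne_one (by lia), add_zero, v.map_zero]
      exact le_top

theorem gaussVal_map {σ : R →+* R} (hσ : ∀ x, v (σ x) = v x) (f : R[X]) :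
    gaussVal v ρ (f.map σ) = gaussVal v ρ f :=
  WithTop.eq_of_forall_coe_le_iff fun n => by simp only [coe_le_gaussVal, coeff_map, hσ]

/-- The Gauss valuation on `R[X]` of the disc of radius `ρ` around `z`. -/
noncomputable def discVal (z : R) : AddValuation R[X] (WithTop ℤ) :=
  (gaussVal v ρ).comap (compRingHom (X + C z))

theorem discVal_apply (z : R) (f : R[X]) : discVal v ρ z f = gaussVal v ρ (f.comp (X + C z)) :=
  rfl

theorem discVal_C (z a : R) : discVal v ρ z (C a) = v a := by
  rw [discVal_apply, C_comp, gaussVal_C]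

theorem discVal_X_sub_C (z a : R) :
    discVal v ρ z (X - C a) = min (ρ : WithTop ℤ) (v (z - a)) := by
  rw [discVal_apply, sub_comp, X_comp, C_comp, add_sub_assoc, ← C_sub, gaussVal_X_add_C]

theorem gaussVal_le_gaussVal_comp {c : R} (hc : (ρ : WithTop ℤ) ≤ v c) (f : R[X]) :
    gaussVal v ρ f ≤ gaussVal v ρ (f.comp (X + C c)) := by
  refine WithTop.forall_coe_le_iff_le.1 fun a ha => ?_
  rw [comp_eq_sum_left, sum_def]
  refine AddValuation.map_le_sum _ fun i _ => ?_
  have hXc : (ρ : WithTop ℤ) ≤ gaussVal v ρ (X + C c) :=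
    (le_min le_rfl hc).trans_eq (gaussVal_X_add_C v ρ c).symm
  have hCi : ((a - i * ρ : ℤ) : WithTop ℤ) ≤ gaussVal v ρ (C (f.coeff i)) :=
    ((coe_le_gaussVal v ρ).1 ha i).trans_eq (gaussVal_C v ρ _).symm
  exact coe_le_of_coe_le (coe_add_le_map_mul _ hCi (coe_mul_le_map_pow _ hXc i)) (by simp)

theorem discVal_le_discVal_of_center {z z' : R} (hz : (ρ : WithTop ℤ) ≤ v (z' - z)) (f : R[X]) :
    discVal v ρ z f ≤ discVal v ρ z' f := by
  have hf : f.comp (X + C z') = (f.comp (X + C z)).comp (X + C (z' - z)) := by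
    rw [comp_assoc, add_comp, X_comp, C_comp, C_sub, add_assoc, sub_add_cancel]
  rw [discVal_apply, discVal_apply, hf]
  exact gaussVal_le_gaussVal_comp v ρ hz _

theorem discVal_map {σ : R →+* R} (hσ : ∀ x, v (σ x) = v x) (z : R) (f : R[X]) :
    discVal v ρ (σ z) (f.map σ) = discVal v ρ z f := by
  have hf : (f.map σ).comp (X + C (σ z)) = (f.comp (X + C z)).map σ := by
    rw [Polynomial.map_comp, Polynomial.map_add, map_X, map_C]
  rw [discVal_apply, discVal_apply, hf, gaussVal_map v ρ hσ]

theorem coeff_nonneg_of_monic_mul {P S : R[X]} (hP : P.Monic) (hP0 : ∀ i, 0 ≤ v (P.coeff i))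
    (h : ∀ i, 0 ≤ v ((P * S).coeff i)) (i : ℕ) : 0 ≤ v (S.coeff i) := by
  have hP_le : gaussVal v 0 P ≤ 0 := by
    have hlead := gaussFun_le_coeff v 0 P P.natDegree
    rwa [coeff_natDegree, hP.leadingCoeff, v.map_one, mul_zero, WithTop.coe_zero, add_zero] at hlead
  have hP_ge : 0 ≤ gaussVal v 0 P := (coe_le_gaussVal v 0 (a := 0)).2 (by simpa using hP0)
  have hPS : ((0 : ℤ) : WithTop ℤ) ≤ gaussVal v 0 (P * S) :=
    (coe_le_gaussVal v 0).2 (by simpa using h)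
  rw [AddValuation.map_mul, hP_le.antisymm hP_ge, zero_add, coe_le_gaussVal] at hPS
  simpa using hPS i

end Gauss

/-! ### Approximate roots -/

section Krasner

/-- The nonarchimedean maximum argument behind Krasner's lemma. -/
theorem exists_close_root {L R Γ : Type*} [CommRing L] [CommRing R] [Algebra L R]
    [LinearOrderedAddCommMonoidWithTop Γ] (v : AddValuation L Γ) (w : AddValuation R Γ)
    (hw : ∀ a, w (algebraMap L R a) = v a) [DecidableEq L] (S : Finset L) (hS : S.Nonempty)
    (Z : R) {B : Γ} (hB : B ≤ w (∏ s ∈ S, (Z - algebraMap L R s))) :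
    ∃ s₀ ∈ S, B ≤ w (Z - algebraMap L R s₀) + v (∏ s ∈ S.erase s₀, (s₀ - s)) := by
  obtain ⟨s₀, hs₀, hmax⟩ := S.exists_max_image (fun s => w (Z - algebraMap L R s)) hS
  refine ⟨s₀, hs₀, hB.trans ?_⟩
  rw [map_prod_eq_sum, map_prod_eq_sum, ← Finset.add_sum_erase _ _ hs₀]
  gcongr with s hs
  have hsub : algebraMap L R (s₀ - s) = (Z - algebraMap L R s) - (Z - algebraMap L R s₀) := by
    rw [map_sub]
    ring
  rw [← hw, hsub]
  exact w.map_le_sub le_rfl (hmax s (Finset.mem_of_mem_erase hs))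

theorem prod_erase_eq_derivative {L : Type*} [Field L] [DecidableEq L] (S : Finset L) {s₀ : L}
    (hs₀ : s₀ ∈ S) :
    ∏ s ∈ S.erase s₀, (s₀ - s) = (derivative (∏ s ∈ S, (X - C s))).eval s₀ := by
  have heval := Lagrange.eval_nodal_derivative_eval_node_eq (v := id) hs₀
  simp only [Lagrange.nodal, id] at heval
  rw [heval, eval_prod]
  simp only [eval_sub, eval_X, eval_C]

end Krasner

/-! ### Structure of the extensions of `K₀` -/

section OfWitt

variable (p : ℕ) [Fact p.Prime] (k : Type*) [Field k] [CharP k p]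
  (L : Type*) [Field L] [Algebra (K₀ p k) L]

/-- The structure map `W(k) → L` of an extension `L` of `K₀`. -/
noncomputable def ofWitt : WittVector p k →+* L :=
  (algebraMap (K₀ p k) L).comp (algebraMap (WittVector p k) (K₀ p k))

include p k in
theorem charZero_ext : CharZero L :=
  have := charZero_K₀ p k
  charZero_of_injective_algebraMap (algebraMap (K₀ p k) L).injective

include k in
theorem p_ne_zero_ext : (p : L) ≠ 0 :=
  have := charZero_ext p k L
  Nat.cast_ne_zero.2 (Fact.out : p.Prime).ne_zero

variable {p k L}

theorem dvd_of_constantCoeff_eq_zero [PerfectRing k p] {a : WittVector p k}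
    (ha : WittVector.constantCoeff a = 0) : (p : WittVector p k) ∣ a :=
  Ideal.mem_span_singleton.1 ((WittVector.mem_span_p_iff_coeff_zero_eq_zero a).2 ha)

theorem exists_eval₂_ofWitt_eq_zero {x : L} (hx : IsAlgebraic (K₀ p k) x) :
    ∃ f : (WittVector p k)[X], f ≠ 0 ∧ f.eval₂ (ofWitt p k L) x = 0 := by
  obtain ⟨q, hq, hqx⟩ := hx
  exact ⟨IsLocalization.integerNormalization (nonZeroDivisors (WittVector p k)) q,
    (IsFractionRing.integerNormalization_eq_zero_iff (A := WittVector p k)).not.2 hq,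
    IsLocalization.integerNormalization_eval₂_eq_zero _ _ _ hqx⟩

theorem exists_eval₂_eq_zero_of_map_ne_zero [PerfectRing k p] {x : L} {f : (WittVector p k)[X]}
    (hf : f ≠ 0) (hx : f.eval₂ (ofWitt p k L) x = 0) :
    ∃ g : (WittVector p k)[X], g.map WittVector.constantCoeff ≠ 0 ∧
      g.eval₂ (ofWitt p k L) x = 0 := by
  obtain ⟨i, hi⟩ := nonempty_support_iff.2 hf
  obtain ⟨n, b, hb, hn⟩ := WittVector.exists_eq_pow_p_mul _ (mem_support_iff.1 hi)
  clear hf hi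
  induction n generalizing f with
  | zero =>
    refine ⟨f, fun h => hb ?_, hx⟩
    have hcoeff : WittVector.constantCoeff (f.coeff i) = 0 := by rw [← coeff_map, h, coeff_zero]
    rwa [hn, pow_zero, one_mul] at hcoeff
  | succ n ih =>
    by_cases h : f.map WittVector.constantCoeff = 0
    · obtain ⟨f', rfl⟩ : C (p : WittVector p k) ∣ f := (C_dvd_iff_dvd_coeff _ _).2 fun j =>
        dvd_of_constantCoeff_eq_zero (by rw [← coeff_map, h, coeff_zero])
      refine ih (f := f') ?_ ?_
      · rw [eval₂_mul, eval₂_C, map_natCast] at hx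
        exact (mul_eq_zero.1 hx).resolve_left (p_ne_zero_ext p k L)
      · rw [coeff_C_mul, pow_succ', mul_assoc] at hn
        exact mul_left_cancel₀ (WittVector.p_nonzero p k) hn
    · exact ⟨f, h, hx⟩

theorem exists_prod_X_sub_C_map_eq [IsAlgClosed k] {g : (WittVector p k)[X]}
    (hg : g.map WittVector.constantCoeff ≠ 0) :
    ∃ (c : WittVector p k) (s : Multiset (WittVector p k)), IsUnit c ∧
      (C c * (s.map fun a => X - C a).prod).map WittVector.constantCoeff =
        g.map WittVector.constantCoeff := by
  set q := g.map (WittVector.constantCoeff (p := p) (R := k))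
  obtain ⟨c, hc⟩ := WittVector.constantCoeff_surjective p q.leadingCoeff
  refine ⟨c, q.roots.map (WittVector.teichmuller p), ?_, ?_⟩
  · refine WittVector.isUnit_of_coeff_zero_ne_zero c ?_
    change WittVector.constantCoeff c ≠ 0
    rw [hc]
    exact leadingCoeff_ne_zero.2 hg
  · rw [Polynomial.map_mul, Polynomial.map_C, hc, Polynomial.map_multiset_prod, Multiset.map_map,
      Multiset.map_map]
    conv_rhs => rw [(IsAlgClosed.splits q).eq_prod_roots]
    congr 3
    funext a
    simp [WittVector.teichmuller_coeff_zero]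

end OfWitt

section ValOfWitt

variable {p : ℕ} [Fact p.Prime] {k : Type*} [Field k] [CharP k p]
  {L : Type*} [Field L] [Algebra (K₀ p k) L] {v : AddValuation L (WithTop ℤ)}
  (hv : IsNormalizedVal p k v)

include hv

theorem val_ofWitt_nonneg (a : WittVector p k) : 0 ≤ v (ofWitt p k L a) :=
  hv.2 a

theorem val_ofWitt_of_isUnit {a : WittVector p k} (ha : IsUnit a) : v (ofWitt p k L a) = 0 := by
  obtain ⟨b, hb⟩ := ha.exists_right_inv
  refine map_eq_zero_of_mul_eq_one v (y := ofWitt p k L b) ?_ (hv.2 a) (hv.2 b)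
  rw [← map_mul, hb, map_one]

theorem exists_uniformizer : ∃ π : L, v π = 1 :=
  hv.1 1

theorem exists_val_ofWitt [PerfectRing k p] {e : ℤ} (he : v (p : L) = e) {a : WittVector p k}
    (ha : a ≠ 0) : ∃ n : ℤ, v (ofWitt p k L a) = ((n * e : ℤ) : WithTop ℤ) := by
  obtain ⟨n, u, hu, rfl⟩ := WittVector.exists_eq_pow_p_mul a ha
  refine ⟨n, ?_⟩
  rw [map_mul, map_pow, map_natCast, v.map_mul,
    val_ofWitt_of_isUnit hv (WittVector.isUnit_of_coeff_zero_ne_zero u hu), add_zero,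
    map_pow_eq_coe v he]

theorem exists_val_algebraMap [PerfectRing k p] {e : ℤ} (he : v (p : L) = e) {c : K₀ p k}
    (hc : c ≠ 0) : ∃ n : ℤ, v (algebraMap (K₀ p k) L c) = ((n * e : ℤ) : WithTop ℤ) := by
  obtain ⟨a, b, hb, rfl⟩ := IsFractionRing.div_surjective (A := WittVector p k) c
  have ha : a ≠ 0 := by
    rintro rfl
    simp at hc
  obtain ⟨n, hn⟩ := exists_val_ofWitt hv he ha
  obtain ⟨m, hm⟩ := exists_val_ofWitt hv he (nonZeroDivisors.ne_zero hb)
  refine ⟨n - m, ?_⟩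
  rw [map_div₀, sub_mul]
  exact map_div_eq_coe v hn hm

variable [Algebra.IsAlgebraic (K₀ p k) L]

theorem exists_val_p [PerfectRing k p] :
    ∃ e : ℕ, 1 ≤ e ∧ v (p : L) = ((e : ℤ) : WithTop ℤ) := by
  obtain ⟨e, he⟩ := exists_map_eq_coe v (p_ne_zero_ext p k L)
  have he0 : 0 ≤ e := WithTop.coe_le_coe.1 ((map_natCast_nonneg v p).trans_eq he)
  lift e to ℕ using he0
  refine ⟨e, Nat.one_le_iff_ne_zero.2 ?_, he⟩
  rintro rfl
  -- if `v p = 0` then `v` is trivial on `K₀`, hence nonnegative on the algebraic extension `L`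
  have hK₀ (c : K₀ p k) : 0 ≤ v (algebraMap (K₀ p k) L c) := by
    rcases eq_or_ne c 0 with rfl | hc
    · simp
    · obtain ⟨n, hn⟩ := exists_val_algebraMap hv he hc
      simp [hn]
  obtain ⟨x, hx⟩ := hv.1 ((-1 : ℤ) : WithTop ℤ)
  have hx0 := map_nonneg_of_isIntegralElem v hK₀ (Algebra.IsIntegral.isIntegral (R := K₀ p k) x)
  rw [hx] at hx0
  norm_cast at hx0

theorem one_le_val_p [PerfectRing k p] : ((1 : ℤ) : WithTop ℤ) ≤ v (p : L) := by
  obtain ⟨e, he, hve⟩ := exists_val_p hv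
  rw [hve]
  exact_mod_cast he

theorem one_le_val_ofWitt [PerfectRing k p] {a : WittVector p k}
    (ha : WittVector.constantCoeff a = 0) : ((1 : ℤ) : WithTop ℤ) ≤ v (ofWitt p k L a) := by
  obtain ⟨b, rfl⟩ := dvd_of_constantCoeff_eq_zero ha
  rw [map_mul, map_natCast]
  exact coe_add_le_map_mul v (b := 0) (one_le_val_p hv) (val_ofWitt_nonneg hv b)

theorem one_le_val_eval₂ [PerfectRing k p] {f : (WittVector p k)[X]}
    (hf : f.map WittVector.constantCoeff = 0) {x : L} (hx : 0 ≤ v x) :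
    ((1 : ℤ) : WithTop ℤ) ≤ v (f.eval₂ (ofWitt p k L) x) := by
  rw [eval₂_eq_sum, sum_def]
  refine v.map_le_sum fun i _ => ?_
  rw [v.map_mul]
  refine le_add_of_le_of_nonneg ?_ (map_pow_nonneg v hx i)
  exact one_le_val_ofWitt hv (by rw [← coeff_map, hf, coeff_zero])

end ValOfWitt

section Residue

variable {p : ℕ} [Fact p.Prime] {k : Type*} [Field k] [CharP k p] [IsAlgClosed k]
  {L : Type*} [Field L] [Algebra (K₀ p k) L] [Algebra.IsAlgebraic (K₀ p k) L]
  {v : AddValuation L (WithTop ℤ)} (hv : IsNormalizedVal p k v)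

include hv

/-- The residue field of `L` is `k`. -/
theorem exists_residue {x : L} (hx : 0 ≤ v x) :
    ∃ a : WittVector p k, ((1 : ℤ) : WithTop ℤ) ≤ v (x - ofWitt p k L a) := by
  obtain ⟨f, hf, hfx⟩ :=
    exists_eval₂_ofWitt_eq_zero (Algebra.IsAlgebraic.isAlgebraic (R := K₀ p k) x)
  obtain ⟨g, hg, hgx⟩ := exists_eval₂_eq_zero_of_map_ne_zero hf hfx
  obtain ⟨c, s, hc, hs⟩ := exists_prod_X_sub_C_map_eq hg
  set F := C c * (s.map fun a => X - C a).prod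
  have hF : ((1 : ℤ) : WithTop ℤ) ≤ v (F.eval₂ (ofWitt p k L) x) := by
    have hFg := one_le_val_eval₂ hv (f := F - g) (by rw [Polynomial.map_sub, hs, sub_self]) hx
    rwa [eval₂_sub, hgx, sub_zero] at hFg
  by_contra! hcon
  have hprod (t : Multiset (WittVector p k)) :
      v ((t.map fun a => X - C a).prod.eval₂ (ofWitt p k L) x) ≤ 0 := by
    induction t using Multiset.induction_on with
    | empty => simp
    | cons a t ih =>
      have ha : v (x - ofWitt p k L a) ≤ 0 := by
        rw [← not_lt, ← WithTop.coe_zero, coe_lt_iff_add_one_le, zero_add, not_le]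
        exact hcon a
      rw [Multiset.map_cons, Multiset.prod_cons, eval₂_mul, v.map_mul, eval₂_sub, eval₂_X, eval₂_C]
      exact add_nonpos ha ih
  rw [eval₂_mul, eval₂_C, v.map_mul, val_ofWitt_of_isUnit hv hc, zero_add] at hF
  exact absurd (hF.trans (hprod s)) (by norm_cast)

theorem exists_poly_approx {π : L} (hπ : v π = 1) {x : L} (hx : 0 ≤ v x) (j : ℕ) :
    ∃ V : (WittVector p k)[X], V.degree < j ∧
      ((j : ℤ) : WithTop ℤ) ≤ v (x - V.eval₂ (ofWitt p k L) π) := by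
  induction j with
  | zero => exact ⟨0, by simp, by simpa using hx⟩
  | succ j ih =>
    obtain ⟨V, hV, hle⟩ := ih
    have hπj := map_uniformizer_pow v hπ j
    have hπj0 : π ^ j ≠ 0 := ne_zero_of_map_eq_coe v hπj
    obtain ⟨a, ha⟩ := exists_residue hv (x := (x - V.eval₂ (ofWitt p k L) π) / π ^ j)
      (coe_le_map_div v (a := 0) (by simpa using hle) hπj)
    refine ⟨V + C a * X ^ j, ?_, ?_⟩
    · refine (degree_add_le _ _).trans_lt (max_lt (hV.trans (by exact_mod_cast j.lt_succ_self)) ?_)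
      exact (degree_C_mul_X_pow_le j a).trans_lt (by exact_mod_cast j.lt_succ_self)
    · have hsplit : x - (V + C a * X ^ j).eval₂ (ofWitt p k L) π =
          ((x - V.eval₂ (ofWitt p k L) π) / π ^ j - ofWitt p k L a) * π ^ j := by
        rw [eval₂_add, eval₂_mul, eval₂_C, eval₂_pow, eval₂_X]
        field_simp
        ring
      rw [hsplit]
      exact coe_le_of_coe_le (coe_add_le_map_mul v ha hπj.ge) (by push_cast; lia)

end Residue

theorem isPrecomplete_pi {A : Type*} [CommRing A] (I : Ideal A) {M : Type*} [AddCommGroup M]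
    [Module A M] {ι : Type*} [Finite ι] [IsPrecomplete I M] : IsPrecomplete I (ι → M) := by
  classical
  have := Fintype.ofFinite ι
  refine AdicCompletion.of_surjective_iff.1 fun y => ?_
  choose x hx using fun i =>
    AdicCompletion.of_surjective I M (AdicCompletion.piEquivOfFintype I (fun _ : ι => M) y i)
  refine ⟨x, (AdicCompletion.piEquivOfFintype I (fun _ : ι => M)).injective (funext fun i => ?_)⟩
  rw [← hx, AdicCompletion.piEquivOfFintype_apply]
  rfl

theorem exists_sum_smul_eq_of_isHausdorff {A : Type*} [CommRing A] {ϖ : A}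
    [IsPrecomplete (Ideal.span {ϖ}) A] {N : Type*} [AddCommGroup N] [Module A N]
    [IsHausdorff (Ideal.span {ϖ}) N] {ι : Type*} [Fintype ι] {b : ι → N}
    (h : ∀ y, ∃ (a : ι → A) (z : N), y = ∑ i, a i • b i + ϖ • z) (y : N) :
    ∃ a : ι → A, y = ∑ i, a i • b i := by
  have := isPrecomplete_pi (Ideal.span {ϖ}) (M := A) (ι := ι)
  have hsurj : Function.Surjective (Fintype.linearCombination A b) := by
    refine surjective_of_mkQ_comp_surjective (I := Ideal.span {ϖ}) fun q => ?_
    obtain ⟨y, rfl⟩ := Submodule.mkQ_surjective _ q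
    obtain ⟨a, z, hz⟩ := h y
    refine ⟨a, (Submodule.Quotient.eq _).2 ?_⟩
    rw [hz, Fintype.linearCombination_apply, sub_add_cancel_left]
    exact Submodule.neg_mem _
      (Submodule.smul_mem_smul (Ideal.mem_span_singleton_self ϖ) Submodule.mem_top)
  obtain ⟨a, ha⟩ := hsurj y
  exact ⟨a, ha.symm⟩

theorem sum_ne_zero_of_injOn {L : Type*} [Field L] (v : AddValuation L (WithTop ℤ)) {ι : Type*}
    {s : Finset ι} {f : ι → L} (hs : s.Nonempty) (hf : ∀ i ∈ s, f i ≠ 0)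
    (hinj : Set.InjOn (fun i => v (f i)) s) : ∑ i ∈ s, f i ≠ 0 := by
  classical
  obtain ⟨i, hi, hmin⟩ := s.exists_min_image (fun i => v (f i)) hs
  have htop : v (f i) ≠ ⊤ := v.ne_top_iff.2 (hf i hi)
  have hlt : v (f i) < v (∑ j ∈ s.erase i, f j) := v.map_lt_sum htop fun j hj =>
    (hmin j (Finset.mem_of_mem_erase hj)).lt_of_ne fun h =>
      Finset.ne_of_mem_erase hj (hinj (Finset.mem_of_mem_erase hj) hi h.symm)
  rw [← v.ne_top_iff, ← Finset.add_sum_erase _ _ hi, v.map_add_eq_of_lt_left hlt]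
  exact htop

theorem map_eq_coe_mul_of_forall_nonneg {L : Type*} [Field L] {v v' : AddValuation L (WithTop ℤ)}
    (h : ∀ x, 0 ≤ v x → 0 ≤ v' x) {π : L} (hπ : v π = 1) {m : ℤ} (hm : v' π = m) {x : L} {n : ℤ}
    (hx : v x = n) : v' x = ((n * m : ℤ) : WithTop ℤ) := by
  have hπn0 : π ^ n ≠ 0 := zpow_ne_zero _ (ne_zero_of_map_eq_coe v hπ)
  have hu : v (x / π ^ n) = 0 := by
    simpa using map_div_eq_coe v hx (map_zpow_eq_coe v (a := 1) hπ n)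
  have hu' : v' (x / π ^ n) = 0 := by
    have hx0 : x / π ^ n ≠ 0 := ne_zero_of_map_eq_coe v (a := 0) hu
    refine map_eq_zero_of_mul_eq_one v' (mul_inv_cancel₀ hx0) (h _ hu.ge) (h _ ?_)
    rw [AddValuation.map_inv, hu, neg_zero]
  rw [← div_mul_cancel₀ x hπn0, v'.map_mul, hu', zero_add, map_zpow_eq_coe v' hm]

section PowerBasis

variable {p : ℕ} [Fact p.Prime] {k : Type*} [Field k] [CharP k p] [IsAlgClosed k]
  {L : Type*} [Field L] [Algebra (K₀ p k) L] [Algebra.IsAlgebraic (K₀ p k) L]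
  {v : AddValuation L (WithTop ℤ)} (hv : IsNormalizedVal p k v)

include hv

/-- Modulo `p` every integral element is a combination of `1, π, …, π ^ (e - 1)`, and `W(k)` is
`p`-adically complete. -/
theorem exists_sum_ofWitt_mul_pow {π : L} (hπ : v π = 1) {e : ℕ}
    (he : v (p : L) = ((e : ℤ) : WithTop ℤ)) {x : L} (hx : 0 ≤ v x) :
    ∃ a : Fin e → WittVector p k, x = ∑ i, ofWitt p k L (a i) * π ^ (i : ℕ) := by
  have he1 : (1 : ℤ) ≤ e := WithTop.coe_le_coe.1 ((one_le_val_p hv).trans_eq he)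
  let _ : Module (WittVector p k) L := Module.compHom L (ofWitt p k L)
  have hsmul (a : WittVector p k) (y : L) : a • y = ofWitt p k L a * y := rfl
  let O : Submodule (WittVector p k) L :=
    { carrier := {y | 0 ≤ v y}
      add_mem' := v.map_le_add
      zero_mem' := by simp
      smul_mem' := fun a y hy => by
        rw [Set.mem_ofPred_eq, hsmul, v.map_mul]
        exact add_nonneg (val_ofWitt_nonneg hv a) hy }
  have := (WittVector.isAdicCompleteIdealSpanP (p := p) (k := k)).toIsPrecomplete
  have : IsHausdorff (Ideal.span {(p : WittVector p k)}) O := by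
    refine ⟨fun y hy => Subtype.ext (eq_zero_of_forall_mul_le_map v he1 fun n => ?_)⟩
    have hyn := hy n
    rw [SModEq.zero, Ideal.span_singleton_pow, Submodule.ideal_span_singleton_smul,
      Submodule.mem_smul_pointwise_iff_exists] at hyn
    obtain ⟨z, -, rfl⟩ := hyn
    rw [Submodule.coe_smul, hsmul, map_pow, map_natCast, v.map_mul, map_pow_eq_coe v he]
    exact le_add_of_nonneg_right z.2
  let b (i : Fin e) : O := ⟨π ^ (i : ℕ), map_pow_nonneg v (hπ ▸ zero_le_one) i⟩
  have happrox (y : O) :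
      ∃ (a : Fin e → WittVector p k) (z : O), y = ∑ i, a i • b i + (p : WittVector p k) • z := by
    obtain ⟨V, hV, hle⟩ := exists_poly_approx hv hπ y.2 e
    refine ⟨fun i => V.coeff i, ⟨_, coe_le_map_div v (a := 0) (by simpa using hle) he⟩,
      Subtype.ext ?_⟩
    have hp0 := p_ne_zero_ext p k L
    have hVsum : V.eval₂ (ofWitt p k L) π =
        ∑ i : Fin e, ofWitt p k L (V.coeff i) * π ^ (i : ℕ) := by
      rw [eval₂_eq_sum]
      exact (sum_fin _ (by simp) hV).symm
    simp [b, hsmul, hVsum, mul_div_cancel₀ _ hp0]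
  obtain ⟨a, ha⟩ := exists_sum_smul_eq_of_isHausdorff happrox ⟨x, hx⟩
  exact ⟨a, by simpa [b, hsmul] using congrArg Subtype.val ha⟩

theorem exists_poly_of_nonneg {π : L} (hπ : v π = 1) {e : ℕ}
    (he : v (p : L) = ((e : ℤ) : WithTop ℤ)) {x : L} (hx : 0 ≤ v x) :
    ∃ V : (WittVector p k)[X], V.degree < e ∧ x = V.eval₂ (ofWitt p k L) π := by
  obtain ⟨a, ha⟩ := exists_sum_ofWitt_mul_pow hv hπ he hx
  refine ⟨∑ i, C (a i) * X ^ (i : ℕ), degree_sum_fin_lt a, ?_⟩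
  simpa [eval₂_finsetSum] using ha

theorem exists_eq_uniformizer_pow_mul_eval₂ {π : L} (hπ : v π = 1) {x : L} {r : ℕ}
    (hx : ((r : ℤ) : WithTop ℤ) ≤ v x) :
    ∃ V : (WittVector p k)[X], x = π ^ r * V.eval₂ (ofWitt p k L) π := by
  obtain ⟨e, -, he⟩ := exists_val_p hv
  have hπr := map_uniformizer_pow v hπ r
  obtain ⟨V, -, hV⟩ := exists_poly_of_nonneg hv hπ he
    (coe_le_map_div v (a := 0) (by rwa [zero_add]) hπr)
  exact ⟨V, by rw [← hV, mul_div_cancel₀ _ (ne_zero_of_map_eq_coe v hπr)]⟩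

theorem exists_pow_p_mul_nonneg (x : L) : ∃ n : ℕ, 0 ≤ v ((p : L) ^ n * x) := by
  obtain ⟨e, he1, he⟩ := exists_val_p hv
  rcases eq_or_ne x 0 with rfl | hx
  · exact ⟨0, by simp⟩
  obtain ⟨m, hm⟩ := exists_map_eq_coe v hx
  refine ⟨m.natAbs, coe_le_of_coe_le (a := 0)
    (coe_add_le_map_mul v (map_pow_eq_coe v he _).ge hm.ge) ?_⟩
  have he1' : (1 : ℤ) ≤ e := by exact_mod_cast he1
  have hm' : -m ≤ (m.natAbs : ℤ) := by lia
  nlinarith [he1', hm']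

theorem span_uniformizer_pow {π : L} (hπ : v π = 1) {e : ℕ}
    (he : v (p : L) = ((e : ℤ) : WithTop ℤ)) :
    ⊤ ≤ Submodule.span (K₀ p k) (Set.range fun i : Fin e => π ^ (i : ℕ)) := by
  intro x _
  obtain ⟨n, hn⟩ := exists_pow_p_mul_nonneg hv x
  obtain ⟨a, ha⟩ := exists_sum_ofWitt_mul_pow hv hπ he hn
  have hx : x = ((p : K₀ p k) ^ n)⁻¹ • ((p : L) ^ n * x) := by
    rw [Algebra.smul_def, map_inv₀, map_pow, map_natCast, inv_mul_cancel_left₀]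
    exact pow_ne_zero _ (p_ne_zero_ext p k L)
  rw [hx, ha]
  refine Submodule.smul_mem _ _ (Submodule.sum_mem _ fun i _ => ?_)
  rw [ofWitt, RingHom.comp_apply, ← Algebra.smul_def]
  exact Submodule.smul_mem _ _ (Submodule.subset_span ⟨i, rfl⟩)

omit [Algebra.IsAlgebraic (K₀ p k) L] in
/-- The valuations of the terms of `∑ c_i π ^ i` are distinct modulo `e`. -/
theorem linearIndependent_uniformizer_pow {π : L} (hπ : v π = 1) {e : ℕ}
    (he : v (p : L) = ((e : ℤ) : WithTop ℤ)) :
    LinearIndependent (K₀ p k) fun i : Fin e => π ^ (i : ℕ) := by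
  classical
  rw [Fintype.linearIndependent_iff]
  intro c hc
  by_contra! hne
  have hπ0 : π ≠ 0 := ne_zero_of_map_eq_coe v hπ
  refine sum_ne_zero_of_injOn v (s := {i | c i ≠ 0}) (f := fun i => c i • π ^ (i : ℕ))
    (by simpa [Finset.Nonempty] using hne) (fun i hi => by simp_all) ?_ ?_
  · intro i hi j hj hij
    obtain ⟨n, hn⟩ := exists_val_algebraMap hv he (Finset.mem_filter_univ i |>.1 hi)
    obtain ⟨m, hm⟩ := exists_val_algebraMap hv he (Finset.mem_filter_univ j |>.1 hj)
    simp only [Algebra.smul_def, v.map_mul, hn, hm, map_uniformizer_pow v hπ] at hij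
    norm_cast at hij
    have hmod := congrArg (fun t : ℤ => t % e) hij
    simp only [Int.add_comm (n * e), Int.add_comm (m * e), Int.add_mul_emod_self_right] at hmod
    rw [Int.emod_eq_of_lt (by positivity) (by exact_mod_cast i.2),
      Int.emod_eq_of_lt (by positivity) (by exact_mod_cast j.2)] at hmod
    exact Fin.ext (by exact_mod_cast hmod)
  · rw [← hc]
    refine Finset.sum_subset (Finset.subset_univ _) fun i _ hi => ?_
    simp_all

theorem finrank_eq_of_val_p {e : ℕ} (he : v (p : L) = ((e : ℤ) : WithTop ℤ)) :
    Module.finrank (K₀ p k) L = e := by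
  obtain ⟨π, hπ⟩ := exists_uniformizer hv
  have hcard := Module.finrank_eq_card_basis (Module.Basis.mk
    (linearIndependent_uniformizer_pow hv hπ he) (span_uniformizer_pow hv hπ he))
  rwa [Fintype.card_fin] at hcard

section Unique

variable {v' : AddValuation L (WithTop ℤ)}

theorem map_uniformizer_nonneg_of_map_ofWitt_nonneg (hv' : ∀ a, 0 ≤ v' (ofWitt p k L a)) {π : L}
    (hπ : v π = 1) : 0 ≤ v' π := by
  obtain ⟨e, -, he⟩ := exists_val_p hv
  obtain ⟨V, hV, h⟩ := exists_poly_of_nonneg hv hπ he (map_pow_nonneg v (hπ ▸ zero_le_one) e)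
  refine map_nonneg_of_isIntegralElem v' hv' ⟨X ^ e - V, monic_X_pow_sub hV, ?_⟩
  rw [eval₂_sub, eval₂_pow, eval₂_X, h, sub_self]

theorem map_nonneg_of_map_ofWitt_nonneg (hv' : ∀ a, 0 ≤ v' (ofWitt p k L a)) {x : L}
    (hx : 0 ≤ v x) : 0 ≤ v' x := by
  obtain ⟨π, hπ⟩ := exists_uniformizer hv
  obtain ⟨e, -, he⟩ := exists_val_p hv
  obtain ⟨V, -, rfl⟩ := exists_poly_of_nonneg hv hπ he hx
  exact map_eval₂_nonneg v' hv' (map_uniformizer_nonneg_of_map_ofWitt_nonneg hv hv' hπ) V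

theorem isNormalizedVal_unique (hv' : IsNormalizedVal p k v') : v' = v := by
  obtain ⟨π, hπ⟩ := exists_uniformizer hv
  obtain ⟨π', hπ'⟩ := exists_uniformizer hv'
  have hnonneg (x : L) (hx : 0 ≤ v x) : 0 ≤ v' x :=
    map_nonneg_of_map_ofWitt_nonneg hv (val_ofWitt_nonneg hv') hx
  obtain ⟨m, hm⟩ := exists_map_eq_coe v' (ne_zero_of_map_eq_coe v hπ)
  obtain ⟨n, hn⟩ := exists_map_eq_coe v (ne_zero_of_map_eq_coe v' hπ')
  have hm0 : 0 ≤ m := WithTop.coe_le_coe.1 ((hnonneg π (hπ ▸ zero_le_one)).trans_eq hm)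
  have hm1 : m = 1 := by
    have hn1 := map_eq_coe_mul_of_forall_nonneg hnonneg hπ hm hn
    rw [hπ'] at hn1
    exact Int.eq_one_of_mul_eq_one_left hm0 (WithTop.coe_injective hn1.symm)
  ext x
  rcases eq_or_ne x 0 with rfl | hx
  · simp
  · obtain ⟨l, hl⟩ := exists_map_eq_coe v hx
    rw [map_eq_coe_mul_of_forall_nonneg hnonneg hπ hm hl, hl, hm1, mul_one]

end Unique

theorem val_algEquiv (g : L ≃ₐ[K₀ p k] L) (x : L) : v (g x) = v x := by
  have hv' : IsNormalizedVal p k (v.comap (g : L →+* L)) := by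
    refine ⟨fun n => ?_, fun a => ?_⟩
    · obtain ⟨y, hy⟩ := hv.1 n
      refine ⟨g.symm y, ?_⟩
      change v (g (g.symm y)) = n
      rw [g.apply_symm_apply, hy]
    · change 0 ≤ v (g _)
      rw [g.commutes]
      exact hv.2 a
  exact DFunLike.congr_fun (isNormalizedVal_unique hv hv') x

end PowerBasis

/-! ### The conductor -/

section HerbrandFunction

variable {K L : Type*} [Field K] [Field L] [Algebra K L] (v : AddValuation L (WithTop ℤ))

theorem one_mem_lowerRam (i : ℝ) : 1 ∈ lowerRam K v i := by
  intro π _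
  simp

theorem lowerRam_antitone : Antitone (lowerRam K v) := by
  intro i j hij g hg π hπ
  exact le_trans (by exact_mod_cast (by linarith)) (hg π hπ)

variable [FiniteDimensional K L]

theorem card_lowerRam_antitone :
    Antitone fun t => (Nat.card (lowerRam K v t) : ℝ) / Nat.card (lowerRam K v 0) := by
  intro i j hij
  have hcard : Nat.card (lowerRam K v j) ≤ Nat.card (lowerRam K v i) :=
    Nat.card_mono (Set.toFinite _) (lowerRam_antitone v hij)
  dsimp only
  gcongr

theorem one_le_card_lowerRam (i : ℝ) : (1 : ℝ) ≤ Nat.card (lowerRam K v i) := by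
  have : Nonempty (lowerRam K v i) := ⟨⟨1, one_mem_lowerRam v i⟩⟩
  exact Nat.one_le_cast.2 Nat.card_pos

theorem le_herbrandPhi_mul_card {i : ℝ} (hi : 0 ≤ i) :
    i ≤ herbrandPhi K v (i * Nat.card (lowerRam K v 0)) := by
  set N : ℝ := (Nat.card (lowerRam K v 0) : ℝ)
  have hN1 : 1 ≤ N := one_le_card_lowerRam v 0
  have hle : ∫ _ in (0 : ℝ)..(i * N), (1 / N) ≤ herbrandPhi K v (i * N) := by
    refine intervalIntegral.integral_mono_on (by positivity) (by simp)
      (card_lowerRam_antitone v).intervalIntegrable fun t _ => ?_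
    have := one_le_card_lowerRam (K := K) v t
    gcongr
  rwa [intervalIntegral.integral_const, smul_eq_mul, sub_zero, mul_assoc,
    mul_one_div_cancel (by positivity), mul_one] at hle

theorem herbrandPhi_surjOn {i : ℝ} (hi : 0 ≤ i) :
    ∃ u ∈ Set.Ici (0 : ℝ), herbrandPhi K v u = i := by
  have hcont : Continuous (herbrandPhi K v) :=
    intervalIntegral.continuous_primitive
      (fun a b => (card_lowerRam_antitone v).intervalIntegrable) 0
  have h0 : herbrandPhi K v 0 = 0 := intervalIntegral.integral_same
  obtain ⟨u, hu, hui⟩ := intermediate_value_Icc (by positivity) hcont.continuousOn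
    ⟨h0.le.trans hi, le_herbrandPhi_mul_card (K := K) v hi⟩
  exact ⟨u, hu.1, hui⟩

theorem exists_mem_lowerRam_of_lt_conductor {B : ℝ} (hB : 0 ≤ B) (h : B < conductor K v) :
    ∃ u : ℝ, 0 ≤ u ∧ B < herbrandPhi K v u ∧ ∃ g ∈ lowerRam K v u, g ≠ 1 := by
  have hne : {i : ℝ | 0 ≤ i ∧ upperRam K v i ≠ {1}}.Nonempty := by
    by_contra hemp
    rw [conductor, Set.not_nonempty_iff_eq_empty.1 hemp, Real.sSup_empty] at h
    exact absurd h hB.not_gt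
  obtain ⟨i, ⟨hi0, hi⟩, hBi⟩ := exists_lt_of_lt_csSup hne h
  have hsurj := herbrandPhi_surjOn (K := K) v hi0
  refine ⟨herbrandPsi K v i, Function.invFunOn_mem hsurj,
    hBi.trans_eq (Function.invFunOn_eq hsurj).symm, ?_⟩
  by_contra! hcon
  exact hi (Set.eq_singleton_iff_unique_mem.2 ⟨one_mem_lowerRam v _, hcon⟩)

end HerbrandFunction

theorem antitone_ite_one_zero {α : Type*} [Preorder α] {P : α → Prop} [DecidablePred P]
    (hP : ∀ ⦃s t⦄, s ≤ t → P t → P s) : Antitone fun t => if P t then (1 : ℝ) else 0 := by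
  intro s t hst
  by_cases ht : P t
  · simp [ht, hP hst ht]
  · simp only [ht, if_false]
    split_ifs <;> norm_num

theorem integral_ite_le_le {a u : ℝ} (ha : 0 ≤ a) (hu : 0 ≤ u) :
    (∫ t in (0 : ℝ)..u, if t ≤ a then (1 : ℝ) else 0) ≤ a := by
  have hset : (fun t : ℝ => if t ≤ a then (1 : ℝ) else 0) =
      {t | t ≤ a}.indicator fun _ => (1 : ℝ) := by
    funext t
    simp only [Set.indicator_apply, Set.mem_ofPred_eq]
  rw [hset]
  rcases le_total a u with h | h
  · rw [intervalIntegral.integral_indicator ⟨ha, h⟩]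
    simp
  · calc ∫ t in (0 : ℝ)..u, {t | t ≤ a}.indicator (fun _ => (1 : ℝ)) t
        = ∫ _ in (0 : ℝ)..u, (1 : ℝ) := intervalIntegral.integral_congr fun _ ht => by
          rw [Set.uIcc_of_le hu] at ht
          exact Set.indicator_of_mem (s := {t : ℝ | t ≤ a}) (ht.2.trans h) _
      _ ≤ a := by simpa using h

section Conductor

variable {p : ℕ} [Fact p.Prime] {k : Type*} [Field k] [CharP k p]
  {L : Type*} [Field L] [Algebra (K₀ p k) L]

theorem map_eval₂_ofWitt {M F : Type*} [Field M] [Algebra (K₀ p k) M] [FunLike F L M]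
    [AlgHomClass F (K₀ p k) L M] (f : F) (V : (WittVector p k)[X]) (x : L) :
    f (V.eval₂ (ofWitt p k L) x) = V.eval₂ (ofWitt p k M) (f x) := by
  have hcomp : (f : L →+* M).comp (ofWitt p k L) = ofWitt p k M :=
    RingHom.ext fun a => AlgHomClass.commutes f _
  have heval := hom_eval₂ V (ofWitt p k L) (f : L →+* M) x
  rwa [hcomp] at heval

variable [IsAlgClosed k] {v : AddValuation L (WithTop ℤ)} (hv : IsNormalizedVal p k v)

section Algebraic

variable [Algebra.IsAlgebraic (K₀ p k) L]

include hv

theorem val_uniformizer_sub_le {π : L} (hπ : v π = 1) (g : L ≃ₐ[K₀ p k] L) {x : L}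
    (hx : 0 ≤ v x) : v (g π - π) ≤ v (g x - x) := by
  obtain ⟨e, -, he⟩ := exists_val_p hv
  obtain ⟨V, -, rfl⟩ := exists_poly_of_nonneg hv hπ he hx
  rw [map_eval₂_ofWitt]
  have hπ0 : 0 ≤ v π := hπ ▸ zero_le_one
  exact le_map_eval₂_sub v (val_ofWitt_nonneg hv) (by rwa [val_algEquiv hv]) hπ0 le_rfl V

theorem algEquiv_eq_one_of_uniformizer {π : L} (hπ : v π = 1) {g : L ≃ₐ[K₀ p k] L}
    (hg : g π = π) : g = 1 := by
  have hint (x : L) (hx : 0 ≤ v x) : g x = x := by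
    have hle := val_uniformizer_sub_le hv hπ g hx
    rwa [hg, sub_self, v.map_zero, top_le_iff, v.top_iff, sub_eq_zero] at hle
  ext x
  change g x = x
  rcases le_or_gt 0 (v x) with hx | hx
  · exact hint x hx
  · have hx0 : x ≠ 0 := by
      rintro rfl
      simp at hx
    obtain ⟨n, hn⟩ := exists_map_eq_coe v hx0
    have hinv := hint x⁻¹ (by
      rw [AddValuation.map_inv, hn]
      rw [hn] at hx
      norm_cast at hx
      exact_mod_cast neg_nonneg.2 hx.le)
    rw [map_inv₀] at hinv
    exact inv_injective hinv

theorem one_le_val_algEquiv_sub {π : L} (hπ : v π = 1) (g : L ≃ₐ[K₀ p k] L) :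
    1 ≤ v (g π - π) :=
  v.map_le_sub (by rw [val_algEquiv hv, hπ]) hπ.ge

theorem exists_val_algEquiv_sub {π : L} (hπ : v π = 1) {g : L ≃ₐ[K₀ p k] L} (hg : g ≠ 1) :
    ∃ n : ℤ, 1 ≤ n ∧ v (g π - π) = n := by
  obtain ⟨n, hn⟩ := exists_map_eq_coe v (x := g π - π) fun h =>
    hg (algEquiv_eq_one_of_uniformizer hv hπ (sub_eq_zero.1 h))
  exact ⟨n, WithTop.coe_le_coe.1 ((one_le_val_algEquiv_sub hv hπ g).trans_eq hn), hn⟩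

theorem mem_lowerRam_iff {π : L} (hπ : v π = 1) {i : ℝ} {g : L ≃ₐ[K₀ p k] L} :
    g ∈ lowerRam (K₀ p k) v i ↔
      ((i + 1 : ℝ) : WithTop ℝ) ≤ WithTop.map (fun n : ℤ => (n : ℝ)) (v (g π - π)) := by
  refine ⟨fun h => h π hπ, fun h π' hπ' => h.trans ?_⟩
  have hmono : Monotone (fun n : ℤ => (n : ℝ)) := Int.cast_mono
  exact hmono.withTop_map (val_uniformizer_sub_le hv hπ g (hπ' ▸ zero_le_one))

theorem mem_lowerRam_iff_of_eq {π : L} (hπ : v π = 1) {i : ℝ} {g : L ≃ₐ[K₀ p k] L} {n : ℤ}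
    (hn : v (g π - π) = n) : g ∈ lowerRam (K₀ p k) v i ↔ i + 1 ≤ n := by
  rw [mem_lowerRam_iff hv hπ, hn, WithTop.map_coe, WithTop.coe_le_coe]

theorem lowerRam_zero : lowerRam (K₀ p k) v 0 = Set.univ := by
  obtain ⟨π, hπ⟩ := exists_uniformizer hv
  refine Set.eq_univ_of_forall fun g => ?_
  rcases eq_or_ne g 1 with rfl | hg
  · exact one_mem_lowerRam v 0
  · obtain ⟨n, hn1, hn⟩ := exists_val_algEquiv_sub hv hπ hg
    rw [mem_lowerRam_iff_of_eq hv hπ hn, zero_add]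
    exact_mod_cast hn1

theorem add_one_le_of_mem_lowerRam {π : L} (hπ : v π = 1) {t : ℝ} {g : L ≃ₐ[K₀ p k] L}
    (hg : g ∈ lowerRam (K₀ p k) v t) {i₀ n : ℤ} (ht : t + 1 ≤ i₀)
    (hn : min (i₀ : WithTop ℤ) (v (g π - π)) = n) : t + 1 ≤ n := by
  rcases eq_or_ne g 1 with rfl | hg1
  · have hi₀ : i₀ = n := by simpa using hn
    rwa [← hi₀]
  · obtain ⟨m, -, hm⟩ := exists_val_algEquiv_sub hv hπ hg1
    rw [hm, ← WithTop.coe_min, WithTop.coe_inj] at hn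
    rw [← hn, Int.cast_min]
    exact le_min ht ((mem_lowerRam_iff_of_eq hv hπ hm).1 hg)

end Algebraic

variable [FiniteDimensional (K₀ p k) L]

include hv

open scoped Classical in
theorem herbrandPhi_mul_card (u : ℝ) :
    herbrandPhi (K₀ p k) v u * Nat.card (L ≃ₐ[K₀ p k] L) =
      ∑ g : L ≃ₐ[K₀ p k] L, ∫ t in (0 : ℝ)..u,
        if g ∈ lowerRam (K₀ p k) v t then (1 : ℝ) else 0 := by
  have hG : (Nat.card (L ≃ₐ[K₀ p k] L) : ℝ) ≠ 0 := Nat.cast_ne_zero.2 Nat.card_pos.ne'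
  have hcard (t : ℝ) : (Nat.card (lowerRam (K₀ p k) v t) : ℝ) =
      ∑ g : L ≃ₐ[K₀ p k] L, if g ∈ lowerRam (K₀ p k) v t then (1 : ℝ) else 0 := by
    rw [Finset.sum_boole, Nat.card_eq_fintype_card]
    exact_mod_cast Fintype.card_subtype _
  rw [← intervalIntegral.integral_finsetSum fun g _ =>
      (antitone_ite_one_zero (P := fun t => g ∈ lowerRam (K₀ p k) v t)
        fun _ _ hst ht => lowerRam_antitone v hst ht).intervalIntegrable,
    herbrandPhi, lowerRam_zero hv, Nat.card_univ, intervalIntegral.integral_div,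
    div_mul_cancel₀ _ hG]
  simp_rw [hcard]

theorem herbrandPhi_le {π : L} (hπ : v π = 1) {i₀ : ℤ} {u : ℝ} (hu : 0 ≤ u) (hui : u + 1 ≤ i₀)
    {n : (L ≃ₐ[K₀ p k] L) → ℤ} (hn : ∀ g, min (i₀ : WithTop ℤ) (v (g π - π)) = n g) :
    (herbrandPhi (K₀ p k) v u + 1) * Nat.card (L ≃ₐ[K₀ p k] L) ≤ ((∑ g, n g : ℤ) : ℝ) := by
  classical
  have hn1 (g : L ≃ₐ[K₀ p k] L) : (1 : ℝ) ≤ n g := by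
    have hi₀ : (1 : ℤ) ≤ i₀ := by exact_mod_cast (le_add_of_nonneg_left hu).trans hui
    have hmin : (1 : WithTop ℤ) ≤ n g :=
      (le_min (WithTop.coe_le_coe.2 hi₀) (one_le_val_algEquiv_sub hv hπ g)).trans_eq (hn g)
    exact_mod_cast hmin
  have hint (g : L ≃ₐ[K₀ p k] L) :
      (∫ t in (0 : ℝ)..u, if g ∈ lowerRam (K₀ p k) v t then (1 : ℝ) else 0) ≤ n g - 1 := by
    refine le_trans (intervalIntegral.integral_mono_on hu
      (antitone_ite_one_zero fun _ _ hst ht => lowerRam_antitone v hst ht).intervalIntegrable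
      (antitone_ite_one_zero fun _ _ => le_trans).intervalIntegrable fun t ht => ?_)
      (integral_ite_le_le (sub_nonneg.2 (hn1 g)) hu)
    by_cases hg : g ∈ lowerRam (K₀ p k) v t
    · have htn := add_one_le_of_mem_lowerRam hv hπ hg (by linarith [ht.2]) (hn g)
      rw [if_pos hg, if_pos (le_sub_iff_add_le.2 htn)]
    · rw [if_neg hg]
      split_ifs <;> norm_num
  rw [add_mul, one_mul, herbrandPhi_mul_card hv]
  calc _ ≤ ∑ g : L ≃ₐ[K₀ p k] L, ((n g : ℝ) - 1) + Nat.card (L ≃ₐ[K₀ p k] L) := by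
        gcongr with g
        exact hint g
    _ = _ := by
        rw [Finset.sum_sub_distrib, Nat.card_eq_fintype_card]
        simp

theorem exists_ramification_of_lt_conductor {π : L} (hπ : v π = 1) {B : ℝ} (hB : 0 ≤ B)
    (h : B < conductor (K₀ p k) v) :
    ∃ i₀ D : ℤ, 1 ≤ i₀ ∧ (∃ g : L ≃ₐ[K₀ p k] L, g ≠ 1 ∧ v (g π - π) = i₀) ∧
      ∑ g : L ≃ₐ[K₀ p k] L, min (i₀ : WithTop ℤ) (v (g π - π)) = D ∧
      (B + 1) * Nat.card (L ≃ₐ[K₀ p k] L) < D := by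
  classical
  obtain ⟨u, hu0, hBu, g₁, hg₁, hg₁1⟩ := exists_mem_lowerRam_of_lt_conductor v hB h
  obtain ⟨g₀, hg₀, hmax⟩ := (Finset.univ.filter fun g : L ≃ₐ[K₀ p k] L => g ≠ 1).exists_max_image
    (fun g => v (g π - π)) ⟨g₁, by simpa using hg₁1⟩
  have hg₀1 : g₀ ≠ 1 := (Finset.mem_filter.1 hg₀).2
  obtain ⟨i₀, hi₀1, hi₀⟩ := exists_val_algEquiv_sub hv hπ hg₀1
  obtain ⟨n₁, -, hn₁⟩ := exists_val_algEquiv_sub hv hπ hg₁1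
  have hui₀ : u + 1 ≤ i₀ := by
    have hle := hmax g₁ (by simpa using hg₁1)
    rw [hn₁, hi₀, WithTop.coe_le_coe] at hle
    exact ((mem_lowerRam_iff_of_eq hv hπ hn₁).1 hg₁).trans (by exact_mod_cast hle)
  have hn (g : L ≃ₐ[K₀ p k] L) : ∃ n : ℤ, min (i₀ : WithTop ℤ) (v (g π - π)) = n :=
    (WithTop.ne_top_iff_exists.1 (min_lt_of_left_lt (WithTop.coe_lt_top i₀)).ne).imp
      fun _ => Eq.symm
  choose n hn using hn
  refine ⟨i₀, ∑ g, n g, hi₀1, ⟨g₀, hg₀1, hi₀⟩, ?_, ?_⟩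
  · simp_rw [hn]
    norm_cast
  · refine lt_of_lt_of_le ?_ (herbrandPhi_le hv hπ hu0 hui₀ hn)
    have hG : (0 : ℝ) < Nat.card (L ≃ₐ[K₀ p k] L) := Nat.cast_pos.2 Nat.card_pos
    gcongr

end Conductor

/-! ### Roots of unity -/

section RootsOfUnity

variable {L : Type*} [Field L] (v : AddValuation L (WithTop ℤ))

theorem map_eq_zero_of_pow_eq {x y : L} {n : ℕ} (hn : n ≠ 0) (hx : x ^ n = y) (hy : v y = 0) :
    v x = 0 := by
  have hy0 : y ≠ 0 := ne_zero_of_map_eq_coe v (a := 0) hy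
  obtain ⟨a, ha⟩ := exists_map_eq_coe v (x := x) (by
    rintro rfl
    exact hy0 (hx.symm.trans (zero_pow hn)))
  have hna := map_pow_eq_coe v ha n
  rw [hx, hy] at hna
  norm_cast at hna
  rw [ha, (mul_eq_zero.1 hna.symm).resolve_left (mod_cast hn), WithTop.coe_zero]

theorem map_eq_zero_of_pow_eq_one {x : L} {n : ℕ} (hn : n ≠ 0) (hx : x ^ n = 1) : v x = 0 :=
  map_eq_zero_of_pow_eq v hn hx v.map_one

theorem map_sub_one_le_map_pow_sub_one {x : L} (hx : 0 ≤ v x) (n : ℕ) :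
    v (x - 1) ≤ v (x ^ n - 1) := by
  simpa only [one_pow] using le_map_pow_sub_pow v hx v.map_one.ge le_rfl n

theorem map_primitiveRoot_sub_one_eq {n : ℕ} (hn : n ≠ 0) {x y : L} (hx : IsPrimitiveRoot x n)
    (hy : IsPrimitiveRoot y n) : v (x - 1) = v (y - 1) := by
  have : NeZero n := ⟨hn⟩
  have hle {x y : L} (hx : IsPrimitiveRoot x n) (hy : IsPrimitiveRoot y n) :
      v (x - 1) ≤ v (y - 1) := by
    obtain ⟨i, -, rfl⟩ := hx.eq_pow_of_pow_eq_one hy.pow_eq_one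
    exact map_sub_one_le_map_pow_sub_one v (map_eq_zero_of_pow_eq_one v hn hx.pow_eq_one).ge i
  exact le_antisymm (hle hx hy) (hle hy hx)

theorem exists_pow_eq_of_pow_mul_eq {m n : ℕ} [NeZero m] [NeZero n] {ξ x y : L}
    (hξ : IsPrimitiveRoot ξ (m * n)) (h : x ^ (m * n) = y ^ n) : ∃ z : L, z ^ m = y := by
  by_cases hx : x = 0
  · rw [hx, zero_pow (NeZero.ne _), eq_comm, pow_eq_zero_iff (NeZero.ne n)] at h
    exact ⟨0, by rw [h, zero_pow (NeZero.ne m)]⟩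
  have hxm : x ^ m ≠ 0 := pow_ne_zero m hx
  have hquot : (y / x ^ m) ^ n = 1 := by
    rw [div_pow, ← pow_mul, h, div_self (h ▸ pow_ne_zero _ hx)]
  obtain ⟨i, -, hi⟩ :=
    (hξ.pow (NeZero.pos (m * n)) rfl : IsPrimitiveRoot (ξ ^ m) n).eq_pow_of_pow_eq_one hquot
  exact ⟨ξ ^ i * x, by rw [mul_pow, ← pow_mul, mul_comm i, pow_mul, hi, div_mul_cancel₀ _ hxm]⟩

theorem prod_nthRootsFinset_sub {R : Type*} [CommRing R] [Algebra L R] {q : ℕ} (hq : 0 < q)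
    {ξ : L} (hξ : IsPrimitiveRoot ξ q) {x a : L} (hx : x ^ q = a) (ha : a ≠ 0) (Z : R) :
    ∏ s ∈ nthRootsFinset q a, (Z - algebraMap L R s) = Z ^ q - algebraMap L R a := by
  have hfactor : X ^ q - C a = ∏ s ∈ nthRootsFinset q a, (X - C s) := by
    classical
    rw [(X_pow_sub_C_splits_of_isPrimitiveRoot hξ hx).eq_prod_roots_of_monic
      (monic_X_pow_sub_C _ hq.ne'), ← nthRoots, nthRootsFinset_def, Finset.prod,
      Multiset.toFinset_val, (hξ.nthRoots_nodup ha).dedup]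
  simpa using (congrArg (aeval Z) hfactor).symm

variable {p : ℕ} [hp : Fact p.Prime]

theorem exists_map_primitiveRoot_sub_one {n : ℕ} {x : L} (hx : IsPrimitiveRoot x (p ^ (n + 1)))
    {e : ℤ} (he : v (p : L) = e) :
    ∃ N : ℤ, v (x - 1) = N ∧ (p ^ n * (p - 1) : ℤ) * N = e := by
  have hpos : 0 < p ^ (n + 1) := pow_pos hp.out.pos _
  have hprod : (p : L) = ∏ μ ∈ primitiveRoots (p ^ (n + 1)) L, (1 - μ) := by
    rw [← eval_one_cyclotomic_prime_pow (R := L) n, cyclotomic_eq_prod_X_sub_primitiveRoots hx,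
      eval_prod]
    simp only [eval_sub, eval_X, eval_C]
  have hval : v (p : L) = (p ^ (n + 1)).totient • v (x - 1) := by
    rw [hprod, map_prod_eq_sum, ← hx.card_primitiveRoots, ← Finset.sum_const]
    refine Finset.sum_congr rfl fun μ hμ => ?_
    rw [v.map_sub_swap]
    exact map_primitiveRoot_sub_one_eq v hpos.ne' ((mem_primitiveRoots hpos).1 hμ) hx
  obtain ⟨N, hN⟩ := exists_map_eq_coe v
    (sub_ne_zero.2 (hx.ne_one (Nat.one_lt_pow n.succ_ne_zero hp.out.one_lt)))
  refine ⟨N, hN, ?_⟩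
  rw [hN, he, Nat.totient_prime_pow_succ hp.out, coe_nsmul, WithTop.coe_eq_coe] at hval
  rw [hval, Nat.cast_mul, Nat.cast_sub hp.out.one_le, Nat.cast_pow, Nat.cast_one]

theorem map_primitiveRoot_pow_sub_one {n : ℕ} {x : L} (hx : IsPrimitiveRoot x (p ^ (n + 1)))
    {e ε : ℤ} (he : v (p : L) = e) (hε : (p - 1 : ℤ) * ε = e) : v (x ^ p ^ n - 1) = ε := by
  have hprim : IsPrimitiveRoot (x ^ p ^ n) (p ^ (0 + 1)) := by
    simpa only [zero_add, pow_one] using hx.pow (pow_pos hp.out.pos _) (pow_succ p n)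
  obtain ⟨N, hN, hNe⟩ := exists_map_primitiveRoot_sub_one v hprim he
  have hp2 : (2 : ℤ) ≤ p := by exact_mod_cast hp.out.two_le
  rw [← hε, pow_zero, one_mul] at hNe
  rw [hN, mul_left_cancel₀ (by omega) hNe]

theorem eq_one_of_lt_map_sub_one {c : ℕ} {x : L} (hx : x ^ p ^ c = 1) {e ε : ℤ}
    (he : v (p : L) = e) (hε : (p - 1 : ℤ) * ε = e) (h : (ε : WithTop ℤ) < v (x - 1)) :
    x = 1 := by
  obtain ⟨j, -, hj⟩ := (Nat.dvd_prime_pow hp.out).1 (orderOf_dvd_of_pow_eq_one hx)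
  have hprim : IsPrimitiveRoot x (p ^ j) := hj ▸ IsPrimitiveRoot.orderOf x
  cases j with
  | zero => simpa only [pow_zero, pow_one] using hprim.pow_eq_one
  | succ j =>
    have hx0 := map_eq_zero_of_pow_eq_one v (pow_ne_zero c hp.out.ne_zero) hx
    exact absurd (h.trans_le (map_sub_one_le_map_pow_sub_one v hx0.ge (p ^ j)))
      (map_primitiveRoot_pow_sub_one v hprim he hε).not_gt

theorem derivative_cyclotomic_prime_pow_mul {n : ℕ} {x : L}
    (hx : IsPrimitiveRoot x (p ^ (n + 1))) :
    (derivative (cyclotomic (p ^ (n + 1)) L)).eval x * (x ^ p ^ n - 1) =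
      p ^ (n + 1) * x ^ (p ^ (n + 1) - 1) := by
  have hroot : (cyclotomic (p ^ (n + 1)) L).eval x = 0 :=
    hx.isRoot_cyclotomic (pow_pos hp.out.pos _)
  have h := congrArg (fun q => (derivative q).eval x)
    (cyclotomic_prime_pow_mul_X_pow_sub_one L p n)
  simpa only [derivative_mul, derivative_sub, derivative_X_pow, derivative_one, eval_add,
    eval_mul, eval_sub, eval_pow, eval_X, eval_one, hroot, zero_mul, add_zero, eval_C,
    sub_zero, Nat.cast_pow] using h

theorem map_derivative_cyclotomic {n : ℕ} {x : L} (hx : IsPrimitiveRoot x (p ^ (n + 1)))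
    {e ε : ℤ} (he : v (p : L) = e) (hε : (p - 1 : ℤ) * ε = e) :
    v ((derivative (cyclotomic (p ^ (n + 1)) L)).eval x) = (((n + 1) * e - ε : ℤ) : WithTop ℤ) := by
  have hpos : 0 < p ^ (n + 1) := pow_pos hp.out.pos _
  have hx0 : v x = ((0 : ℤ) : WithTop ℤ) := map_eq_zero_of_pow_eq_one v hpos.ne' hx.pow_eq_one
  have hsub := map_primitiveRoot_pow_sub_one v hx he hε
  rw [eq_div_of_mul_eq (ne_zero_of_map_eq_coe v hsub) (derivative_cyclotomic_prime_pow_mul hx),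
    map_div_eq_coe v (map_mul_eq_coe v (map_pow_eq_coe v he _) (map_pow_eq_coe v hx0 _)) hsub]
  rw [mul_zero, add_zero, Nat.cast_add, Nat.cast_one]

end RootsOfUnity

section CloseRoots

variable {L : Type*} [Field L] (v : AddValuation L (WithTop ℤ))

theorem gaussVal_one_add_X_pow_sub_C {q : ℕ} (hq : 0 < q) {ξ : L} (hξ : IsPrimitiveRoot ξ q)
    {y a : L} (hy : y ^ q = a) (ha : a ≠ 0) {ρ : ℤ} (hρ : ∀ s, s ^ q = a → v (s - 1) ≤ ρ) :
    gaussVal v ρ ((1 + X) ^ q - C a) = v (a - 1) := by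
  have hone := prod_nthRootsFinset_sub hq hξ hy ha (1 : L)
  have hpoly := prod_nthRootsFinset_sub hq hξ hy ha (1 + X : L[X])
  rw [algebraMap_eq] at hpoly
  rw [Algebra.algebraMap_self, RingHom.id_apply, one_pow] at hone
  rw [← hpoly, map_prod_eq_sum, v.map_sub_swap, ← hone, map_prod_eq_sum]
  refine Finset.sum_congr rfl fun s hs => ?_
  have hfactor : (1 + X - C s : L[X]) = X + C (1 - s) := by rw [C_sub, C_1]; ring
  rw [hfactor, gaussVal_X_add_C, v.map_sub_swap, RingHom.id_apply, v.map_sub_swap 1 s]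
  exact min_eq_right (hρ s ((mem_nthRootsFinset hq a).1 hs))

/-- Here `y` is the `q`-th root of `1 + t` closest to `1`: for it, no term of the binomial
expansion of `(1 + (y - 1)) ^ q - 1` is larger than the sum `t`. -/
theorem exists_root_close_to_one {q : ℕ} (hq : 0 < q) {ξ : L} (hξ : IsPrimitiveRoot ξ q)
    {x t : L} (hx : x ^ q = 1 + t) (hx0 : x ≠ 0) {R : ℕ} (hR : ((R : ℤ) : WithTop ℤ) ≤ v t) :
    ∃ y : L, y ^ q = 1 + t ∧ ∃ r : ℕ, ((r : ℤ) : WithTop ℤ) ≤ v (y - 1) ∧ ∀ j ≥ 1,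
      ((R : ℤ) : WithTop ℤ) ≤ v ((q.choose j : ℕ) : L) + ((j * r : ℤ) : WithTop ℤ) := by
  by_cases ht : t = 0
  · refine ⟨1, by rw [one_pow, ht, add_zero], R, by simp, fun j hj => ?_⟩
    refine (WithTop.coe_le_coe.2 ?_).trans
      (le_add_of_nonneg_left (map_natCast_nonneg v (q.choose j)))
    exact le_mul_of_one_le_left R.cast_nonneg (by exact_mod_cast hj)
  have ha : 1 + t ≠ 0 := hx ▸ pow_ne_zero q hx0
  obtain ⟨y, hy, hmax⟩ := (nthRootsFinset q (1 + t)).exists_max_image (fun s => v (s - 1))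
    ⟨x, (mem_nthRootsFinset hq _).2 hx⟩
  rw [mem_nthRootsFinset hq] at hy
  obtain ⟨ρ, hρ⟩ := exists_map_eq_coe v (x := y - 1) (sub_ne_zero.2 (by
    rintro rfl
    rw [one_pow, left_eq_add] at hy
    exact ht hy))
  have hgauss := gaussVal_one_add_X_pow_sub_C v hq hξ hy ha fun s hs =>
    hρ ▸ hmax s ((mem_nthRootsFinset hq _).2 hs)
  rw [add_sub_cancel_left] at hgauss
  have hcoeff (j : ℕ) (hj : j ≥ 1) :
      ((R : ℤ) : WithTop ℤ) ≤ v ((q.choose j : ℕ) : L) + ((j * ρ : ℤ) : WithTop ℤ) := by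
    have h := (coe_le_gaussVal v ρ).1 (hR.trans_eq hgauss.symm) j
    rw [coeff_sub, coeff_C_of_ne_zero (by omega), sub_zero, coeff_one_add_X_pow] at h
    exact coe_le_add_coe_iff.2 h
  have hρ0 : 0 ≤ ρ := by
    have h := hcoeff q hq
    rw [Nat.choose_self, Nat.cast_one, v.map_one, zero_add, WithTop.coe_le_coe] at h
    exact nonneg_of_mul_nonneg_right (R.cast_nonneg.trans h) (by exact_mod_cast hq)
  lift ρ to ℕ using hρ0
  exact ⟨y, hy, ρ, hρ.ge, hcoeff⟩

end CloseRoots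

/-! ### The generic point of a disc around a uniformizer -/

section WittPolynomials

variable {p : ℕ} [Fact p.Prime] {k : Type*} [Field k] [CharP k p]
  {L : Type*} [Field L] [Algebra (K₀ p k) L]

theorem map_ofWitt_comp (U V : (WittVector p k)[X]) :
    (U.comp V).map (ofWitt p k L) =
      U.eval₂ ((C : L →+* L[X]).comp (ofWitt p k L)) (V.map (ofWitt p k L)) := by
  rw [Polynomial.map_comp, comp, eval₂_map]

theorem map_algEquiv_map_ofWitt (h : L ≃ₐ[K₀ p k] L) (V : (WittVector p k)[X]) :
    (V.map (ofWitt p k L)).map (h : L →+* L) = V.map (ofWitt p k L) := by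
  rw [Polynomial.map_map]
  congr 1
  exact RingHom.ext fun a => h.commutes _

end WittPolynomials

theorem discVal_nonneg {R : Type*} [CommRing R] (v : AddValuation R (WithTop ℤ)) {ρ : ℤ}
    (hρ : 0 ≤ ρ) {z : R} (hz : 0 ≤ v z) {f : R[X]} (hf : ∀ i, 0 ≤ v (f.coeff i)) :
    0 ≤ discVal v ρ z f := by
  have hX : 0 ≤ discVal v ρ z X := by
    rw [← sub_zero X, ← C_0, discVal_X_sub_C, sub_zero]
    exact le_min (WithTop.coe_le_coe.2 hρ) hz
  rw [f.as_sum_range_C_mul_X_pow]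
  refine AddValuation.map_le_sum _ fun i _ => ?_
  rw [AddValuation.map_mul, discVal_C]
  exact add_nonneg (hf i) (map_pow_nonneg _ hX i)

section GenericPoint

variable {p : ℕ} [hp : Fact p.Prime] {k : Type*} [Field k] [CharP k p]
  {L : Type*} [Field L] [Algebra (K₀ p k) L]

/-- A valuation `w` on `L[X]` extending `v`, for which `X` behaves like an approximation of the
uniformizer `π` defined over `K₀`: polynomials over `W(k)` vanishing at `π` have valuation at
least `D`, and letting elements of `H` act on the coefficients does not decrease `w`. -/
structure IsGenericPoint (p : ℕ) [Fact p.Prime] (k : Type*) [Field k] [CharP k p]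
    {L : Type*} [Field L] [Algebra (K₀ p k) L] (v : AddValuation L (WithTop ℤ)) (π : L) (D : ℤ)
    (H : Set (L ≃ₐ[K₀ p k] L)) (w : AddValuation L[X] (WithTop ℤ)) : Prop where
  val_C : ∀ a, w (C a) = v a
  val_X : w X = 1
  val_of_root : ∀ Q : (WittVector p k)[X], Q.eval₂ (ofWitt p k L) π = 0 →
    (D : WithTop ℤ) ≤ w (Q.map (ofWitt p k L))
  le_val_map : ∀ h ∈ H, ∀ f : L[X], w f ≤ w (f.map (h : L →+* L))

section Disc

variable {v : AddValuation L (WithTop ℤ)} {π : L} [IsAlgClosed k]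
  [FiniteDimensional (K₀ p k) L] (hv : IsNormalizedVal p k v) (hπ : v π = 1)

include hv hπ

theorem prod_X_sub_C_dvd_of_root {Q : (WittVector p k)[X]} (hQ : Q.eval₂ (ofWitt p k L) π = 0) :
    ∏ g : L ≃ₐ[K₀ p k] L, (X - C (g π)) ∣ Q.map (ofWitt p k L) := by
  have hinj : Function.Injective fun g : L ≃ₐ[K₀ p k] L => g π := fun g g' h =>
    (inv_mul_eq_one.1 (algEquiv_eq_one_of_uniformizer hv hπ
      ((AlgEquiv.symm_apply_eq g').2 h : (g'⁻¹ * g) π = π))).symm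
  refine Finset.prod_dvd_of_coprime (fun g _ g' _ hne => pairwise_coprime_X_sub_C hinj hne)
    fun g _ => ?_
  rw [dvd_iff_isRoot, IsRoot, eval_map, ← map_eval₂_ofWitt, hQ, map_zero]

theorem sum_min_le_discVal_of_root {i₀ : ℤ} (hi₀ : 0 ≤ i₀) {Q : (WittVector p k)[X]}
    (hQ : Q.eval₂ (ofWitt p k L) π = 0) :
    ∑ g : L ≃ₐ[K₀ p k] L, min (i₀ : WithTop ℤ) (v (g π - π)) ≤
      discVal v i₀ π (Q.map (ofWitt p k L)) := by
  obtain ⟨S, hS⟩ := prod_X_sub_C_dvd_of_root hv hπ hQ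
  have hP (i : ℕ) : 0 ≤ v ((∏ g : L ≃ₐ[K₀ p k] L, (X - C (g π))).coeff i) := by
    have hgauss : ((0 : ℤ) : WithTop ℤ) ≤ gaussVal v 0 (∏ g : L ≃ₐ[K₀ p k] L, (X - C (g π))) := by
      rw [map_prod_eq_sum]
      refine Finset.sum_nonneg fun g _ => ?_
      rw [sub_eq_add_neg, ← C_neg, gaussVal_X_add_C, v.map_neg, val_algEquiv hv, hπ]
      exact le_min le_rfl zero_le_one
    simpa only [mul_zero, sub_zero, WithTop.coe_zero] using (coe_le_gaussVal v 0).1 hgauss i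
  have hScoeff := coeff_nonneg_of_monic_mul v (monic_prod_of_monic _ _ fun g _ => monic_X_sub_C _)
    hP fun i => by
      rw [← hS, coeff_map]
      exact val_ofWitt_nonneg hv _
  rw [hS, AddValuation.map_mul, map_prod_eq_sum]
  simp only [discVal_X_sub_C, v.map_sub_swap π]
  exact le_add_of_nonneg_right (discVal_nonneg v hi₀ (hπ ▸ zero_le_one) hScoeff)

theorem isGenericPoint_discVal {i₀ : ℤ} (hi₀ : 1 ≤ i₀) {D : ℤ}
    (hD : ∑ g : L ≃ₐ[K₀ p k] L, min (i₀ : WithTop ℤ) (v (g π - π)) = D) :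
    IsGenericPoint p k v π D {h | (i₀ : WithTop ℤ) ≤ v (h π - π)} (discVal v i₀ π) where
  val_C := discVal_C v i₀ π
  val_X := by
    rw [← sub_zero X, ← C_0, discVal_X_sub_C, sub_zero, hπ]
    exact min_eq_right (WithTop.coe_le_coe.2 hi₀)
  val_of_root _ hQ := hD ▸ sum_min_le_discVal_of_root hv hπ (zero_le_one.trans hi₀) hQ
  le_val_map h hh f := by
    rw [← discVal_map v i₀ (σ := (h : L →+* L)) (val_algEquiv hv h) π f]
    refine discVal_le_discVal_of_center v i₀ ?_ _
    rw [v.map_sub_swap]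
    exact hh

end Disc

/-! ### Lifting elements of `L` to polynomials in the generic point -/

/-- `Z` agrees, up to relative precision `κ`, with the polynomial obtained by writing
`z = π ^ r * V(π)` with `V` over `W(k)` and replacing `π` by `X`. -/
def LiftsTo (p : ℕ) [Fact p.Prime] (k : Type*) [Field k] [CharP k p]
    {L : Type*} [Field L] [Algebra (K₀ p k) L] (π : L) (w : AddValuation L[X] (WithTop ℤ)) (κ : ℤ)
    (r : ℕ) (z : L) (Z : L[X]) : Prop :=
  ∃ V : (WittVector p k)[X], z = π ^ r * V.eval₂ (ofWitt p k L) π ∧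
    ((r + κ : ℤ) : WithTop ℤ) ≤ w (Z - X ^ r * V.map (ofWitt p k L))

section Basic

variable {π : L} {w : AddValuation L[X] (WithTop ℤ)} {κ : ℤ}

theorem LiftsTo.pow_mul_eval₂ (π : L) (w : AddValuation L[X] (WithTop ℤ)) (κ : ℤ) (r : ℕ)
    (V : (WittVector p k)[X]) :
    LiftsTo p k π w κ r (π ^ r * V.eval₂ (ofWitt p k L) π) (X ^ r * V.map (ofWitt p k L)) :=
  ⟨V, rfl, by rw [sub_self, w.map_zero]; exact le_top⟩

theorem LiftsTo.natCast (π : L) (w : AddValuation L[X] (WithTop ℤ)) (κ : ℤ) (n : ℕ) :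
    LiftsTo p k π w κ 0 (n : L) (n : L[X]) := by
  simpa using LiftsTo.pow_mul_eval₂ (p := p) (k := k) π w κ 0 n

theorem LiftsTo.one (π : L) (w : AddValuation L[X] (WithTop ℤ)) (κ : ℤ) :
    LiftsTo p k π w κ 0 1 1 := by
  simpa using LiftsTo.natCast (p := p) (k := k) π w κ 1

theorem LiftsTo.zero (π : L) (w : AddValuation L[X] (WithTop ℤ)) (κ : ℤ) (r : ℕ) :
    LiftsTo p k π w κ r 0 0 := by
  simpa using LiftsTo.pow_mul_eval₂ (p := p) (k := k) π w κ r 0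

theorem LiftsTo.add {r : ℕ} {z₁ z₂ : L} {Z₁ Z₂ : L[X]} (h₁ : LiftsTo p k π w κ r z₁ Z₁)
    (h₂ : LiftsTo p k π w κ r z₂ Z₂) : LiftsTo p k π w κ r (z₁ + z₂) (Z₁ + Z₂) := by
  obtain ⟨V₁, rfl, hV₁⟩ := h₁
  obtain ⟨V₂, rfl, hV₂⟩ := h₂
  refine ⟨V₁ + V₂, by rw [eval₂_add, mul_add], ?_⟩
  rw [Polynomial.map_add, mul_add, add_sub_add_comm]
  exact w.map_le_add hV₁ hV₂

theorem LiftsTo.sum {ι : Type*} (s : Finset ι) {r : ℕ} {z : ι → L} {Z : ι → L[X]}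
    (h : ∀ i ∈ s, LiftsTo p k π w κ r (z i) (Z i)) :
    LiftsTo p k π w κ r (∑ i ∈ s, z i) (∑ i ∈ s, Z i) := by
  classical
  induction s using Finset.induction_on with
  | empty => simpa only [Finset.sum_empty] using LiftsTo.zero π w κ r
  | insert i s hi ih =>
    rw [Finset.sum_insert hi, Finset.sum_insert hi]
    exact (h i (Finset.mem_insert_self i s)).add
      (ih fun j hj => h j (Finset.mem_insert_of_mem hj))

theorem LiftsTo.mono {r r' : ℕ} (hr : r ≤ r') {z : L} {Z : L[X]}
    (h : LiftsTo p k π w κ r' z Z) : LiftsTo p k π w κ r z Z := by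
  obtain ⟨V, rfl, hV⟩ := h
  refine ⟨X ^ (r' - r) * V, ?_, ?_⟩
  · rw [eval₂_mul, eval₂_pow, eval₂_X, ← mul_assoc, ← pow_add, Nat.add_sub_cancel' hr]
  · rw [Polynomial.map_mul, Polynomial.map_pow, map_X, ← mul_assoc, ← pow_add,
      Nat.add_sub_cancel' hr]
    exact coe_le_of_coe_le hV (by omega)

theorem LiftsTo.le_val {v : AddValuation L (WithTop ℤ)} (hv : IsNormalizedVal p k v)
    (hπ : v π = 1) {r : ℕ} {z : L} {Z : L[X]} (h : LiftsTo p k π w κ r z Z) :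
    ((r : ℤ) : WithTop ℤ) ≤ v z := by
  obtain ⟨V, rfl, -⟩ := h
  rw [v.map_mul, map_uniformizer_pow v hπ]
  exact le_add_of_nonneg_right
    (map_eval₂_nonneg v (val_ofWitt_nonneg hv) (hπ ▸ zero_le_one) V)

end Basic

variable {v : AddValuation L (WithTop ℤ)} {π : L} {D : ℤ} {H : Set (L ≃ₐ[K₀ p k] L)}
  {w : AddValuation L[X] (WithTop ℤ)} (hv : IsNormalizedVal p k v)
  (hw : IsGenericPoint p k v π D H w) {κ : ℤ}

include hw

theorem LiftsTo.le_val_sub (hκ : κ ≤ D) {r : ℕ} {z : L} {Z Z' : L[X]} (hπ0 : π ≠ 0)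
    (h : LiftsTo p k π w κ r z Z) (h' : LiftsTo p k π w κ r z Z') :
    ((r + κ : ℤ) : WithTop ℤ) ≤ w (Z - Z') := by
  obtain ⟨V, hzV, hV⟩ := h
  obtain ⟨V', hzV', hV'⟩ := h'
  have hroot : (V - V').eval₂ (ofWitt p k L) π = 0 := by
    rw [eval₂_sub, sub_eq_zero]
    exact mul_left_cancel₀ (pow_ne_zero r hπ0) (hzV.symm.trans hzV')
  have hsplit : Z - Z' = (Z - X ^ r * V.map (ofWitt p k L)) -
      (Z' - X ^ r * V'.map (ofWitt p k L)) + X ^ r * (V - V').map (ofWitt p k L) := by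
    rw [Polynomial.map_sub]; ring
  rw [hsplit]
  exact w.map_le_add (w.map_le_sub hV hV') (coe_le_of_coe_le
    (coe_add_le_map_mul w (map_uniformizer_pow w hw.val_X r).ge (hw.val_of_root _ hroot))
    (by omega))

include hv

theorem val_C_ofWitt_nonneg (a : WittVector p k) :
    0 ≤ w (((C : L →+* L[X]).comp (ofWitt p k L)) a) := by
  rw [RingHom.comp_apply, hw.val_C]
  exact val_ofWitt_nonneg hv a

theorem val_map_ofWitt_nonneg (V : (WittVector p k)[X]) : 0 ≤ w (V.map (ofWitt p k L)) := by
  rw [← V.comp_X, map_ofWitt_comp, map_X]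
  exact map_eval₂_nonneg w (val_C_ofWitt_nonneg hv hw) (hw.val_X ▸ zero_le_one) V

theorem le_val_X_pow_mul_map_ofWitt (r : ℕ) (V : (WittVector p k)[X]) :
    ((r : ℤ) : WithTop ℤ) ≤ w (X ^ r * V.map (ofWitt p k L)) := by
  rw [w.map_mul, map_uniformizer_pow w hw.val_X]
  exact le_add_of_nonneg_right (val_map_ofWitt_nonneg hv hw V)

theorem LiftsTo.le_val_lift {r : ℕ} {z : L} {Z : L[X]} (hκ : 0 ≤ κ)
    (h : LiftsTo p k π w κ r z Z) : ((r : ℤ) : WithTop ℤ) ≤ w Z := by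
  obtain ⟨V, -, hV⟩ := h
  rw [← sub_add_cancel Z (X ^ r * V.map (ofWitt p k L))]
  exact w.map_le_add (coe_le_of_coe_le hV (by omega)) (le_val_X_pow_mul_map_ofWitt hv hw r V)

theorem LiftsTo.mul (hκ : 0 ≤ κ) {r₁ r₂ : ℕ} {z₁ z₂ : L} {Z₁ Z₂ : L[X]}
    (h₁ : LiftsTo p k π w κ r₁ z₁ Z₁) (h₂ : LiftsTo p k π w κ r₂ z₂ Z₂) :
    LiftsTo p k π w κ (r₁ + r₂) (z₁ * z₂) (Z₁ * Z₂) := by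
  have hZ₂ := h₂.le_val_lift hv hw hκ
  obtain ⟨V₁, rfl, hV₁⟩ := h₁
  obtain ⟨V₂, rfl, hV₂⟩ := h₂
  refine ⟨V₁ * V₂, by rw [eval₂_mul]; ring, ?_⟩
  have hsplit : Z₁ * Z₂ - X ^ (r₁ + r₂) * (V₁ * V₂).map (ofWitt p k L) =
      (Z₁ - X ^ r₁ * V₁.map (ofWitt p k L)) * Z₂ +
        X ^ r₁ * V₁.map (ofWitt p k L) * (Z₂ - X ^ r₂ * V₂.map (ofWitt p k L)) := by
    rw [Polynomial.map_mul]; ring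
  rw [hsplit]
  refine w.map_le_add (coe_le_of_coe_le (coe_add_le_map_mul w hV₁ hZ₂) ?_)
    (coe_le_of_coe_le
      (coe_add_le_map_mul w (le_val_X_pow_mul_map_ofWitt hv hw r₁ V₁) hV₂) ?_) <;>
  · push_cast
    omega

theorem LiftsTo.pow (hκ : 0 ≤ κ) {r : ℕ} {z : L} {Z : L[X]} (h : LiftsTo p k π w κ r z Z)
    (n : ℕ) : LiftsTo p k π w κ (n * r) (z ^ n) (Z ^ n) := by
  induction n with
  | zero => simpa only [zero_mul, pow_zero] using LiftsTo.one π w κ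
  | succ n ih =>
    rw [Nat.succ_mul, pow_succ, pow_succ]
    exact ih.mul hv hw hκ h

variable [IsAlgClosed k] [FiniteDimensional (K₀ p k) L] (hπ : v π = 1)

include hπ

omit hw in
theorem exists_liftsTo (w : AddValuation L[X] (WithTop ℤ)) (κ : ℤ) {z : L} {r : ℕ}
    (hz : ((r : ℤ) : WithTop ℤ) ≤ v z) :
    ∃ V : (WittVector p k)[X], LiftsTo p k π w κ r z (V.map (ofWitt p k L)) := by
  obtain ⟨V, rfl⟩ := exists_eq_uniformizer_pow_mul_eval₂ hv hπ hz
  refine ⟨X ^ r * V, ?_⟩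
  rw [Polynomial.map_mul, Polynomial.map_pow, map_X]
  exact LiftsTo.pow_mul_eval₂ π w κ r V

variable {e : ℕ} (he : v (p : L) = ((e : ℤ) : WithTop ℤ)) (hκ : κ + e ≤ D)

include he hκ

theorem liftsTo_prime : LiftsTo p k π w κ e (p : L) (p : L[X]) := by
  obtain ⟨U, hU⟩ := exists_eq_uniformizer_pow_mul_eval₂ hv hπ he.ge
  refine ⟨U, hU, ?_⟩
  have hroot : ((p : (WittVector p k)[X]) - X ^ e * U).eval₂ (ofWitt p k L) π = 0 := by
    rw [eval₂_sub, eval₂_mul, eval₂_natCast, eval₂_pow, eval₂_X, ← hU, sub_self]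
  have hval := hw.val_of_root _ hroot
  rw [Polynomial.map_sub, Polynomial.map_natCast, Polynomial.map_mul, Polynomial.map_pow,
    map_X] at hval
  exact coe_le_of_coe_le hval (by omega)

theorem exists_val_natCast_liftsTo (hκ0 : 0 ≤ κ) {n : ℕ} (hn : n ≠ 0) :
    ∃ s : ℕ, v (n : L) = ((s : ℤ) : WithTop ℤ) ∧ LiftsTo p k π w κ s (n : L) (n : L[X]) := by
  obtain ⟨a, m, hm, rfl⟩ := Nat.exists_eq_pow_mul_and_not_dvd hn p hp.out.ne_one
  refine ⟨a * e, ?_, ?_⟩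
  · have hunit : IsUnit (m : WittVector p k) := by
      refine WittVector.isUnit_of_coeff_zero_ne_zero _ ?_
      change WittVector.constantCoeff (m : WittVector p k) ≠ 0
      rw [map_natCast]
      exact (CharP.cast_eq_zero_iff k p m).not.2 hm
    have hval := val_ofWitt_of_isUnit hv hunit
    rw [map_natCast] at hval
    rw [Nat.cast_mul, Nat.cast_pow, v.map_mul, hval, add_zero, map_pow_eq_coe v he, Nat.cast_mul]
  · rw [Nat.cast_mul, Nat.cast_pow, Nat.cast_mul, Nat.cast_pow]
    exact ((liftsTo_prime hv hw hπ he hκ).pow hv hw hκ0 a).mul hv hw hκ0 (.natCast π w κ m)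

theorem LiftsTo.one_add_pow_sub_one (hκ0 : 0 ≤ κ) {r R q : ℕ} {y : L} {Y : L[X]}
    (h : LiftsTo p k π w κ r y Y) (hR : ∀ j ≥ 1,
      ((R : ℤ) : WithTop ℤ) ≤ v ((q.choose j : ℕ) : L) + ((j * r : ℤ) : WithTop ℤ)) :
    LiftsTo p k π w κ R ((1 + y) ^ q - 1) ((1 + Y) ^ q - 1) := by
  have hbinom {A : Type _} [CommRing A] (y : A) : (1 + y) ^ q - 1 =
      ∑ j ∈ Finset.range q, ((q.choose (j + 1) : ℕ) : A) * y ^ (j + 1) := by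
    rw [add_comm, add_pow, Finset.sum_range_succ']
    simp [mul_comm]
  rw [hbinom, hbinom]
  refine LiftsTo.sum _ fun j hj => ?_
  obtain ⟨s, hs, hlift⟩ := exists_val_natCast_liftsTo hv hw hπ he hκ hκ0
    (Nat.choose_pos (Finset.mem_range.1 hj : j + 1 ≤ q)).ne'
  refine (hlift.mul hv hw hκ0 (h.pow hv hw hκ0 (j + 1))).mono ?_
  have hle := hR (j + 1) (Nat.le_add_left 1 j)
  rw [hs] at hle
  norm_cast at hle

end GenericPoint

/-! ### Elements fixed by inertia -/

section Inertia

variable {p : ℕ} [hp : Fact p.Prime] {k : Type*} [Field k] [CharP k p]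
  {L : Type*} [Field L] [Algebra (K₀ p k) L]
  {v : AddValuation L (WithTop ℤ)} {π : L} {D : ℤ} {H : Set (L ≃ₐ[K₀ p k] L)}
  {w : AddValuation L[X] (WithTop ℤ)} (hw : IsGenericPoint p k v π D H w)

include hw

theorem le_val_algEquiv_sub_of_close {h : L ≃ₐ[K₀ p k] L} (hh : h ∈ H) {V : (WittVector p k)[X]}
    {a : L} {b : ℤ} (hb : (b : WithTop ℤ) ≤ w (V.map (ofWitt p k L) - C a)) :
    (b : WithTop ℤ) ≤ v (h a - a) := by
  have hbh := hb.trans (hw.le_val_map h hh _)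
  rw [Polynomial.map_sub, map_algEquiv_map_ofWitt, Polynomial.map_C] at hbh
  have hdiff := w.map_le_sub hb hbh
  rw [sub_sub_sub_cancel_left, ← C_sub, hw.val_C] at hdiff
  exact hdiff

variable {e : ℕ} (he : v (p : L) = ((e : ℤ) : WithTop ℤ))

include he

theorem exists_close_root_pow {c : ℕ} {ξ : L} (hξ : IsPrimitiveRoot ξ (p ^ c)) {x a : L}
    (hx : x ^ p ^ c = a) {s b : ℤ} (hs : v a = s) {V : (WittVector p k)[X]}
    (hV : ((s + c * e + b : ℤ) : WithTop ℤ) ≤ w (V.map (ofWitt p k L) ^ p ^ c - C a)) :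
    ∃ y : L, y ^ p ^ c = a ∧ ∃ r : ℤ, v y = r ∧
      ((r + b : ℤ) : WithTop ℤ) ≤ w (V.map (ofWitt p k L) - C y) := by
  classical
  have hpos : 0 < p ^ c := pow_pos hp.out.pos _
  have ha0 : a ≠ 0 := ne_zero_of_map_eq_coe v hs
  rw [← algebraMap_eq, ← prod_nthRootsFinset_sub hpos hξ hx ha0] at hV
  obtain ⟨y, hymem, hclose⟩ := exists_close_root v w hw.val_C (nthRootsFinset (p ^ c) a)
    ⟨x, (mem_nthRootsFinset hpos a).2 hx⟩ _ hV
  have hy := (mem_nthRootsFinset hpos a).1 hymem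
  obtain ⟨r, hr⟩ := exists_map_eq_coe v (x := y) (by
    rintro rfl
    exact ha0 (by rw [← hy, zero_pow hpos.ne']))
  have hsr : s = (p ^ c : ℕ) * r := by
    rw [← WithTop.coe_eq_coe, ← hs, ← hy, map_pow_eq_coe v hr]
  have hder : v (∏ s ∈ (nthRootsFinset (p ^ c) a).erase y, (y - s)) =
      ((c * e + (p ^ c - 1 : ℕ) * r : ℤ) : WithTop ℤ) := by
    have hprod := prod_nthRootsFinset_sub (R := L[X]) hpos hξ hx ha0 X
    rw [algebraMap_eq] at hprod
    rw [prod_erase_eq_derivative _ hymem, hprod, derivative_sub, derivative_X_pow,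
      derivative_C, sub_zero, eval_mul, eval_C, eval_pow, eval_X, Nat.cast_pow]
    exact map_mul_eq_coe v (map_pow_eq_coe v he c) (map_pow_eq_coe v hr _)
  rw [hder, coe_le_add_coe_iff] at hclose
  refine ⟨y, hy, r, hr, coe_le_of_coe_le hclose ?_⟩
  rw [hsr, Nat.cast_sub hpos]
  push_cast
  linarith

variable {ε : ℤ} (hε : (p - 1 : ℤ) * ε = e)

include hε

theorem algEquiv_eq_of_close {h : L ≃ₐ[K₀ p k] L} (hh : h ∈ H) {c : ℕ} {y : L}
    (hy : h (y ^ p ^ c) = y ^ p ^ c) {r : ℤ} (hr : v y = r) {V : (WittVector p k)[X]}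
    (hV : ((r + ε + 1 : ℤ) : WithTop ℤ) ≤ w (V.map (ofWitt p k L) - C y)) : h y = y := by
  have hy0 : y ≠ 0 := ne_zero_of_map_eq_coe v hr
  refine (div_eq_one_iff_eq hy0).1 (eq_one_of_lt_map_sub_one v (c := c) ?_ he hε ?_)
  · rw [div_pow, ← map_pow, hy, div_self (pow_ne_zero _ hy0)]
  · have hclose := le_val_algEquiv_sub_of_close hw hh hV
    have hquot : h y / y - 1 = (h y - y) / y := by rw [sub_div, div_self hy0]
    rw [hquot, coe_lt_iff_add_one_le]
    exact coe_le_map_div v (by convert hclose using 2; ring) hr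

theorem exists_close_primitiveRoot {n : ℕ} {ζ : L} (hζ : IsPrimitiveRoot ζ (p ^ (n + 1)))
    {F : (WittVector p k)[X]} (hF : F.eval₂ (ofWitt p k L) π = ζ) :
    ∃ ζ' : L, IsPrimitiveRoot ζ' (p ^ (n + 1)) ∧
      ((D - (n + 1) * e + ε : ℤ) : WithTop ℤ) ≤ w (F.map (ofWitt p k L) - C ζ') := by
  classical
  have hpos : 0 < p ^ (n + 1) := pow_pos hp.out.pos _
  have hcyc := cyclotomic_eq_prod_X_sub_primitiveRoots hζ
  have hroot : ((cyclotomic (p ^ (n + 1)) (WittVector p k)).comp F).eval₂ (ofWitt p k L) π = 0 := by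
    rw [eval₂_comp, hF, ← eval_map, map_cyclotomic]
    exact hζ.isRoot_cyclotomic hpos
  have hprod : ((cyclotomic (p ^ (n + 1)) (WittVector p k)).comp F).map (ofWitt p k L) =
      ∏ μ ∈ primitiveRoots (p ^ (n + 1)) L, (F.map (ofWitt p k L) - algebraMap L L[X] μ) := by
    rw [Polynomial.map_comp, map_cyclotomic, hcyc, prod_comp]
    simp only [sub_comp, X_comp, C_comp, algebraMap_eq]
  have hval := hw.val_of_root _ hroot
  rw [hprod] at hval
  obtain ⟨ζ', hζ', hclose⟩ := exists_close_root v w hw.val_C (primitiveRoots (p ^ (n + 1)) L)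
    ⟨ζ, (mem_primitiveRoots hpos).2 hζ⟩ _ hval
  have hprim := (mem_primitiveRoots hpos).1 hζ'
  rw [prod_erase_eq_derivative _ hζ', ← hcyc, map_derivative_cyclotomic v hprim he hε,
    coe_le_add_coe_iff, ← sub_add] at hclose
  exact ⟨ζ', hprim, hclose⟩

theorem algEquiv_primitiveRoot_eq [IsAlgClosed k] [FiniteDimensional (K₀ p k) L]
    (hv : IsNormalizedVal p k v) (hπ : v π = 1) {n : ℕ} {ζ : L}
    (hζ : IsPrimitiveRoot ζ (p ^ (n + 1))) (hD : (n + 1) * e < D) {h : L ≃ₐ[K₀ p k] L}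
    (hh : h ∈ H) {j : ℕ} (hj : j ≤ n + 1) {η : L} (hη : η ^ p ^ j = 1) : h η = η := by
  have hpos : 0 < p ^ (n + 1) := pow_pos hp.out.pos _
  have : NeZero (p ^ (n + 1)) := ⟨hpos.ne'⟩
  obtain ⟨F, -, hF⟩ := exists_poly_of_nonneg hv hπ he
    (map_eq_zero_of_pow_eq_one v hpos.ne' hζ.pow_eq_one).ge
  obtain ⟨ζ', hζ', hclose⟩ := exists_close_primitiveRoot hw he hε hζ hF.symm
  have hfix : h ζ' = ζ' := by
    refine algEquiv_eq_of_close hw he hε hh (c := n + 1) (r := 0) ?_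
      (map_eq_zero_of_pow_eq_one v hpos.ne' hζ'.pow_eq_one)
      (coe_le_of_coe_le hclose (by linarith))
    rw [hζ'.pow_eq_one, map_one]
  have hη' : η ^ p ^ (n + 1) = 1 := by
    rw [← Nat.add_sub_cancel' hj, pow_add, pow_mul, hη, one_pow]
  obtain ⟨i, -, rfl⟩ := hζ'.eq_pow_of_pow_eq_one hη'
  rw [map_pow, hfix]

theorem algEquiv_root_eq {c : ℕ} {ξ : L} (hξ : IsPrimitiveRoot ξ (p ^ c)) {x a : L}
    (hx : x ^ p ^ c = a) {s : ℤ} (hs : v a = s) {V : (WittVector p k)[X]}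
    (hV : ((s + c * e + ε + 1 : ℤ) : WithTop ℤ) ≤ w (V.map (ofWitt p k L) ^ p ^ c - C a))
    {h : L ≃ₐ[K₀ p k] L} (hh : h ∈ H) (ha : h a = a) (hη : ∀ η : L, η ^ p ^ c = 1 → h η = η) :
    h x = x := by
  obtain ⟨y, rfl, r, hr, hclose⟩ := exists_close_root_pow hw he hξ hx hs (b := ε + 1)
    (by rwa [← add_assoc])
  have hy : h y = y := algEquiv_eq_of_close hw he hε hh ha hr (by rwa [add_assoc])
  have hy0 : y ≠ 0 := ne_zero_of_map_eq_coe v hr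
  have hquot : h (x / y) = x / y :=
    hη _ (by rw [div_pow, hx, div_self (pow_ne_zero _ hy0)])
  rw [map_div₀, hy] at hquot
  exact (div_left_inj' hy0).1 hquot

end Inertia

/-! ### Approximating roots by constants over `K₀(X)` -/

theorem le_map_add_pow_sub_pow {R : Type*} [CommRing R] (w : AddValuation R (WithTop ℤ)) {p : ℕ}
    (hp : p.Prime) {e σ μ b : ℤ} (he : (e : WithTop ℤ) ≤ w (p : R)) {x y : R}
    (hx : (σ : WithTop ℤ) ≤ w x) (hy : ((σ + μ : ℤ) : WithTop ℤ) ≤ w y) (hμ : 0 ≤ μ)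
    (hb : b ≤ e + μ) (hb' : b ≤ p * μ) :
    ((p * σ + b : ℤ) : WithTop ℤ) ≤ w ((x + y) ^ p - x ^ p) := by
  rw [add_pow, Finset.sum_range_succ, Nat.choose_self, Nat.sub_self, pow_zero, mul_one,
    Nat.cast_one, mul_one, add_sub_cancel_right]
  refine w.map_le_sum fun j hj => ?_
  have hjp : j < p := Finset.mem_range.1 hj
  have hpow := coe_add_le_map_mul w (coe_mul_le_map_pow w hx j) (coe_mul_le_map_pow w hy (p - j))
  rw [Nat.cast_sub hjp.le] at hpow
  rcases Nat.eq_zero_or_pos j with rfl | hj0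
  · rw [Nat.choose_zero_right, Nat.cast_one, mul_one]
    refine coe_le_of_coe_le hpow ?_
    rw [Nat.cast_zero]
    linarith
  · obtain ⟨m, hm⟩ := hp.dvd_choose_self hj0.ne' hjp
    have hchoose : (e : WithTop ℤ) ≤ w ((p.choose j : ℕ) : R) := by
      rw [hm, Nat.cast_mul, w.map_mul]
      exact le_add_of_le_of_nonneg he (map_natCast_nonneg w m)
    refine coe_le_of_coe_le (coe_add_le_map_mul w hpow hchoose) ?_
    have hμj : μ ≤ (p - j) * μ := le_mul_of_one_le_left hμ (by omega)
    linarith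

theorem le_map_pow_sub_mul_pow {R : Type*} [CommRing R] (w : AddValuation R (WithTop ℤ)) {p : ℕ}
    (hp : p.Prime) {e s M : ℤ} (he : (e : WithTop ℤ) ≤ w (p : R)) (hM : 0 ≤ M)
    (heM : e + M ≤ p * M) {A B Y Z : R} (hB : (s : WithTop ℤ) ≤ w B) (hZ : 0 ≤ w Z)
    (hY : ((s + M : ℤ) : WithTop ℤ) ≤ w (Y - B * Z))
    (hA : ((e + M : ℤ) : WithTop ℤ) ≤ w (Z ^ p - A)) :
    ((p * s + (e + M) : ℤ) : WithTop ℤ) ≤ w (Y ^ p - A * B ^ p) := by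
  have hBZ : (s : WithTop ℤ) ≤ w (B * Z) := by
    rw [w.map_mul]
    exact le_add_of_le_of_nonneg hB hZ
  have hYp := le_map_add_pow_sub_pow w hp he hBZ hY hM le_rfl heM
  have hBA := coe_add_le_map_mul w (coe_mul_le_map_pow w hB p) hA
  rw [add_sub_cancel] at hYp
  have hsplit : Y ^ p - A * B ^ p = Y ^ p - (B * Z) ^ p + B ^ p * (Z ^ p - A) := by ring
  rw [hsplit]
  exact w.map_le_add hYp hBA

theorem exists_nat_le_of_lt_add {T κ : ℤ} {V : WithTop ℤ} (hV : 0 ≤ V)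
    (h : (T : WithTop ℤ) < κ + V) : ∃ n : ℕ, ((n : ℤ) : WithTop ℤ) ≤ V ∧ T < κ + n := by
  induction V with
  | top => exact ⟨(T + 1 - κ).toNat, le_top, by omega⟩
  | coe a =>
    norm_cast at hV h
    exact ⟨a.toNat, WithTop.coe_le_coe.2 (Int.toNat_of_nonneg hV).le, by omega⟩

theorem map_eq_zero_of_one_le_map_sub_one {R : Type*} [Ring R] (v : AddValuation R (WithTop ℤ))
    {x : R} (hx : 1 ≤ v (x - 1)) : v x = 0 := by
  have h := v.map_add_eq_of_lt_left (v.map_one.trans_lt (zero_lt_one.trans_le hx))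
  rwa [add_sub_cancel, v.map_one] at h

section Approx

variable {p : ℕ} [hp : Fact p.Prime] {k : Type*} [Field k] [CharP k p]
  {L : Type*} [Field L] [Algebra (K₀ p k) L]

/-- The element `b` of `L` is approximated by the constant `b'`: some lift of `b` to `L[X]` with
leading exponent `r` agrees with `b'` up to relative precision `κ`. -/
def ApproxBy (p : ℕ) [Fact p.Prime] (k : Type*) [Field k] [CharP k p]
    {L : Type*} [Field L] [Algebra (K₀ p k) L] (π : L) (w : AddValuation L[X] (WithTop ℤ)) (κ : ℤ)
    (r : ℕ) (b b' : L) : Prop :=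
  ∃ B : L[X], LiftsTo p k π w κ r b B ∧ ((r + κ : ℤ) : WithTop ℤ) ≤ w (B - C b')

section Basic

variable {π : L} {w : AddValuation L[X] (WithTop ℤ)} {κ : ℤ}

theorem ApproxBy.zero (r : ℕ) : ApproxBy p k π w κ r 0 0 :=
  ⟨0, LiftsTo.zero π w κ r, by rw [C_0, sub_zero, w.map_zero]; exact le_top⟩

theorem ApproxBy.mono {r r' : ℕ} (hr : r ≤ r') {b b' : L} (h : ApproxBy p k π w κ r' b b') :
    ApproxBy p k π w κ r b b' := by
  obtain ⟨B, hB, hBb'⟩ := h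
  exact ⟨B, hB.mono hr, coe_le_of_coe_le hBb' (by omega)⟩

end Basic

variable {v : AddValuation L (WithTop ℤ)} (hv : IsNormalizedVal p k v) {π : L}
  {D : ℤ} {H : Set (L ≃ₐ[K₀ p k] L)} {w : AddValuation L[X] (WithTop ℤ)}
  (hw : IsGenericPoint p k v π D H w) {κ : ℤ}

include hv hw

theorem ApproxBy.pow_mul_eval₂ (hκ0 : 0 ≤ κ) {N : ℕ} {z z' : L}
    (h : ApproxBy p k π w κ N z z') (n : ℕ) (U : (WittVector p k)[X]) :
    ApproxBy p k π w κ (n * N) (z ^ n * U.eval₂ (ofWitt p k L) z)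
      (z' ^ n * U.eval₂ (ofWitt p k L) z') := by
  obtain ⟨B, ⟨V, rfl, hBV⟩, hBz'⟩ := h
  set F : (WittVector p k)[X] := X ^ N * V
  have hFX : F.map (ofWitt p k L) = X ^ N * V.map (ofWitt p k L) := by
    rw [Polynomial.map_mul, Polynomial.map_pow, map_X]
  have hFπ : F.eval₂ (ofWitt p k L) π = π ^ N * V.eval₂ (ofWitt p k L) π := by
    rw [eval₂_mul, eval₂_pow, eval₂_X]
  have hwF : ((N : ℤ) : WithTop ℤ) ≤ w (F.map (ofWitt p k L)) :=
    hFX ▸ le_val_X_pow_mul_map_ofWitt hv hw N V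
  have hclose : ((N + κ : ℤ) : WithTop ℤ) ≤ w (F.map (ofWitt p k L) - C z') := by
    rw [hFX, ← sub_sub_sub_cancel_left _ _ B]
    exact w.map_le_sub hBz' hBV
  have hwz' : ((N : ℤ) : WithTop ℤ) ≤ w (C z') := by
    rw [← sub_sub_cancel (F.map (ofWitt p k L)) (C z')]
    exact w.map_le_sub hwF (coe_le_of_coe_le hclose (by omega))
  have hN0 : (0 : WithTop ℤ) ≤ ((N : ℤ) : WithTop ℤ) := WithTop.coe_le_coe.2 N.cast_nonneg
  refine ⟨X ^ (n * N) * (V ^ n * U.comp F).map (ofWitt p k L), ?_, ?_⟩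
  · have hz : (π ^ N * V.eval₂ (ofWitt p k L) π) ^ n *
        U.eval₂ (ofWitt p k L) (π ^ N * V.eval₂ (ofWitt p k L) π) =
        π ^ (n * N) * (V ^ n * U.comp F).eval₂ (ofWitt p k L) π := by
      rw [eval₂_mul, eval₂_pow, eval₂_comp, hFπ, mul_comm n N, pow_mul, mul_pow, mul_assoc]
    rw [hz]
    exact LiftsTo.pow_mul_eval₂ π w κ (n * N) (V ^ n * U.comp F)
  · have hpoly : X ^ (n * N) * (V ^ n * U.comp F).map (ofWitt p k L) = F.map (ofWitt p k L) ^ n *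
        U.eval₂ ((C : L →+* L[X]).comp (ofWitt p k L)) (F.map (ofWitt p k L)) := by
      rw [← map_ofWitt_comp, hFX, mul_pow, ← pow_mul, mul_comm n N, Polynomial.map_mul,
        Polynomial.map_pow, mul_assoc]
    have hcoeff := val_C_ofWitt_nonneg hv hw
    have hsub (a b c d : L[X]) : a * b - c * d = (a - c) * b + c * (b - d) := by ring
    rw [hpoly, C_mul, C_pow, hom_eval₂, hsub]
    refine w.map_le_add ?_ ?_
    · rw [w.map_mul, Nat.cast_mul, WithTop.coe_add, ← coe_nsmul]
      exact le_add_of_le_of_nonneg (nsmul_add_le_map_pow_sub_pow w hwF hwz' hclose n)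
        (map_eval₂_nonneg w hcoeff (hN0.trans hwF) U)
    · refine coe_le_of_coe_le (coe_add_le_map_mul w (coe_mul_le_map_pow w hwz' n)
        (le_map_eval₂_sub w hcoeff (hN0.trans hwF) (hN0.trans hwz') hclose U)) ?_
      rw [Nat.cast_mul]
      linarith [Int.natCast_nonneg N]

theorem ApproxBy.le_val (hκ0 : 0 ≤ κ) {r : ℕ} {b b' : L} (h : ApproxBy p k π w κ r b b') :
    ((r : ℤ) : WithTop ℤ) ≤ v b' := by
  obtain ⟨B, hB, hBb'⟩ := h
  rw [← hw.val_C, ← sub_sub_cancel B (C b')]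
  exact w.map_le_sub (hB.le_val_lift hv hw hκ0) (coe_le_of_coe_le hBb' (by omega))

variable (hπ : v π = 1) [IsAlgClosed k] [FiniteDimensional (K₀ p k) L]

include hπ

theorem exists_approx_root (hκ0 : 0 ≤ κ) (hκ : κ ≤ D) {q : ℕ} (hq : 0 < q) {x z : L}
    (hx : x ^ q = z) {s : ℕ} (hs : v z = ((s : ℤ) : WithTop ℤ)) {Z : L[X]}
    (hZ : LiftsTo p k π w κ s z Z) :
    ∃ V : (WittVector p k)[X],
      ((s + κ : ℤ) : WithTop ℤ) ≤ w (V.map (ofWitt p k L) ^ q - Z) := by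
  have hπ0 : π ≠ 0 := ne_zero_of_map_eq_coe v (a := 1) hπ
  obtain ⟨r, hr⟩ := exists_map_eq_coe v (x := x) (by
    rintro rfl
    exact ne_zero_of_map_eq_coe v hs (by rw [← hx, zero_pow hq.ne']))
  have hqr : (q * r : ℤ) = s := by
    rw [← WithTop.coe_eq_coe, ← hs, ← hx, map_pow_eq_coe v hr]
  lift r to ℕ using nonneg_of_mul_nonneg_right (hqr ▸ s.cast_nonneg) (by exact_mod_cast hq)
  obtain ⟨V, hV⟩ := exists_liftsTo hv hπ w κ hr.ge
  have hVq := hV.pow hv hw hκ0 q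
  rw [hx, (by exact_mod_cast hqr : q * r = s)] at hVq
  exact ⟨V, hVq.le_val_sub hw hκ hπ0 hZ⟩

theorem exists_approx_root_mul (hκ0 : 0 ≤ κ) (hκ : κ ≤ D) {q : ℕ} (hq : 0 < q) {x b b' z : L}
    (hx : x ^ q = b * z) (hz : v z = 0) {s : ℕ} (hs : v b = ((s : ℤ) : WithTop ℤ))
    (hb : ApproxBy p k π w κ s b b') {Z : L[X]} (hZ : LiftsTo p k π w κ 0 z Z) :
    ∃ V : (WittVector p k)[X],
      ((s + κ : ℤ) : WithTop ℤ) ≤ w (V.map (ofWitt p k L) ^ q - C b' * Z) := by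
  obtain ⟨B, hB, hBb'⟩ := hb
  obtain ⟨V, hV⟩ := exists_approx_root hv hw hπ hκ0 hκ hq hx
    (by rw [v.map_mul, hz, hs, add_zero, add_zero]) (hB.mul hv hw hκ0 hZ)
  have hBZ := coe_add_le_map_mul w hBb' (hZ.le_val_lift hv hw hκ0)
  rw [Nat.cast_zero, add_zero, sub_mul] at hBZ
  refine ⟨V, ?_⟩
  rw [← sub_add_sub_cancel _ (B * Z)]
  exact w.map_le_add hV hBZ

variable {e : ℕ} (he : v (p : L) = ((e : ℤ) : WithTop ℤ)) (hκ0 : 0 ≤ κ) (hκ : κ + e ≤ D)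

include he hκ0 hκ

theorem exists_approx_root_one_add {q : ℕ} (hq : 0 < q) {ξ : L} (hξ : IsPrimitiveRoot ξ q)
    {x t : L} (hx : x ^ q = 1 + t) (hx0 : x ≠ 0) {R : ℕ} {T : L[X]}
    (hT : LiftsTo p k π w κ R t T) :
    ∃ z : L, z ^ q = 1 + t ∧ ∃ (r : ℕ) (V : (WittVector p k)[X]),
      LiftsTo p k π w κ r (z - 1) (V.map (ofWitt p k L)) ∧
      ((R : ℤ) : WithTop ℤ) ≤ v (q : L) + ((r : ℤ) : WithTop ℤ) ∧
      ((R + κ : ℤ) : WithTop ℤ) ≤ w ((1 + V.map (ofWitt p k L)) ^ q - (1 + T)) := by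
  have hπ0 : π ≠ 0 := ne_zero_of_map_eq_coe v (a := 1) hπ
  obtain ⟨z, hz, r, hr, hbinom⟩ := exists_root_close_to_one v hq hξ hx hx0 (hT.le_val hv hπ)
  obtain ⟨V, hV⟩ := exists_liftsTo hv hπ w κ hr
  have hpow := hV.one_add_pow_sub_one hv hw hπ he hκ hκ0 hbinom
  rw [add_sub_cancel, hz, add_sub_cancel_left] at hpow
  refine ⟨z, hz, r, V, hV, ?_, ?_⟩
  · simpa only [Nat.choose_one_right, Nat.cast_one, one_mul] using hbinom 1 le_rfl
  · rw [← sub_sub]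
    exact hpow.le_val_sub hw (by omega) hπ0 hT

theorem exists_approx_root_of_approxBy {q : ℕ} (hq : 0 < q) {ξ : L} (hξ : IsPrimitiveRoot ξ q)
    {x a a' : L} (hx : x ^ q = a) (ha0 : a ≠ 0) {R : ℕ}
    (ha : ApproxBy p k π w κ R (a - 1) (a' - 1)) :
    ∃ z : L, z ^ q = a ∧ ∃ (r : ℕ) (V : (WittVector p k)[X]),
      LiftsTo p k π w κ r (z - 1) (V.map (ofWitt p k L)) ∧
      ((R : ℤ) : WithTop ℤ) ≤ v (q : L) + ((r : ℤ) : WithTop ℤ) ∧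
      ((R + κ : ℤ) : WithTop ℤ) ≤ w ((1 + V.map (ofWitt p k L)) ^ q - C a') := by
  obtain ⟨A, hA, hAa'⟩ := ha
  have hx0 : x ≠ 0 := by
    rintro rfl
    exact ha0 (by rw [← hx, zero_pow hq.ne'])
  obtain ⟨z, hz, r, V, hV, hr, hVA⟩ := exists_approx_root_one_add hv hw hπ he hκ0 hκ hq hξ
    (by rwa [add_sub_cancel]) hx0 hA
  refine ⟨z, by rwa [add_sub_cancel] at hz, r, V, hV, hr, ?_⟩
  have hsplit : (1 + V.map (ofWitt p k L)) ^ q - C a' =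
      (1 + V.map (ofWitt p k L)) ^ q - (1 + A) + (A - C (a' - 1)) := by
    rw [C_sub, C_1]
    ring
  rw [hsplit]
  exact w.map_le_add hVA hAa'

theorem exists_approx_root_mul_of_close {q : ℕ} (hq : 0 < q) {ξ : L} (hξ : IsPrimitiveRoot ξ q)
    {x b b' z : L} (hx : x ^ q = b * z) (hbz : b * z ≠ 0) {R : ℕ}
    (hb : ApproxBy p k π w κ R (b - 1) (b' - 1)) {Z : L[X]}
    (hZ : LiftsTo p k π w κ R (z - 1) Z) :
    ∃ V : (WittVector p k)[X],
      ((R + κ : ℤ) : WithTop ℤ) ≤ w (V.map (ofWitt p k L) ^ q - C b' * (1 + Z)) := by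
  obtain ⟨B, hB, hBb'⟩ := hb
  have hlift := (hB.add hZ).add ((hB.mul hv hw hκ0 hZ).mono (Nat.le_add_left R R))
  have hx' : x ^ q = 1 + (b - 1 + (z - 1) + (b - 1) * (z - 1)) := by rw [hx]; ring
  have hx0 : x ≠ 0 := by
    rintro rfl
    exact hbz (by rw [← hx, zero_pow hq.ne'])
  obtain ⟨-, -, -, V, -, -, hV⟩ :=
    exists_approx_root_one_add hv hw hπ he hκ0 hκ hq hξ hx' hx0 hlift
  have hZ1 : ((0 : ℤ) : WithTop ℤ) ≤ w (1 + Z) :=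
    ((LiftsTo.one π w κ).add (hZ.mono R.zero_le)).le_val_lift hv hw hκ0
  have hBZ := coe_add_le_map_mul w hBb' hZ1
  refine ⟨1 + V, ?_⟩
  have hsplit : (1 + V).map (ofWitt p k L) ^ q - C b' * (1 + Z) =
      (1 + V.map (ofWitt p k L)) ^ q - (1 + (B + Z + B * Z)) + (B - C (b' - 1)) * (1 + Z) := by
    rw [Polynomial.map_add, Polynomial.map_one, C_sub, C_1]
    ring
  rw [hsplit]
  exact w.map_le_add hV (by rwa [add_zero] at hBZ)

variable {M : Type*} [Field M] {f f' : M →+* L}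
  (hf : ∀ (z : M) (r : ℕ), ((r : ℤ) : WithTop ℤ) ≤ v (f z) → ApproxBy p k π w κ r (f z) (f' z))
  {c : ℕ} {ε : ℤ}

include hf

theorem exists_approx_root_map_mul {ξ : L} (hξ : IsPrimitiveRoot ξ (p ^ c)) {x z : L} {b : M}
    (hx : x ^ p ^ c = f b * z) (hz : v z = 0) {s : ℕ} (hs : v (f b) = ((s : ℤ) : WithTop ℤ))
    {r : ℕ} {Z : L[X]} (hZ : LiftsTo p k π w κ r (z - 1) Z) {T : ℤ} (hr : T < κ + r)
    (hb : (T : WithTop ℤ) < κ + v (f (b - 1))) :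
    ∃ V : (WittVector p k)[X],
      ((s + (T + 1) : ℤ) : WithTop ℤ) ≤
        w (V.map (ofWitt p k L) ^ p ^ c - C (f' b) * (1 + Z)) := by
  have hpos : 0 < p ^ c := pow_pos hp.out.pos c
  rcases lt_or_ge (v (f (b - 1))) 1 with hlt | hge
  · have hZ₀ : LiftsTo p k π w κ 0 z (1 + Z) := by
      simpa only [add_sub_cancel] using (LiftsTo.one π w κ).add (hZ.mono r.zero_le)
    obtain ⟨V, hV⟩ := exists_approx_root_mul hv hw hπ hκ0 (by omega) hpos hx hz hs
      (hf b s hs.ge) hZ₀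
    have hTκ : T + 1 ≤ κ := by
      obtain ⟨m, hm⟩ := WithTop.ne_top_iff_exists.1 hlt.ne_top
      rw [← hm] at hlt hb
      norm_cast at hlt hb
      omega
    exact ⟨V, coe_le_of_coe_le hV (by omega)⟩
  · obtain ⟨r₂, hr₂, hTr₂⟩ := exists_nat_le_of_lt_add (zero_le_one.trans hge) hb
    have happrox := hf (b - 1) r₂ hr₂
    rw [map_sub, map_one, map_sub, map_one] at happrox
    rw [map_sub, map_one] at hge
    have hs0 : (s : ℤ) = 0 := by
      rw [← WithTop.coe_eq_coe, ← hs, map_eq_zero_of_one_le_map_sub_one v hge, WithTop.coe_zero]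
    have hbz : f b * z ≠ 0 := mul_ne_zero (ne_zero_of_map_eq_coe v hs)
      (ne_zero_of_map_eq_coe v (a := 0) hz)
    obtain ⟨V, hV⟩ := exists_approx_root_mul_of_close hv hw hπ he hκ0 hκ hpos hξ hx hbz
      (happrox.mono (min_le_left r₂ r)) (hZ.mono (min_le_right r₂ r))
    exact ⟨V, coe_le_of_coe_le hV (by omega)⟩

variable (hε : (p - 1 : ℤ) * ε = e) {ξ : L} (hξ : IsPrimitiveRoot ξ (p ^ (c + 1)))

include hε hξ

theorem exists_approx_root_map_mul_pow_of_close {x : L} {a b : M}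
    (hx : x ^ p ^ (c + 1) = f (a * b ^ p)) (ha1 : 1 ≤ v (f (a - 1))) {s : ℕ}
    (hs : v (f b) = ((s : ℤ) : WithTop ℤ))
    (ha : (((c + 1) * e + ε : ℤ) : WithTop ℤ) < κ + v (f (a - 1)))
    (hb : ((c * e + ε : ℤ) : WithTop ℤ) < κ + v (f (b - 1))) :
    ∃ V : (WittVector p k)[X], ((p * s + (c + 1) * e + ε + 1 : ℤ) : WithTop ℤ) ≤
      w (V.map (ofWitt p k L) ^ p ^ (c + 1) - C (f' (a * b ^ p))) := by
  have hpos : 0 < p ^ c := pow_pos hp.out.pos c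
  have hp1 : (0 : ℤ) < p - 1 := sub_pos.2 (by exact_mod_cast hp.out.one_lt)
  have hε0 : 0 ≤ ε := nonneg_of_mul_nonneg_right (hε ▸ e.cast_nonneg) hp1
  have hξp : IsPrimitiveRoot (ξ ^ p ^ c) p := hξ.pow (pow_pos hp.out.pos _) (pow_succ p c)
  have hξq : IsPrimitiveRoot (ξ ^ p) (p ^ c) := hξ.pow (pow_pos hp.out.pos _) (pow_succ' p c)
  have hfb0 : f b ≠ 0 := ne_zero_of_map_eq_coe v hs
  obtain ⟨R, hR, hTR⟩ := exists_nat_le_of_lt_add (zero_le_one.trans ha1) ha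
  have happrox := hf (a - 1) R hR
  rw [map_sub, map_one, map_sub, map_one] at happrox
  rw [map_sub, map_one] at ha1
  have hva : v (f a) = 0 := map_eq_zero_of_one_le_map_sub_one v ha1
  have hquot : (x ^ p ^ c / f b) ^ p = f a := by
    rw [div_pow, ← pow_mul, ← pow_succ, hx, map_mul, map_pow,
      mul_div_cancel_right₀ _ (pow_ne_zero p hfb0)]
  obtain ⟨z, hz, r, Y, hY, hRr, hYa⟩ := exists_approx_root_of_approxBy hv hw hπ he hκ0 hκ
    hp.out.pos hξp hquot (ne_zero_of_map_eq_coe v (a := 0) hva) happrox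
  have hvz : v z = 0 := map_eq_zero_of_pow_eq v hp.out.ne_zero hz hva
  rw [he] at hRr
  norm_cast at hRr
  have : NeZero p := ⟨hp.out.ne_zero⟩
  obtain ⟨x₁, hx₁⟩ := exists_pow_eq_of_pow_mul_eq (pow_succ p c ▸ hξ)
    (by rw [← pow_succ, hx, map_mul, map_pow, mul_pow, hz, mul_comm] :
      x ^ (p ^ c * p) = (f b * z) ^ p)
  obtain ⟨V, hV⟩ := exists_approx_root_map_mul hv hw hπ he hκ0 hκ hf hξq hx₁ hvz hs hY
    (by linarith : c * e + ε < κ + r) hb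
  have hwp : w (p : L[X]) = ((e : ℤ) : WithTop ℤ) := by rw [← C_eq_natCast, hw.val_C, he]
  have hpow := le_map_pow_sub_mul_pow w hp.out hwp.ge (by positivity)
    (by linarith [mul_nonneg hp1.le (by positivity : (0 : ℤ) ≤ c * e + 1)])
    (hw.val_C (f' b) ▸ (hf b s hs.ge).le_val hv hw hκ0)
    (((LiftsTo.one π w κ).add (hY.mono r.zero_le)).le_val_lift hv hw hκ0) hV
    (coe_le_of_coe_le hYa (by linarith))
  refine ⟨V, ?_⟩
  rw [map_mul, map_pow, C_mul, C_pow, pow_succ, pow_mul]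
  exact coe_le_of_coe_le hpow (by linarith)

theorem exists_approx_root_map_mul_pow {x : L} {a b : M} (hx : x ^ p ^ (c + 1) = f (a * b ^ p))
    (hab0 : f (a * b ^ p) ≠ 0) (hab : 0 ≤ v (f (a * b ^ p))) (hb0 : 0 ≤ v (f b))
    (ha : (((c + 1) * e + ε : ℤ) : WithTop ℤ) < κ + v (f (a - 1)))
    (hb : ((c * e + ε : ℤ) : WithTop ℤ) < κ + v (f (b - 1))) :
    ∃ (s : ℤ) (V : (WittVector p k)[X]), v (f (a * b ^ p)) = s ∧
      ((s + (c + 1) * e + ε + 1 : ℤ) : WithTop ℤ) ≤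
        w (V.map (ofWitt p k L) ^ p ^ (c + 1) - C (f' (a * b ^ p))) := by
  rcases lt_or_ge (v (f (a - 1))) 1 with hlt | hge
  · obtain ⟨s, hs⟩ := exists_map_eq_coe v hab0
    lift s to ℕ using by rwa [hs, ← WithTop.coe_zero, WithTop.coe_le_coe] at hab
    obtain ⟨B, hB, hBb⟩ := hf _ s hs.ge
    obtain ⟨V, hV⟩ := exists_approx_root hv hw hπ hκ0 (by omega) (pow_pos hp.out.pos _) hx hs hB
    have hκT : (c + 1) * e + ε + 1 ≤ κ := by
      obtain ⟨m, hm⟩ := WithTop.ne_top_iff_exists.1 hlt.ne_top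
      rw [← hm, ← WithTop.coe_add, WithTop.coe_lt_coe] at ha
      rw [← hm, ← WithTop.coe_one, WithTop.coe_lt_coe] at hlt
      omega
    refine ⟨s, V, hs, ?_⟩
    rw [← sub_add_sub_cancel _ B]
    exact coe_le_of_coe_le (w.map_le_add hV hBb) (by linarith)
  · rw [map_mul, map_pow, mul_ne_zero_iff] at hab0
    obtain ⟨s, hs⟩ := exists_map_eq_coe v (pow_ne_zero_iff hp.out.ne_zero |>.1 hab0.2)
    lift s to ℕ using by rwa [hs, ← WithTop.coe_zero, WithTop.coe_le_coe] at hb0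
    obtain ⟨V, hV⟩ := exists_approx_root_map_mul_pow_of_close hv hw hπ he hκ0 hκ hf hε hξ hx hge
      hs ha hb
    refine ⟨p * s, V, ?_, hV⟩
    rw [map_sub, map_one] at hge
    rw [map_mul, map_pow, v.map_mul, map_eq_zero_of_one_le_map_sub_one v hge, zero_add,
      map_pow_eq_coe v hs]

end Approx

/-! ### Cyclotomic fields -/

section Cyclotomic

open scoped IntermediateField

variable {p : ℕ} [hp : Fact p.Prime] {k : Type*} [Field k] [CharP k p] [IsAlgClosed k]
  {L : Type*} [Field L] [Algebra (K₀ p k) L]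

theorem le_val_p_of_primitiveRoot [Algebra.IsAlgebraic (K₀ p k) L]
    {v : AddValuation L (WithTop ℤ)} (hv : IsNormalizedVal p k v) {n : ℕ} {ζ : L}
    (hζ : IsPrimitiveRoot ζ (p ^ (n + 1))) {e : ℕ} (he : v (p : L) = ((e : ℤ) : WithTop ℤ)) :
    (p ^ (n + 1)).totient ≤ e := by
  obtain ⟨N, -, hN⟩ := exists_map_primitiveRoot_sub_one v hζ he
  have hdvd : (p ^ (n + 1)).totient ∣ e := by
    rw [← Int.natCast_dvd_natCast, Nat.totient_prime_pow_succ hp.out, Nat.cast_mul,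
      Nat.cast_sub hp.out.one_le]
    exact ⟨N, by push_cast; exact hN.symm⟩
  have he1 := one_le_val_p hv
  rw [he] at he1
  exact Nat.le_of_dvd (by exact_mod_cast he1) hdvd

/-- The degree of `K₀(ζ)` is its absolute ramification index, which is at least `φ(p ^ (n + 1))`;
hence the cyclotomic polynomial stays irreducible over `K₀`. -/
theorem minpoly_primitiveRoot {n : ℕ} {ζ : L} (hζ : IsPrimitiveRoot ζ (p ^ (n + 1))) :
    minpoly (K₀ p k) ζ = cyclotomic (p ^ (n + 1)) (K₀ p k) := by
  have hint : IsIntegral (K₀ p k) ζ := isIntegral_of_pow_eq_one p k L hζ.pow_eq_one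
  have hdvd : minpoly (K₀ p k) ζ ∣ cyclotomic (p ^ (n + 1)) (K₀ p k) := minpoly.dvd _ _ (by
    rw [aeval_def, ← eval_map, map_cyclotomic]
    exact hζ.isRoot_cyclotomic (pow_pos hp.out.pos _))
  have : FiniteDimensional (K₀ p k) (K₀ p k)⟮ζ⟯ := IntermediateField.adjoin.finiteDimensional hint
  obtain ⟨v, hv⟩ := exists_isNormalizedVal p k (K₀ p k)⟮ζ⟯
  obtain ⟨e, -, he⟩ := exists_val_p hv
  have hgen : IsPrimitiveRoot (IntermediateField.AdjoinSimple.gen (K₀ p k) ζ) (p ^ (n + 1)) :=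
    IsPrimitiveRoot.of_map_of_injective (f := algebraMap (K₀ p k)⟮ζ⟯ L)
      (by simpa only [IntermediateField.AdjoinSimple.algebraMap_gen] using hζ)
      (algebraMap (K₀ p k)⟮ζ⟯ L).injective
  refine (eq_of_monic_of_dvd_of_natDegree_le (minpoly.monic hint) (cyclotomic.monic _ _)
    hdvd ?_).symm
  rw [natDegree_cyclotomic, ← IntermediateField.adjoin.finrank hint, finrank_eq_of_val_p hv he]
  exact le_val_p_of_primitiveRoot hv hgen he

theorem exists_algEquiv_primitiveRoot [Normal (K₀ p k) L] {n : ℕ} {ζ ζ' : L}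
    (hζ : IsPrimitiveRoot ζ (p ^ (n + 1))) (hζ' : IsPrimitiveRoot ζ' (p ^ (n + 1))) :
    ∃ g : L ≃ₐ[K₀ p k] L, g ζ = ζ' := by
  refine isConjRoot_iff_exists_algEquiv.1 ?_
  rw [isConjRoot_def, minpoly_primitiveRoot hζ, minpoly_primitiveRoot hζ']

end Cyclotomic

section Kn

open scoped IntermediateField

variable {p : ℕ} [hp : Fact p.Prime] {k : Type*} [Field k] [CharP k p]
  (Ω : Type*) [Field Ω] [Algebra (K₀ p k) Ω]

theorem exists_primitiveRoot_Kn [IsAlgClosed Ω] (n : ℕ) :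
    ∃ ζ : Kn p k Ω n, IsPrimitiveRoot ζ (p ^ n) := by
  have := charZero_ext p k Ω
  have : NeZero ((p ^ n : ℕ) : Ω) := ⟨Nat.cast_ne_zero.2 (pow_pos hp.out.pos n).ne'⟩
  obtain ⟨ζ, hζ⟩ := HasEnoughRootsOfUnity.exists_primitiveRoot Ω (p ^ n)
  exact ⟨⟨ζ, IntermediateField.subset_adjoin _ _ hζ.pow_eq_one⟩,
    IsPrimitiveRoot.of_map_of_injective (f := algebraMap (Kn p k Ω n) Ω)
      hζ (algebraMap (Kn p k Ω n) Ω).injective⟩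

theorem Kn_eq_adjoin {n : ℕ} {ζ : Ω} (hζ : IsPrimitiveRoot ζ (p ^ n)) :
    Kn p k Ω n = (K₀ p k)⟮ζ⟯ := by
  have : NeZero (p ^ n) := ⟨(pow_pos hp.out.pos _).ne'⟩
  refine le_antisymm (IntermediateField.adjoin_le_iff.2 fun η hη => ?_)
    (IntermediateField.adjoin_simple_le_iff.2
      (IntermediateField.subset_adjoin _ _ hζ.pow_eq_one))
  obtain ⟨i, -, rfl⟩ := hζ.eq_pow_of_pow_eq_one hη
  exact pow_mem (IntermediateField.mem_adjoin_simple_self _ _) i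

instance isAlgebraic_Kn (n : ℕ) : Algebra.IsAlgebraic (K₀ p k) (Kn p k Ω n) :=
  Algebra.IsAlgebraic.of_finite (K₀ p k) (Kn p k Ω n)

variable [IsAlgClosed k]

theorem isNormalizedVal_vn (n : ℕ) : IsNormalizedVal p k (vn p k Ω n) :=
  (exists_isNormalizedVal p k (Kn p k Ω n)).choose_spec

variable {Ω}

theorem vn_p {n : ℕ} {ζ : Kn p k Ω (n + 1)} (hζ : IsPrimitiveRoot ζ (p ^ (n + 1))) :
    vn p k Ω (n + 1) (p : Kn p k Ω (n + 1)) = ((p ^ n * (p - 1) : ℤ) : WithTop ℤ) := by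
  obtain ⟨e, -, he⟩ := exists_val_p (isNormalizedVal_vn (p := p) (k := k) Ω (n + 1))
  have hζΩ : IsPrimitiveRoot (ζ : Ω) (p ^ (n + 1)) :=
    hζ.map_of_injective (f := algebraMap (Kn p k Ω (n + 1)) Ω)
      (algebraMap (Kn p k Ω (n + 1)) Ω).injective
  have hdeg := finrank_eq_of_val_p (isNormalizedVal_vn Ω (n + 1)) he
  rw [Kn_eq_adjoin Ω hζΩ, IntermediateField.adjoin.finrank
    (isIntegral_of_pow_eq_one p k Ω hζΩ.pow_eq_one), minpoly_primitiveRoot hζΩ,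
    natDegree_cyclotomic, Nat.totient_prime_pow_succ hp.out] at hdeg
  rw [he, ← hdeg, Nat.cast_mul, Nat.cast_sub hp.out.one_le, Nat.cast_pow, Nat.cast_one]

theorem vn_primitiveRoot_sub_one {n : ℕ} {ζ : Kn p k Ω (n + 1)}
    (hζ : IsPrimitiveRoot ζ (p ^ (n + 1))) : vn p k Ω (n + 1) (ζ - 1) = 1 := by
  obtain ⟨N, hN, hNe⟩ := exists_map_primitiveRoot_sub_one _ hζ (vn_p hζ)
  have hpos : (0 : ℤ) < p ^ n * (p - 1) :=
    mul_pos (pow_pos (by exact_mod_cast hp.out.pos) n) (by have := hp.out.one_lt; omega)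
  rw [hN, (mul_eq_left₀ hpos.ne').1 hNe, WithTop.coe_one]

end Kn

section ApproxCyclotomic

variable {p : ℕ} [hp : Fact p.Prime] {k : Type*} [Field k] [CharP k p] [IsAlgClosed k]
  {L : Type*} [Field L] [Algebra (K₀ p k) L] [Normal (K₀ p k) L]
  {v : AddValuation L (WithTop ℤ)} (hv : IsNormalizedVal p k v) {π : L} (hπ : v π = 1) {D : ℤ}
  {H : Set (L ≃ₐ[K₀ p k] L)} {w : AddValuation L[X] (WithTop ℤ)}
  (hw : IsGenericPoint p k v π D H w) {e : ℕ} (he : v (p : L) = ((e : ℤ) : WithTop ℤ)) {ε : ℤ}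
  (hε : (p - 1 : ℤ) * ε = e)

include hv hπ hw he hε

theorem exists_algEquiv_approxBy_primitiveRoot {n : ℕ} {ζ : L}
    (hζ : IsPrimitiveRoot ζ (p ^ (n + 1))) {N : ℕ} (hN : v (ζ - 1) = ((N : ℤ) : WithTop ℤ)) :
    ∃ g : L ≃ₐ[K₀ p k] L,
      ApproxBy p k π w (D - (n + 1) * e + ε - N) N (ζ - 1) (g (ζ - 1)) := by
  obtain ⟨V, hV⟩ := exists_eq_uniformizer_pow_mul_eval₂ hv hπ hN.ge
  have hF : (X ^ N * V + 1).eval₂ (ofWitt p k L) π = ζ := by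
    rw [eval₂_add, eval₂_mul, eval₂_pow, eval₂_X, eval₂_one, ← hV, sub_add_cancel]
  obtain ⟨ζ', hζ', hclose⟩ := exists_close_primitiveRoot hw he hε hζ hF
  obtain ⟨g, rfl⟩ := exists_algEquiv_primitiveRoot (k := k) hζ hζ'
  refine ⟨g, _, hV ▸ LiftsTo.pow_mul_eval₂ π w _ N V, ?_⟩
  have hsplit : (X ^ N * V + 1).map (ofWitt p k L) - C (g ζ) =
      X ^ N * V.map (ofWitt p k L) - C (g (ζ - 1)) := by
    simp only [Polynomial.map_add, Polynomial.map_mul, Polynomial.map_pow, map_X,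
      Polynomial.map_one, map_sub, map_one]
    ring
  rw [add_sub_cancel, ← hsplit]
  exact hclose

end ApproxCyclotomic

theorem ramification_primitiveRoot_bounds {p n : ℕ} (hp : 2 ≤ p) {e ε N : ℤ} (he : 1 ≤ e)
    (hε : (p - 1) * ε = e) (hN : p ^ n * (p - 1) * N = e) :
    0 < N ∧ N ≤ ε ∧ e + ε ≤ (n + 1) * e + N := by
  have hp1 : (1 : ℤ) ≤ p - 1 := by omega
  have hpn : (1 : ℤ) ≤ p ^ n := one_le_pow₀ (by omega)
  have hεN : ε = p ^ n * N := by
    refine mul_left_cancel₀ (by omega : (p - 1 : ℤ) ≠ 0) ?_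
    rw [hε, ← hN]
    ring
  have hN0 : 0 < N := by
    refine pos_of_mul_pos_right (a := (p ^ n * (p - 1) : ℤ)) (by omega) (by positivity)
  refine ⟨hN0, hεN ▸ le_mul_of_one_le_left hN0.le hpn, ?_⟩
  rcases n.eq_zero_or_pos with rfl | hn
  · simp [hεN]
  · have hεe : ε ≤ e := hε ▸ le_mul_of_one_le_left (by rw [hεN]; positivity) hp1
    nlinarith [(by exact_mod_cast hn : (1 : ℤ) ≤ n)]

section Embedding

variable {p : ℕ} [hp : Fact p.Prime] {k : Type*} [Field k] [CharP k p] [IsAlgClosed k]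
  {M : Type*} [Field M] [Algebra (K₀ p k) M] [Algebra.IsAlgebraic (K₀ p k) M]
  {u : AddValuation M (WithTop ℤ)} (hu : IsNormalizedVal p k u)
  {L : Type*} [Field L] [Algebra (K₀ p k) L]
  {v : AddValuation L (WithTop ℤ)} (hv : IsNormalizedVal p k v) (f : M →ₐ[K₀ p k] L)

include hu hv

theorem val_algHom_nonneg {a : M} (ha : 0 ≤ u a) : 0 ≤ v (f a) :=
  map_nonneg_of_map_ofWitt_nonneg (v' := v.comap (f : M →+* L)) hu
    (fun a => (val_ofWitt_nonneg hv a).trans_eq (congrArg v (f.commutes _).symm)) ha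

theorem val_algHom_mono {a b : M} (hab : u a ≤ u b) : v (f a) ≤ v (f b) := by
  rcases eq_or_ne a 0 with rfl | ha0
  · rw [u.map_zero, top_le_iff, u.top_iff] at hab
    rw [hab]
  · obtain ⟨n, hn⟩ := exists_map_eq_coe u ha0
    rw [← div_mul_cancel₀ b ha0, map_mul, v.map_mul]
    exact le_add_of_nonneg_left (val_algHom_nonneg hu hv f
      (coe_le_map_div u (a := 0) (by rwa [zero_add, ← hn]) hn))

variable {ϖ : M} (hϖ : u ϖ = 1)

include hϖ

theorem val_algHom {N : ℤ} (hN : v (f ϖ) = N) {a : M} {s : ℤ} (ha : u a = s) :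
    v (f a) = ((s * N : ℤ) : WithTop ℤ) :=
  map_eq_coe_mul_of_forall_nonneg (v' := v.comap (f : M →+* L))
    (fun _ => val_algHom_nonneg hu hv f) hϖ hN ha

variable {π : L} {w : AddValuation L[X] (WithTop ℤ)} {D : ℤ} {H : Set (L ≃ₐ[K₀ p k] L)}
  (hw : IsGenericPoint p k v π D H w)

include hw

theorem approxBy_algHom {κ : ℤ} (hκ0 : 0 ≤ κ) {N : ℕ} (hN0 : 0 < N)
    (hN : v (f ϖ) = ((N : ℤ) : WithTop ℤ)) {g : L ≃ₐ[K₀ p k] L}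
    (hg : ApproxBy p k π w κ N (f ϖ) (g (f ϖ))) {a : M} {r : ℕ}
    (ha : ((r : ℤ) : WithTop ℤ) ≤ v (f a)) :
    ApproxBy p k π w κ r (f a) (g (f a)) := by
  rcases eq_or_ne a 0 with rfl | hne
  · rw [map_zero, map_zero]
    exact ApproxBy.zero r
  obtain ⟨s, hs⟩ := exists_map_eq_coe u hne
  rw [val_algHom hu hv f hϖ hN hs, WithTop.coe_le_coe] at ha
  lift s to ℕ using nonneg_of_mul_nonneg_left (r.cast_nonneg.trans ha) (by exact_mod_cast hN0)
  obtain ⟨U, rfl⟩ := exists_eq_uniformizer_pow_mul_eval₂ hu hϖ hs.ge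
  rw [map_mul, map_pow, map_eval₂_ofWitt, map_mul, map_pow, map_eval₂_ofWitt]
  exact (hg.pow_mul_eval₂ hv hw hκ0 s U).mono (by exact_mod_cast ha)

variable (hπ : v π = 1) [FiniteDimensional (K₀ p k) L] {e : ℕ}
  (he : v (p : L) = ((e : ℤ) : WithTop ℤ)) {ε : ℤ} (hε : (p - 1 : ℤ) * ε = e)

include hπ he hε

variable {n m : ℕ} {ξ : L} (hξ : IsPrimitiveRoot ξ (p ^ (m + 1))) (hD : (m + 1) * e < D)

include hξ hD

omit hϖ

theorem algEquiv_algHom_eq {ζ : M} (hζ : ζ ^ p ^ (n + 1) = 1) (hnm : n ≤ m)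
    (hϖ : u (ζ - 1) = 1) {h : L ≃ₐ[K₀ p k] L} (hh : h ∈ H) (g : L →ₐ[K₀ p k] L) {a : M}
    (ha : 0 ≤ u a) : h (g (f a)) = g (f a) := by
  obtain ⟨U, rfl⟩ := exists_eq_uniformizer_pow_mul_eval₂ hu hϖ (r := 0) ha
  have hgζ : h (g (f ζ)) = g (f ζ) :=
    algEquiv_primitiveRoot_eq hw he hε hv hπ hξ hD hh (Nat.add_le_add_right hnm 1)
      (by rw [← map_pow, ← map_pow, hζ, map_one, map_one])
  simp only [pow_zero, one_mul, map_eval₂_ofWitt, map_sub, map_one, hgζ]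

theorem exists_algEquiv_root_fixed [IsGalois (K₀ p k) L] {ζ : M}
    (hζ : IsPrimitiveRoot ζ (p ^ (n + 1))) (hϖ : u (ζ - 1) = 1) {N : ℕ}
    (hN : v (f ζ - 1) = ((N : ℤ) : WithTop ℤ)) {c : ℕ} (hnm : n ≤ m) (hcm : c ≤ m) {κ : ℤ}
    (hκ : κ = D - (n + 1) * e + ε - N) {a b : M} (hab0 : a * b ^ p ≠ 0)
    (hab : 0 ≤ u (a * b ^ p)) (hb0 : 0 ≤ u b)
    (ha : (((c + 1) * e + ε : ℤ) : WithTop ℤ) < κ + v (f (a - 1)))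
    (hb : ((c * e + ε : ℤ) : WithTop ℤ) < κ + v (f (b - 1)))
    {x : L} (hx : x ^ p ^ (c + 1) = f (a * b ^ p)) :
    ∃ g : L ≃ₐ[K₀ p k] L, ∀ h ∈ H, h (g x) = g x := by
  have hfζ : IsPrimitiveRoot (f ζ) (p ^ (n + 1)) :=
    hζ.map_of_injective (f := (f : M →+* L)) f.injective
  obtain ⟨g, hg⟩ := exists_algEquiv_approxBy_primitiveRoot hv hπ hw he hε hfζ hN
  obtain ⟨N', hNN', hNe⟩ := exists_map_primitiveRoot_sub_one v hfζ he
  rw [hN, WithTop.coe_eq_coe] at hNN'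
  subst hNN'
  have he1 : 1 ≤ e := by exact_mod_cast he ▸ one_le_val_p hv
  obtain ⟨hN0, hNε, hεn⟩ :=
    ramification_primitiveRoot_bounds hp.out.two_le (by exact_mod_cast he1) hε hNe
  have hκ0 : 0 ≤ κ := by
    have : ((n : ℤ) + 1) * e ≤ (m + 1) * e := by gcongr
    linarith
  rw [← map_one f, ← map_sub] at hN hg
  rw [← hκ] at hg
  have happrox (z : M) (r : ℕ) (hr : ((r : ℤ) : WithTop ℤ) ≤ v (f z)) :
      ApproxBy p k π w κ r (f z) (g (f z)) :=
    approxBy_algHom hu hv f hϖ hw hκ0 (by exact_mod_cast hN0) hN hg hr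
  have hξc : IsPrimitiveRoot (ξ ^ p ^ (m - c)) (p ^ (c + 1)) := by
    refine hξ.pow (pow_pos hp.out.pos _) ?_
    rw [← pow_add]
    congr 1
    omega
  obtain ⟨s, V, hs, hV⟩ := exists_approx_root_map_mul_pow (f := (f : M →+* L))
    (f' := (g : L →+* L).comp f) hv hw hπ he hκ0 (by omega) happrox hε hξc hx
    ((map_ne_zero f).2 hab0) (val_algHom_nonneg hu hv f hab) (val_algHom_nonneg hu hv f hb0) ha hb
  refine ⟨g, fun h hh => algEquiv_root_eq hw he hε hξc (x := g x) (a := g (f (a * b ^ p)))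
    (by rw [← map_pow, hx]) (by rw [val_algEquiv hv]; exact hs) (by exact_mod_cast hV) hh
    (algEquiv_algHom_eq hu hv f hw hπ he hε hξ hD hζ.pow_eq_one hnm hϖ hh g hab)
    fun η => algEquiv_primitiveRoot_eq hw he hε hv hπ hξ hD hh (Nat.add_le_add_right hcm 1)⟩

end Embedding

/-! ### The conductor bound -/

section FixedField

open IntermediateField

theorem eq_one_of_le_lift_fixedField {K Ω : Type*} [Field K] [CharZero K] [Field Ω] [Algebra K Ω]
    [Normal K Ω] {F : IntermediateField K Ω}
    {G : Subgroup (normalClosure K F Ω ≃ₐ[K] normalClosure K F Ω)} (hG : G.Normal)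
    (hF : F ≤ lift (fixedField G)) {g : normalClosure K F Ω ≃ₐ[K] normalClosure K F Ω}
    (hg : g ∈ G) : g = 1 := by
  have : IsGalois K (normalClosure K F Ω) := {}
  have hnormal : Normal K (lift (fixedField G)) :=
    Normal.of_algEquiv (liftAlgEquiv (fixedField G))
  ext y
  have hy : y ∈ fixedField G := (mem_lift y).1 (normalClosure_le_iff_of_normal.2 hF y.2)
  exact congrArg Subtype.val (hy ⟨g, hg⟩)

end FixedField

section RamificationGroup

variable {p : ℕ} [hp : Fact p.Prime] {k : Type*} [Field k] [CharP k p] [IsAlgClosed k]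
  {L : Type*} [Field L] [Algebra (K₀ p k) L] [FiniteDimensional (K₀ p k) L]
  {v : AddValuation L (WithTop ℤ)} (hv : IsNormalizedVal p k v)

/-- The automorphisms acting trivially on the valuation ring modulo elements of valuation `≥ i`:
the ramification group `G_{i-1}` in the lower numbering. -/
def ramificationGroup (i : WithTop ℤ) : Subgroup (L ≃ₐ[K₀ p k] L) where
  carrier := {g | ∀ x, 0 ≤ v x → i ≤ v (g x - x)}
  mul_mem' {g h} hg hh x hx := by
    rw [← sub_add_sub_cancel _ (h x) x]
    exact v.map_le_add (hg (h x) (by rwa [val_algEquiv hv])) (hh x hx)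
  one_mem' x _ := by rw [AlgEquiv.one_apply, sub_self, v.map_zero]; exact le_top
  inv_mem' {g} hg x hx := by
    rw [← val_algEquiv hv g, map_sub, ← AlgEquiv.mul_apply, mul_inv_cancel, v.map_sub_swap]
    exact hg x hx

theorem ramificationGroup_normal (i : WithTop ℤ) : (ramificationGroup hv i).Normal where
  conj_mem h hh g x hx := by
    rw [← val_algEquiv hv g⁻¹, map_sub, AlgEquiv.mul_apply, AlgEquiv.mul_apply,
      ← AlgEquiv.mul_apply g⁻¹ g, inv_mul_cancel]
    exact hh (g⁻¹ x) (by rwa [val_algEquiv hv])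

theorem mem_ramificationGroup_iff {π : L} (hπ : v π = 1) {i : WithTop ℤ} {g : L ≃ₐ[K₀ p k] L} :
    g ∈ ramificationGroup hv i ↔ i ≤ v (g π - π) :=
  ⟨fun hg => hg π (hπ ▸ zero_le_one), fun hg _ hx => hg.trans (val_uniformizer_sub_le hv hπ g hx)⟩

end RamificationGroup

section Bound

theorem lt_of_boundTerm_le {p n : ℕ} (hp : 2 ≤ p) {b B : ℝ} {a : ℤ}
    (h : boundTerm p (n + 1) b a ≤ B) {e N : ℕ} (hN : (p ^ n * (p - 1) : ℤ) * N = e) {D : ℤ}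
    (hD : (B + 1) * e < D) : (b + 1) * e - N * (a - 1) < D := by
  have hq : (0 : ℝ) < p ^ n * (p - 1) := by
    have : (2 : ℝ) ≤ p := by exact_mod_cast hp
    exact mul_pos (by positivity) (by linarith)
  have hB : b - (a - 1) / (p ^ n * (p - 1)) ≤ B := WithBot.coe_le_coe.1 h
  have hNe : (p ^ n * (p - 1) : ℝ) * N = e := by exact_mod_cast hN
  calc (b + 1) * e - N * (a - 1) = (b - (a - 1) / (p ^ n * (p - 1)) + 1) * e := by
        rw [← hNe]
        linear_combination (N : ℝ) * div_mul_cancel₀ ((a : ℝ) - 1) hq.ne'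
    _ ≤ (B + 1) * e := by gcongr
    _ < D := hD

variable {p : ℕ} [hp : Fact p.Prime] {k : Type*} [Field k] [CharP k p] [IsAlgClosed k]
  {M : Type*} [Field M] [Algebra (K₀ p k) M] [Algebra.IsAlgebraic (K₀ p k) M]
  {u : AddValuation M (WithTop ℤ)} (hu : IsNormalizedVal p k u)
  {L : Type*} [Field L] [Algebra (K₀ p k) L]
  {v : AddValuation L (WithTop ℤ)} (hv : IsNormalizedVal p k v) (f : M →ₐ[K₀ p k] L)

include hu hv

theorem lt_add_val_of_boundTerm_le {ϖ : M} (hϖ : u ϖ = 1) {n e N : ℕ}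
    (hN : v (f ϖ) = ((N : ℤ) : WithTop ℤ)) (hNe : (p ^ n * (p - 1) : ℤ) * N = e) {B : ℝ} {D : ℤ}
    (hD : (B + 1) * e < D) {r : ℕ} {z : M} (hz : boundTerm p (n + 1) (r + n) (u z) ≤ B) (ε : ℤ) :
    ((r * e + ε : ℤ) : WithTop ℤ) < (D - (n + 1) * e + ε - N : ℤ) + v (f z) := by
  rcases eq_or_ne z 0 with rfl | hz0
  · rw [map_zero, v.map_zero]
    exact WithTop.coe_lt_top _
  obtain ⟨a, ha⟩ := exists_map_eq_coe u hz0
  have hlt := lt_of_boundTerm_le hp.out.two_le (ha ▸ hz) hNe hD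
  rw [val_algHom hu hv f hϖ hN ha, ← WithTop.coe_add, WithTop.coe_lt_coe]
  rify
  linarith

theorem exists_normal_subgroup_of_lt_conductor [FiniteDimensional (K₀ p k) L]
    [IsGalois (K₀ p k) L] {n m c : ℕ} (hnm : n ≤ m) (hcm : c ≤ m) {ζ : M}
    (hζ : IsPrimitiveRoot ζ (p ^ (n + 1))) (hϖ : u (ζ - 1) = 1) {ξ : L}
    (hξ : IsPrimitiveRoot ξ (p ^ (m + 1))) {a b : M} (hab : 0 ≤ u (a * b ^ p)) (hb0 : 0 ≤ u b)
    {B : ℝ} (hB : m ≤ B) (ha : boundTerm p (n + 1) (c + n + 1) (u (a - 1)) ≤ B)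
    (hb : boundTerm p (n + 1) (c + n) (u (b - 1)) ≤ B) {x : L}
    (hx : x ^ p ^ (c + 1) = f (a * b ^ p)) (hlt : B < conductor (K₀ p k) v) :
    ∃ G : Subgroup (L ≃ₐ[K₀ p k] L), G.Normal ∧ G ≠ ⊥ ∧
      (∀ h ∈ G, ∀ η : L, η ^ p ^ (m + 1) = 1 → h η = η) ∧ ∀ h ∈ G, h x = x := by
  obtain ⟨π, hπ⟩ := exists_uniformizer hv
  obtain ⟨i₀, D, hi₀, ⟨g₀, hg₀1, hg₀⟩, hD, hBD⟩ :=
    exists_ramification_of_lt_conductor hv hπ ((Nat.cast_nonneg m).trans hB) hlt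
  obtain ⟨e, he1, he⟩ := exists_val_p hv
  rw [IsGalois.card_aut_eq_finrank, finrank_eq_of_val_p hv he] at hBD
  have hw := isGenericPoint_discVal hv hπ hi₀ hD
  obtain ⟨ε, -, hε⟩ := exists_map_primitiveRoot_sub_one (n := 0) v
    (by simpa using hξ.pow (pow_pos hp.out.pos _) (pow_succ p m)) he
  rw [pow_zero, one_mul] at hε
  have hmD : (m + 1) * e < D := by
    have : ((m : ℝ) + 1) * e < D := lt_of_le_of_lt (by gcongr) hBD
    exact_mod_cast this
  have hmem {h : L ≃ₐ[K₀ p k] L} := mem_ramificationGroup_iff hv hπ (i := i₀) (g := h)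
  refine ⟨ramificationGroup hv i₀, ramificationGroup_normal hv i₀, fun hbot => hg₀1 ?_,
    fun h hh η => algEquiv_primitiveRoot_eq hw he hε hv hπ hξ hmD (hmem.1 hh) le_rfl, ?_⟩
  · exact Subgroup.mem_bot.1 (hbot ▸ hmem.2 hg₀.ge)
  obtain hab0 | hab0 := eq_or_ne (a * b ^ p) 0
  · rw [hab0, map_zero, pow_eq_zero_iff (pow_pos hp.out.pos _).ne'] at hx
    exact fun h _ => by rw [hx, map_zero]
  have hfζ : IsPrimitiveRoot (f ζ) (p ^ (n + 1)) :=
    hζ.map_of_injective (f := (f : M →+* L)) f.injective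
  obtain ⟨N, hN, hNe⟩ := exists_map_primitiveRoot_sub_one v hfζ he
  lift N to ℕ using (ramification_primitiveRoot_bounds hp.out.two_le (by exact_mod_cast he1) hε
    hNe).1.le
  have hN' : v (f (ζ - 1)) = ((N : ℤ) : WithTop ℤ) := by rw [map_sub, map_one, hN]
  obtain ⟨g, hg⟩ := exists_algEquiv_root_fixed hu hv f hw hπ he hε hξ hmD hζ hϖ hN hnm hcm rfl
    hab0 hab hb0
    (lt_add_val_of_boundTerm_le hu hv f hϖ hN' hNe hBD (r := c + 1)
      (by rwa [Nat.cast_succ, add_right_comm]) ε)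
    (lt_add_val_of_boundTerm_le hu hv f hϖ hN' hNe hBD hb ε) hx
  intro h hh
  have hconj := hg _ (hmem.1 ((ramificationGroup_normal hv i₀).conj_mem h hh g))
  rw [AlgEquiv.mul_apply, AlgEquiv.mul_apply, ← AlgEquiv.mul_apply g⁻¹, inv_mul_cancel] at hconj
  exact g.injective hconj

end Bound

section GaloisClosure

variable {p : ℕ} [hp : Fact p.Prime] {k : Type*} [Field k] [CharP k p]
  (Ω : Type*) [Field Ω] [Algebra (K₀ p k) Ω]

theorem Kn_mono : Monotone (Kn p k Ω) := by
  intro n m hnm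
  refine IntermediateField.adjoin.mono _ _ _ fun η (hη : η ^ p ^ n = 1) => ?_
  change η ^ p ^ m = 1
  rw [← Nat.add_sub_cancel' hnm, pow_add, pow_mul, hη, one_pow]

variable [IsAlgClosed Ω] [Algebra.IsAlgebraic (K₀ p k) Ω]

theorem normal_of_isAlgClosed : Normal (K₀ p k) Ω :=
  have : IsAlgClosure (K₀ p k) Ω := ⟨inferInstance, inferInstance⟩
  IsAlgClosure.normal (K₀ p k) Ω

theorem isGalois_galoisClosure (m : ℕ) (x : Ω) : IsGalois (K₀ p k) (galoisClosure p k Ω m x) :=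
  have := charZero_K₀ p k
  have := normal_of_isAlgClosed (p := p) (k := k) Ω
  have : Normal (K₀ p k) (galoisClosure p k Ω m x) := normalClosure.normal _ _ _
  {}

theorem KnAdjoin_le_galoisClosure (m : ℕ) (x : Ω) :
    KnAdjoin p k Ω m x ≤ galoisClosure p k Ω m x :=
  have := normal_of_isAlgClosed (p := p) (k := k) Ω
  IntermediateField.le_normalClosure _

theorem conductor_galoisClosure_le [IsAlgClosed k] {n m c : ℕ} (hnm : n ≤ m) (hcm : c ≤ m)
    {a b : Kn p k Ω (n + 1)} (hab : 0 ≤ vn p k Ω (n + 1) (a * b ^ p))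
    (hb0 : 0 ≤ vn p k Ω (n + 1) b) {x : Ω}
    (hx : x ^ p ^ (c + 1) = ((a * b ^ p : Kn p k Ω (n + 1)) : Ω)) {B : ℝ} (hB : m ≤ B)
    (ha : boundTerm p (n + 1) (c + n + 1) (vn p k Ω (n + 1) (a - 1)) ≤ B)
    (hb : boundTerm p (n + 1) (c + n) (vn p k Ω (n + 1) (b - 1)) ≤ B) :
    conductor (K₀ p k) (normVal p k (galoisClosure p k Ω (m + 1) x)) ≤ B := by
  by_contra! hlt
  have := charZero_K₀ p k
  have := normal_of_isAlgClosed (p := p) (k := k) Ω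
  have := isGalois_galoisClosure (p := p) (k := k) Ω (m + 1) x
  have hle := KnAdjoin_le_galoisClosure (p := p) (k := k) Ω (m + 1) x
  have hKm := le_sup_left.trans hle
  have hxm : x ∈ galoisClosure p k Ω (m + 1) x :=
    hle (le_sup_right (α := IntermediateField (K₀ p k) Ω)
      (IntermediateField.mem_adjoin_simple_self _ x))
  obtain ⟨ζ, hζ⟩ := exists_primitiveRoot_Kn (p := p) (k := k) Ω (n + 1)
  obtain ⟨ξ, hξ⟩ := exists_primitiveRoot_Kn (p := p) (k := k) Ω (m + 1)
  obtain ⟨G, hGn, hG1, hunity, hroot⟩ := exists_normal_subgroup_of_lt_conductor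
    (isNormalizedVal_vn Ω (n + 1)) (exists_isNormalizedVal p k _).choose_spec
    (IntermediateField.inclusion ((Kn_mono Ω (Nat.add_le_add_right hnm 1)).trans hKm)) hnm hcm hζ
    (vn_primitiveRoot_sub_one hζ)
    (hξ.map_of_injective (IntermediateField.inclusion_injective hKm)) hab hb0 hB ha hb
    (x := ⟨x, hxm⟩) (Subtype.ext hx) hlt
  have hfix (y : galoisClosure p k Ω (m + 1) x) (hy : ∀ h ∈ G, h y = y) :
      (y : Ω) ∈ IntermediateField.lift (IntermediateField.fixedField G) :=
    (IntermediateField.mem_lift y).2 fun h => hy h h.2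
  refine hG1 (G.eq_bot_iff_forall.2 fun h => eq_one_of_le_lift_fixedField hGn (sup_le ?_ ?_))
  · refine IntermediateField.adjoin_le_iff.2 fun η hη => ?_
    exact hfix ⟨η, hKm (IntermediateField.subset_adjoin _ _ hη)⟩
      fun h hh => hunity h hh _ (Subtype.ext hη)
  · exact IntermediateField.adjoin_simple_le_iff.2 (hfix ⟨x, hxm⟩ hroot)

end GaloisClosure

/-! ### Existence of `p`-primitive representatives -/

theorem exists_root_le_map_sub_one {L : Type*} [Field L] (v : AddValuation L (WithTop ℤ)) {q : ℕ}
    (hq : 0 < q) {ξ : L} (hξ : IsPrimitiveRoot ξ q) {x t : L} (hx : x ^ q = 1 + t) {ε : ℕ}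
    (ht : ((q * ε : ℤ) : WithTop ℤ) ≤ v t) :
    ∃ y : L, y ^ q = 1 + t ∧ ((ε : ℤ) : WithTop ℤ) ≤ v (y - 1) := by
  rcases eq_or_ne x 0 with rfl | hx0
  · have ht1 : t = -1 := by
      rw [zero_pow hq.ne'] at hx
      exact eq_neg_of_add_eq_zero_right hx.symm
    have hε : (q * ε : ℤ) ≤ 0 := by
      rw [ht1, v.map_neg, v.map_one] at ht
      exact_mod_cast ht
    refine ⟨0, hx, ?_⟩
    rw [zero_sub, v.map_neg, v.map_one]
    exact_mod_cast nonpos_of_mul_nonpos_right hε (by exact_mod_cast hq)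
  · obtain ⟨y, hy, r, hr, hbin⟩ := exists_root_close_to_one v hq hξ hx hx0 (R := q * ε)
      (by exact_mod_cast ht)
    have hεr := hbin q hq
    rw [Nat.choose_self, Nat.cast_one, v.map_one, zero_add, WithTop.coe_le_coe] at hεr
    refine ⟨y, hy, coe_le_of_coe_le hr (le_of_mul_le_mul_left (a := (q : ℤ)) ?_ ?_)⟩
    · exact_mod_cast hεr
    · exact_mod_cast hq

section PowersNearOne

variable {p : ℕ} [hp : Fact p.Prime] {k : Type*} [Field k] [CharP k p] [IsAlgClosed k]

theorem exists_map_primitiveRoot_prime_sub_one {L : Type*} [Field L] [Algebra (K₀ p k) L]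
    [Algebra.IsAlgebraic (K₀ p k) L] {v : AddValuation L (WithTop ℤ)} (hv : IsNormalizedVal p k v)
    {ω : L} (hω : IsPrimitiveRoot ω p) :
    ∃ ε : ℕ, 1 ≤ ε ∧ v (ω - 1) = ((ε : ℤ) : WithTop ℤ) ∧
      v (p : L) = (((p - 1) * ε : ℤ) : WithTop ℤ) := by
  obtain ⟨e, he1, he⟩ := exists_val_p hv
  obtain ⟨ε, hε, hεe⟩ := exists_map_primitiveRoot_sub_one (n := 0) v (by simpa using hω) he
  rw [pow_zero, one_mul] at hεe
  have hε1 : 0 < ε := pos_of_mul_pos_right (a := (p - 1 : ℤ)) (by omega)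
    (by have := hp.out.one_lt; omega)
  lift ε to ℕ using hε1.le
  exact ⟨ε, by omega, hε, by rw [he, hεe]⟩

/-- Since the residue field of `L` is that of `K₀`, the quotient `(y - 1) / (ω - 1)` is fixed
modulo the maximal ideal, so `σ y / y` is a `p`-th root of unity closer to `1` than `ω` is. -/
theorem algEquiv_eq_self_of_pow_eq {L : Type*} [Field L] [Algebra (K₀ p k) L]
    [Algebra.IsAlgebraic (K₀ p k) L] {v : AddValuation L (WithTop ℤ)} (hv : IsNormalizedVal p k v)
    {ω y : L} (hω : IsPrimitiveRoot ω p) {σ : L ≃ₐ[K₀ p k] L} (hσω : σ ω = ω)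
    (hσy : σ y ^ p = y ^ p) (hy : v (ω - 1) ≤ v (y - 1)) : σ y = y := by
  obtain ⟨ε, hε1, hε, he⟩ := exists_map_primitiveRoot_prime_sub_one hv hω
  have hω0 : ω - 1 ≠ 0 := ne_zero_of_map_eq_coe v hε
  obtain ⟨π, hπ⟩ := exists_uniformizer hv
  have hquot : ((1 : ℤ) : WithTop ℤ) ≤ v (σ ((y - 1) / (ω - 1)) - (y - 1) / (ω - 1)) :=
    (one_le_val_algEquiv_sub hv hπ σ).trans (val_uniformizer_sub_le hv hπ σ
      (coe_le_map_div v (a := 0) (by simpa [hε] using hy) hε))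
  have hy0 : v y = 0 := map_eq_zero_of_one_le_map_sub_one v
    (coe_le_of_coe_le (hε ▸ hy) (by exact_mod_cast hε1))
  have hyne : y ≠ 0 := ne_zero_of_map_eq_coe v (a := 0) hy0
  have hsplit : σ y / y - 1 =
      (σ ((y - 1) / (ω - 1)) - (y - 1) / (ω - 1)) * (ω - 1) / y := by
    rw [map_div₀, map_sub, map_sub, map_one, hσω]
    field_simp
    ring
  refine (div_eq_one_iff_eq hyne).1 (eq_one_of_lt_map_sub_one v (c := 1) ?_ he rfl ?_)
  · rw [pow_one, div_pow, hσy, div_self (pow_ne_zero p hyne)]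
  · rw [hsplit, coe_lt_iff_add_one_le]
    refine coe_le_map_div v (b := 0) ?_ hy0
    rw [add_zero, add_comm]
    exact coe_add_le_map_mul v hquot hε.ge

variable {M : Type*} [Field M] [Algebra (K₀ p k) M] {ω : M} (hω : IsPrimitiveRoot ω p)

include hω

theorem exists_pow_eq_one_add_of_isGalois {L : Type*} [Field L] [Algebra (K₀ p k) L]
    [Algebra.IsAlgebraic (K₀ p k) L] [Algebra M L] [IsScalarTower (K₀ p k) M L]
    [FiniteDimensional M L] [IsGalois M L] {v : AddValuation L (WithTop ℤ)}
    (hv : IsNormalizedVal p k v) {t : M} {x : L} (hx : x ^ p = algebraMap M L (1 + t))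
    (ht : v (algebraMap M L ((ω - 1) ^ p)) ≤ v (algebraMap M L t)) : ∃ y : M, y ^ p = 1 + t := by
  have hωL : IsPrimitiveRoot (algebraMap M L ω) p := hω.map_of_injective (algebraMap M L).injective
  obtain ⟨ε, -, hε, -⟩ := exists_map_primitiveRoot_prime_sub_one hv hωL
  obtain ⟨y, hy, hyε⟩ := exists_root_le_map_sub_one v hp.out.pos hωL
    (by rwa [map_add, map_one] at hx)
    (by rwa [map_pow, map_sub, map_one, map_pow_eq_coe v hε] at ht)
  have hfix (σ : L ≃ₐ[M] L) : σ y = y := by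
    refine algEquiv_eq_self_of_pow_eq hv hωL (σ := σ.restrictScalars (K₀ p k)) (σ.commutes ω) ?_
      (hε.trans_le hyε)
    rw [← map_pow, hy, map_add, map_one]
    exact congrArg (1 + ·) (σ.commutes t)
  obtain ⟨z, rfl⟩ := (IsGalois.mem_range_algebraMap_iff_fixed y).2 hfix
  exact ⟨z, (algebraMap M L).injective (by rw [map_pow, map_add, map_one, hy])⟩

theorem exists_pow_eq_one_add [FiniteDimensional (K₀ p k) M] {u : AddValuation M (WithTop ℤ)}
    (hu : IsNormalizedVal p k u) {t : M} (ht : u ((ω - 1) ^ p) ≤ u t) :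
    ∃ y : M, y ^ p = 1 + t := by
  have := charZero_ext p k M
  let L := (X ^ p - C (1 + t)).SplittingField
  have : FiniteDimensional (K₀ p k) L := .trans (K₀ p k) M L
  have : IsGalois M L := {}
  obtain ⟨v, hv⟩ := exists_isNormalizedVal p k L
  obtain ⟨x, hx⟩ := (SplittingField.splits (X ^ p - C (1 + t))).exists_eval_eq_zero (by
    rw [degree_map, degree_X_pow_sub_C hp.out.pos]
    exact_mod_cast hp.out.ne_zero)
  rw [eval_map_algebraMap, map_sub, map_pow, aeval_X, aeval_C, sub_eq_zero] at hx
  exact exists_pow_eq_one_add_of_isGalois hω hv hx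
    (val_algHom_mono hu hv (IsScalarTower.toAlgHom (K₀ p k) M L) ht)

end PowersNearOne

section Decomposition

/-- `α` is `p`-primitive, or equal to `1`, up to the `p`-th power of an integral element. -/
def HasPPrimitiveDecomposition (p : ℕ) {K : Type*} [Field K] (v : AddValuation K (WithTop ℤ))
    (α : K) : Prop :=
  ∃ α' β : K, α = α' * β ^ p ∧ (α' = 1 ∨ IsPPrimitive p v α') ∧ 0 ≤ v β

variable {K : Type*} [Field K] {v : AddValuation K (WithTop ℤ)} {α : K}

theorem IsPPrimitive.hasPPrimitiveDecomposition {p : ℕ} (hα : IsPPrimitive p v α) :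
    HasPPrimitiveDecomposition p v α :=
  ⟨α, 1, by rw [one_pow, mul_one], .inr hα, v.map_one.ge⟩

theorem HasPPrimitiveDecomposition.mul_pow {p : ℕ} {b : K} (hα : HasPPrimitiveDecomposition p v α)
    (hb : 0 ≤ v b) : HasPPrimitiveDecomposition p v (α * b ^ p) := by
  obtain ⟨α', β, rfl, hα', hβ⟩ := hα
  exact ⟨α', β * b, by rw [_root_.mul_pow, mul_assoc], hα', v.map_mul β b ▸ add_nonneg hβ hb⟩

theorem isPPrimitive_of_map_sub_one {p : ℕ} (hp : 1 < p) {ε m : ℤ}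
    (he : v (p : K) = (((p - 1) * ε : ℤ) : WithTop ℤ)) (hm : v (α - 1) = m) (hm0 : 0 < m)
    (hmε : m < p * ε) (hpm : ¬ (p : ℤ) ∣ m) : IsPPrimitive p v α := by
  refine .inr ⟨m, _, hm, he, hm0, ?_, hpm⟩
  have hp1 : (p : ℝ) - 1 ≠ 0 := sub_ne_zero.2 (by exact_mod_cast hp.ne')
  calc (m : ℝ) < p * ε := by exact_mod_cast hmε
    _ = p / (p - 1) * ((p - 1) * ε : ℤ) := by push_cast; field_simp

theorem coe_add_le_map_one_add_pow {p : ℕ} [hp : Fact p.Prime] {R : Type*} [CommRing R]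
    (v : AddValuation R (WithTop ℤ)) {e s : ℤ} (he : (e : WithTop ℤ) ≤ v (p : R)) {y : R}
    (hy : (s : WithTop ℤ) ≤ v y) (hs : 0 ≤ s) :
    ((e + s : ℤ) : WithTop ℤ) ≤ v ((1 + y) ^ p - 1 - y ^ p) := by
  have hsplit : (1 + y) ^ p - 1 - y ^ p = p * (y *
      ∑ j ∈ Finset.Ioo 0 p, y ^ (p - j - 1) * ((p.choose j / p : ℕ) : R)) := by
    rw [add_pow_prime_eq hp.out]
    simp only [one_pow, one_mul, mul_one]
    ring
  have hy0 : 0 ≤ v y := coe_le_of_coe_le hy hs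
  rw [hsplit]
  refine coe_add_le_map_mul v he ?_
  rw [v.map_mul]
  refine le_add_of_le_of_nonneg hy (v.map_le_sum fun j _ => ?_)
  rw [v.map_mul]
  exact add_nonneg (map_pow_nonneg v hy0 _) (map_natCast_nonneg v _)

end Decomposition

section DecompositionExists

variable {p : ℕ} [hp : Fact p.Prime] {k : Type*} [Field k] [CharP k p] [IsAlgClosed k]
  {L : Type*} [Field L] [Algebra (K₀ p k) L]

theorem exists_one_le_val_sub_ofWitt_pow [Algebra.IsAlgebraic (K₀ p k) L]
    {v : AddValuation L (WithTop ℤ)} (hv : IsNormalizedVal p k v) {x : L} (hx : 0 ≤ v x) :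
    ∃ r : WittVector p k, ((1 : ℤ) : WithTop ℤ) ≤ v (x - ofWitt p k L r ^ p) := by
  obtain ⟨a, ha⟩ := exists_residue hv hx
  obtain ⟨b, hb⟩ := IsAlgClosed.exists_pow_nat_eq (WittVector.constantCoeff a) hp.out.pos
  obtain ⟨r, rfl⟩ := WittVector.constantCoeff_surjective p b
  refine ⟨r, ?_⟩
  have hr : ((1 : ℤ) : WithTop ℤ) ≤ v (ofWitt p k L (a - r ^ p)) :=
    one_le_val_ofWitt hv (by rw [map_sub, map_pow, hb, sub_self])
  rw [← sub_add_sub_cancel x (ofWitt p k L a), ← map_pow, ← map_sub]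
  exact v.map_le_add ha hr

variable [FiniteDimensional (K₀ p k) L] {v : AddValuation L (WithTop ℤ)}
  (hv : IsNormalizedVal p k v)

include hv

theorem exists_approx_pow {x : L} {s : ℤ} (hx : v x = ((p * s : ℤ) : WithTop ℤ)) :
    ∃ b : L, v b = s ∧ ((p * s + 1 : ℤ) : WithTop ℤ) ≤ v (x - b ^ p) := by
  obtain ⟨π, hπ⟩ := exists_uniformizer hv
  have hπs : v (π ^ s) = s := by simpa using map_zpow_eq_coe v (a := 1) hπ s
  have hπps := map_pow_eq_coe v hπs p
  have hπ0 : π ^ s ≠ 0 := ne_zero_of_map_eq_coe v hπs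
  obtain ⟨r, hr⟩ := exists_one_le_val_sub_ofWitt_pow hv
    (coe_le_map_div v (a := 0) (by rw [zero_add, hx]) hπps)
  have happrox : ((p * s + 1 : ℤ) : WithTop ℤ) ≤ v (x - (π ^ s * ofWitt p k L r) ^ p) := by
    have hsplit : x - (π ^ s * ofWitt p k L r) ^ p =
        (π ^ s) ^ p * (x / (π ^ s) ^ p - ofWitt p k L r ^ p) := by
      rw [_root_.mul_pow, mul_sub, mul_div_cancel₀ _ (pow_ne_zero p hπ0)]
    rw [hsplit]
    exact coe_add_le_map_mul v hπps.ge hr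
  refine ⟨_, ?_, happrox⟩
  have hpow : v ((π ^ s * ofWitt p k L r) ^ p) = ((p * s : ℤ) : WithTop ℤ) := by
    rw [← sub_sub_cancel x ((π ^ s * ofWitt p k L r) ^ p), v.map_sub_eq_of_lt_left, hx]
    rw [hx]
    exact coe_lt_iff_add_one_le.2 happrox
  obtain ⟨t, ht⟩ := exists_map_eq_coe v ((pow_ne_zero_iff hp.out.ne_zero).1
    (ne_zero_of_map_eq_coe v hpow))
  rw [map_pow_eq_coe v ht, WithTop.coe_eq_coe] at hpow
  rw [ht, mul_left_cancel₀ (by exact_mod_cast hp.out.ne_zero) hpow]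

theorem exists_le_val_div_pow_sub_one {ε : ℕ} (he : v (p : L) = (((p - 1) * ε : ℤ) : WithTop ℤ))
    {z : L} {m : ℤ} (hm0 : 0 < m) (hmε : m < ε) (hz : v (z - 1) = ((p * m : ℤ) : WithTop ℤ)) :
    ∃ s : L, v s = 0 ∧ ((p * m + 1 : ℤ) : WithTop ℤ) ≤ v (z / s ^ p - 1) := by
  obtain ⟨b, hb, hzb⟩ := exists_approx_pow hv hz
  have hs : v (1 + b) = 0 := map_eq_zero_of_one_le_map_sub_one v (by
    rw [add_sub_cancel_left, hb]
    exact_mod_cast hm0)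
  have hcross := coe_add_le_map_one_add_pow v he.ge hb.ge hm0.le
  refine ⟨1 + b, hs, ?_⟩
  have hsplit : z / (1 + b) ^ p - 1 =
      ((z - 1 - b ^ p) - ((1 + b) ^ p - 1 - b ^ p)) / (1 + b) ^ p := by
    have : 1 + b ≠ 0 := ne_zero_of_map_eq_coe v (a := 0) hs
    field_simp
    ring
  rw [hsplit]
  refine coe_le_map_div v (b := p * 0) ?_ (map_pow_eq_coe v hs p)
  rw [mul_zero, add_zero]
  refine v.map_le_sub hzb (coe_le_of_coe_le hcross ?_)
  have := hp.out.one_lt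
  nlinarith

theorem isPPrimitive_or_exists_lt_val_div_pow_sub_one {ε : ℕ}
    (he : v (p : L) = (((p - 1) * ε : ℤ) : WithTop ℤ)) {z : L} {m : ℤ} (hz : v (z - 1) = m)
    (hm0 : 0 < m) (hmε : m < p * ε) :
    IsPPrimitive p v z ∨
      ∃ s : L, v s = 0 ∧ ((m + 1 : ℤ) : WithTop ℤ) ≤ v (z / s ^ p - 1) := by
  have hp0 : (0 : ℤ) < p := by exact_mod_cast hp.out.pos
  by_cases hpm : (p : ℤ) ∣ m
  · obtain ⟨m, rfl⟩ := hpm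
    exact .inr (exists_le_val_div_pow_sub_one hv he (pos_of_mul_pos_right hm0 hp0.le)
      (lt_of_mul_lt_mul_left hmε hp0.le) hz)
  · exact .inl (isPPrimitive_of_map_sub_one hp.out.one_lt he hz hm0 hmε hpm)

/-- Each non-primitive `z` close to `1` is multiplied by a `p`-th power that brings it closer;
after finitely many steps it is so close that it is itself a `p`-th power. -/
theorem hasPPrimitiveDecomposition_of_le_val_sub_one {ω : L} (hω : IsPrimitiveRoot ω p) {z : L}
    (hz : ((1 : ℤ) : WithTop ℤ) ≤ v (z - 1)) : HasPPrimitiveDecomposition p v z := by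
  obtain ⟨ε, -, hε, he⟩ := exists_map_primitiveRoot_prime_sub_one hv hω
  suffices hstep : ∀ (d : ℕ) (z : L), ((1 : ℤ) : WithTop ℤ) ≤ v (z - 1) →
      ((p * ε - d : ℤ) : WithTop ℤ) ≤ v (z - 1) → HasPPrimitiveDecomposition p v z from
    hstep (p * ε) z hz (coe_le_of_coe_le hz (by push_cast; omega))
  intro d
  induction d with
  | zero =>
    intro z hz1 hzd
    obtain ⟨y, hy⟩ := exists_pow_eq_one_add hω hv (t := z - 1)
      (by simpa [map_pow_eq_coe v hε] using hzd)
    rw [add_sub_cancel] at hy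
    exact ⟨1, y, by rw [one_mul, hy], .inl rfl, (map_eq_zero_of_pow_eq v hp.out.ne_zero hy
      (map_eq_zero_of_one_le_map_sub_one v hz1)).ge⟩
  | succ d ih =>
    intro z hz1 hzd
    by_cases hd : ((p * ε - d : ℤ) : WithTop ℤ) ≤ v (z - 1)
    · exact ih z hz1 hd
    obtain ⟨m, hm⟩ := exists_map_eq_coe v (x := z - 1) fun h =>
      hd (le_top.trans_eq (by rw [h, v.map_zero]))
    rw [hm, WithTop.coe_le_coe] at hz1 hzd hd
    push_cast at hzd
    rcases isPPrimitive_or_exists_lt_val_div_pow_sub_one hv he hm (by omega) (by omega) with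
      hprim | ⟨s, hs, hzs⟩
    · exact hprim.hasPPrimitiveDecomposition
    · rw [← div_mul_cancel₀ z (pow_ne_zero p (ne_zero_of_map_eq_coe v (a := 0) hs))]
      exact (ih _ (coe_le_of_coe_le hzs (by omega))
        (coe_le_of_coe_le hzs (by omega))).mul_pow hs.ge

theorem hasPPrimitiveDecomposition_of_nonneg {ω : L} (hω : IsPrimitiveRoot ω p)
    {α : L} (hα : 0 ≤ v α) : HasPPrimitiveDecomposition p v α := by
  rcases eq_or_ne α 0 with rfl | hα0
  · exact ⟨1, 0, by rw [zero_pow hp.out.ne_zero, mul_zero], .inl rfl, hα⟩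
  obtain ⟨a, ha⟩ := exists_map_eq_coe v hα0
  by_cases hpa : (p : ℤ) ∣ a
  · obtain ⟨s, rfl⟩ := hpa
    obtain ⟨b, hb, hαb⟩ := exists_approx_pow hv ha
    have hbp : b ^ p ≠ 0 := pow_ne_zero p (ne_zero_of_map_eq_coe v hb)
    rw [← div_mul_cancel₀ α hbp]
    refine (hasPPrimitiveDecomposition_of_le_val_sub_one hv hω ?_).mul_pow ?_
    · rw [← div_self hbp, ← sub_div]
      exact coe_le_map_div v (a := 1) (by rwa [add_comm]) (map_pow_eq_coe v hb p)
    · rw [hb]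
      rw [ha] at hα
      have : 0 ≤ p * s := by exact_mod_cast hα
      exact_mod_cast nonneg_of_mul_nonneg_right this (by exact_mod_cast hp.out.pos)
  · exact IsPPrimitive.hasPPrimitiveDecomposition (.inl ⟨a, ha, hpa⟩)

end DecompositionExists

theorem hasPPrimitiveDecomposition_vn {p : ℕ} [hp : Fact p.Prime] {k : Type*} [Field k] [CharP k p]
    [IsAlgClosed k] (Ω : Type*) [Field Ω] [Algebra (K₀ p k) Ω] [IsAlgClosed Ω] {n : ℕ}
    {α : Kn p k Ω (n + 1)} (hα : 0 ≤ vn p k Ω (n + 1) α) :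
    HasPPrimitiveDecomposition p (vn p k Ω (n + 1)) α := by
  obtain ⟨ζ, hζ⟩ := exists_primitiveRoot_Kn (p := p) (k := k) Ω (n + 1)
  exact hasPPrimitiveDecomposition_of_nonneg (isNormalizedVal_vn Ω (n + 1))
    (hζ.pow (pow_pos hp.out.pos _) (pow_succ p n)) hα

end WittKummer

theorem corollary4p3_general (p : ℕ) [Fact p.Prime] (k : Type*) [Field k] [CharP k p]
    [IsAlgClosed k] (Ω : Type*) [Field Ω] [Algebra (WittKummer.K₀ p k) Ω] [IsAlgClosed Ω]
    [Algebra.IsAlgebraic (WittKummer.K₀ p k) Ω]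
    (ℓ c : ℕ) (hℓ : 1 ≤ ℓ) (hc : 1 ≤ c)
    (α : WittKummer.Kn p k Ω ℓ) (hα : 0 ≤ WittKummer.vn p k Ω ℓ α) :
    (∃ α' β : WittKummer.Kn p k Ω ℓ, α = α' * β ^ p ∧
      (α' = 1 ∨ WittKummer.IsPPrimitive p (WittKummer.vn p k Ω ℓ) α') ∧
      0 ≤ WittKummer.vn p k Ω ℓ β) ∧
    ∀ α' β : WittKummer.Kn p k Ω ℓ, α = α' * β ^ p →
      0 ≤ WittKummer.vn p k Ω ℓ β →
      ∀ x : Ω, x ^ p ^ c = (α : Ω) →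
      ((WittKummer.conductor (WittKummer.K₀ p k)
          (WittKummer.normVal p k (WittKummer.galoisClosure p k Ω (max ℓ c) x)) : ℝ) :
            WithBot ℝ) ≤
        max (((max ℓ c : ℝ) - 1 : ℝ) : WithBot ℝ)
          (max (WittKummer.boundTerm p ℓ ((c : ℝ) + ℓ - 1) (WittKummer.vn p k Ω ℓ (α' - 1)))
            (WittKummer.boundTerm p ℓ ((c : ℝ) + ℓ - 2) (WittKummer.vn p k Ω ℓ (β - 1)))) := by
  obtain ⟨n, rfl⟩ := Nat.exists_eq_add_of_le' hℓ
  obtain ⟨c, rfl⟩ := Nat.exists_eq_add_of_le' hc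
  refine ⟨WittKummer.hasPPrimitiveDecomposition_vn Ω hα, ?_⟩
  rintro α' β rfl hβ x hx
  have hmax : max (n + 1) (c + 1) = max n c + 1 := Nat.succ_max_succ n c
  have hm : (max (n + 1 : ℕ) (c + 1 : ℕ) : ℝ) - 1 = (max n c : ℕ) := by
    rw [← Nat.cast_max, hmax, Nat.cast_succ, add_sub_cancel_right]
  have h₁ : ((c + 1 : ℕ) : ℝ) + (n + 1 : ℕ) - 1 = c + n + 1 := by push_cast; ring
  have h₂ : ((c + 1 : ℕ) : ℝ) + (n + 1 : ℕ) - 2 = c + n := by push_cast; ring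
  rw [hm, hmax, h₁, h₂, ← max_assoc]
  set m : WithBot ℝ := (((max n c : ℕ) : ℝ) : WithBot ℝ)
  set b₁ := WittKummer.boundTerm p (n + 1) (c + n + 1) (WittKummer.vn p k Ω (n + 1) (α' - 1))
  set b₂ := WittKummer.boundTerm p (n + 1) (c + n) (WittKummer.vn p k Ω (n + 1) (β - 1))
  obtain ⟨B, hB⟩ : ∃ B : ℝ, B = max (max m b₁) b₂ := WithBot.ne_bot_iff_exists.1
    (ne_bot_of_le_ne_bot WithBot.coe_ne_bot (le_max_of_le_left (le_max_left m b₁)))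
  rw [← hB, WithBot.coe_le_coe]
  have hle : (m ≤ B ∧ b₁ ≤ B) ∧ b₂ ≤ B := by simp only [← max_le_iff, hB, le_rfl]
  exact WittKummer.conductor_galoisClosure_le Ω (le_max_left n c) (le_max_right n c) hα hβ hx
    (WithBot.coe_le_coe.1 hle.1.1) hle.1.2 hle.2

theorem corollary4p3 (p : ℕ) [Fact p.Prime] (k : Type*) [Field k] [CharP k p] [IsAlgClosed k]
    (Ω : Type*) [Field Ω] [Algebra (WittKummer.K₀ p k) Ω] [IsAlgClosed Ω]
    [Algebra.IsAlgebraic (WittKummer.K₀ p k) Ω]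
    (ℓ c : ℕ) (hℓ : 1 ≤ ℓ) (hc : 1 ≤ c)
    (α : WittKummer.Kn p k Ω ℓ) (hα : 0 ≤ WittKummer.vn p k Ω ℓ α) :
    (∃ α' β : WittKummer.Kn p k Ω ℓ, α = α' * β ^ p ∧
      (α' = 1 ∨ WittKummer.IsPPrimitive p (WittKummer.vn p k Ω ℓ) α') ∧
      0 ≤ WittKummer.vn p k Ω ℓ β) ∧
    ∀ α' β : WittKummer.Kn p k Ω ℓ, α = α' * β ^ p →
      (α' = 1 ∨ WittKummer.IsPPrimitive p (WittKummer.vn p k Ω ℓ) α') →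
      0 ≤ WittKummer.vn p k Ω ℓ β →
      ∀ x : Ω, x ^ p ^ c = (α : Ω) →
      ((WittKummer.conductor (WittKummer.K₀ p k)
          (WittKummer.normVal p k (WittKummer.galoisClosure p k Ω (max ℓ c) x)) : ℝ) :
            WithBot ℝ) ≤
        max (((max ℓ c : ℝ) - 1 : ℝ) : WithBot ℝ)
          (max (WittKummer.boundTerm p ℓ ((c : ℝ) + ℓ - 1) (WittKummer.vn p k Ω ℓ (α' - 1)))
            (WittKummer.boundTerm p ℓ ((c : ℝ) + ℓ - 2) (WittKummer.vn p k Ω ℓ (β - 1)))) := by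
  obtain ⟨hdecomp, hbound⟩ := corollary4p3_general p k Ω ℓ c hℓ hc α hα
  exact ⟨hdecomp, fun α' β h _ => hbound α' β h⟩
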